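/- **Conventions.** $\cosh^{-1}$ takes values with nonnegative real part and imaginary part in $(-\pi,\pi]$ (nonnegative imaginary part if the real part is $0$), and $\log$ has imaginary part in $(-\pi,\pi]$. For $x\in\mathbf C$ put $l(x)=2\cosh^{-1}(x/2)$. For $\tau\in\mathbf C$ put $\nu=\cosh^{-1}(-\tau/2)$ and, for $x^2\neq\tau+2$, $$\mathfrak h_\tau(x)=\log\frac{e^{\nu}+e^{l(x)}}{e^{-\nu}+e^{l(x)}}.$$ Let $\Gamma=\langle a,b\rangle$ be the fundamental group of the once-punctured torus, a free group on two generators. Write $g\sim h$ if $g$ is conjugate to $h$ or $h^{-1}$, and let $\hat\Omega\subset\Gamma/\!\sim$ be the set of classes of essential (non-trivial, non-peripheral) simple closed curves, that is, of classes of elements of $\Gamma$ that belong to a free basis. A $\tau$-representation is a homomorphism $\rho:\Gamma\to\mathrm{SL}(2,\mathbf C)$ with $\mathrm{tr}\,\rho(aba^{-1}b^{-1})=\tau$. An element $H\in\mathrm{SL}(2,\mathbf Z)$ is hyperbolic if $|\mathrm{tr}\,H|>2$. The group $\mathrm{SL}(2,\mathbf Z)$ is identified with the mapping class group of the once-punctured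 torus: $H$ induces an automorphism $H_*$ of $\Gamma$, well defined up to inner automorphisms, which acts on the abelianization $\mathbf Z^2$ of $\Gamma$ by the matrix $H$. The representation $\rho$ is stabilized by $H$ if $\rho\circ H_*$ is conjugate to $\rho$ in $\mathrm{SL}(2,\mathbf C)$; then $[g]\mapsto\mathrm{tr}\,\rho(g)$ is well defined on $\hat\Omega/\langle H_*\rangle$. Let $\Omega=\mathbf Q\cup\{\infty\}$ be the set of vertices of the Farey triangulation (equivalently, of complementary regions of its dual tree), where $p/q$ and $r/s$ (in lowest terms, $\infty=1/0$) are neighbours if $ps-rq=\pm1$; $\mathrm{SL}(2,\mathbf Z)$ acts on $\Omega$ by Möbius transformations. A $\mu$-Markoff map is a function $\phi:\Omega\to\mathbf C$ such that $\phi(X)^2+\phi(Y)^2+\phi(Z)^2-\phi(X)\phi(Y)\phi(Z)=\mu$ whenever $X,Y,Z$ are pairwise neighbours, and $\phi(X)\phi(Y)=\phi(Z)+\phi(W)$ whenever $X,Y$ are neighbours and $Z\ne W$ are the two common neighbours of $X$ and $Y$. If $\phi(HX)=\phi(X)$ for all $X\in\Omega$, then $\phi$ is called invariant under $H$ and it induces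 a function $[X]\mapsto\phi(X)$ on $\Omega/\langle H\rangle$. **Theorem.** Let $H\in\mathrm{SL}(2,\mathbf Z)$ be hyperbolic. (a) Let $\tau\neq2$ and let $\rho:\Gamma\to\mathrm{SL}(2,\mathbf C)$ be a $\tau$-representation stabilized by $H$ such that (i) $\mathrm{tr}\,\rho(g)\notin[-2,2]$ for all $[g]\in\hat\Omega/\langle H_*\rangle$, and (ii) $|\mathrm{tr}\,\rho(g)|\le2$ for only finitely many $[g]\in\hat\Omega/\langle H_*\rangle$. Then $(\mathrm{tr}\,\rho(g))^2\neq\tau+2$ for all $[g]\in\hat\Omega/\langle H_*\rangle$, so that $\mathfrak h_\tau(\mathrm{tr}\,\rho(g))$ is defined, and $$\sum_{[g]\in\hat\Omega/\langle H_*\rangle}\mathfrak h_\tau(\mathrm{tr}\,\rho(g))\in 2\pi i\,\mathbf Z,$$ where the sum converges absolutely. (b) Let $\mu\neq4$ and let $\phi$ be a $\mu$-Markoff map that is invariant under $H$ and such that (i) $\phi(X)\notin[-2,2]$ for all $[X]\in\Omega/\langle H\rangle$, and (ii) $|\phi(X)|\le2$ for only finitely many $[X]\in\Omega/\langle H\rangle$.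 Then $\phi(X)^2\neq\mu$ for all $[X]\in\Omega/\langle H\rangle$, so that $\mathfrak h_{\mu-2}(\phi(X))$ is defined, and $$\sum_{[X]\in\Omega/\langle H\rangle}\mathfrak h_{\mu-2}(\phi(X))\in 2\pi i\,\mathbf Z,$$ where the sum converges absolutely. -/

import Mathlib

open scoped MatrixGroups

noncomputable section

namespace PuncturedTorus

/-! ### The functions `cosh⁻¹`, `l` and `𝔥` -/

/-- The inverse hyperbolic cosine with values of nonnegative real part and with imaginary part
in `(-π, π]` (and in `[0, π]` when the real part is `0`). -/
def arcosh (z : ℂ) : ℂ :=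
  Complex.log (z + (z + 1) ^ (1 / 2 : ℂ) * (z - 1) ^ (1 / 2 : ℂ))

/-- The complex length `l(x) = 2 cosh⁻¹(x/2)`. -/
def complexLength (x : ℂ) : ℂ := 2 * arcosh (x / 2)

/-- `ν = cosh⁻¹(-τ/2)`. -/
def halfBoundaryLength (τ : ℂ) : ℂ := arcosh (-τ / 2)

/-- `𝔥_τ(x) = log ((e^ν + e^{l(x)}) / (e^{-ν} + e^{l(x)}))`, with the principal branch of the
logarithm; meaningful for `x² ≠ τ + 2`. -/
def gap (τ x : ℂ) : ℂ :=
  Complex.log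
    ((Complex.exp (halfBoundaryLength τ) + Complex.exp (complexLength x)) /
      (Complex.exp (-halfBoundaryLength τ) + Complex.exp (complexLength x)))

/-! ### Functions on a quotient by a cyclic group, and the BQ-conditions -/

/-- The set of orbits of the cyclic group `⟨g⟩` acting on `C`. -/
abbrev CyclicQuotient {G : Type*} [Group G] (C : Type*) [MulAction G C] (g : G) : Type _ :=
  MulAction.orbitRel.Quotient (Subgroup.zpowers g) C

theorem apply_zpow_smul {G C : Type*} [Group G] [MulAction G C] (g : G) (f : C → ℂ)
    (hf : ∀ c, f (g • c) = f c) (n : ℤ) (c : C) : f (g ^ n • c) = f c := by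
  induction n using Int.induction_on with
  | zero => simp
  | succ i ih => rw [add_comm, zpow_add, zpow_one, mul_smul, hf, ih]
  | pred i ih => rw [← hf, ← mul_smul, ← zpow_one_add, add_sub_cancel, ih]

/-- The function induced on the `⟨g⟩`-orbits by a `g`-invariant function. -/
def orbitLift {G C : Type*} [Group G] [MulAction G C] (g : G) (f : C → ℂ)
    (hf : ∀ c, f (g • c) = f c) : CyclicQuotient C g → ℂ :=
  Quotient.lift f (by
    rintro x y ⟨⟨k, n, rfl⟩, rfl⟩
    exact apply_zpow_smul g f hf n y)

/-- The BQ-conditions for a complex valued function: (BQ1) it takes no value in the real interval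
`[-2, 2]`, and (BQ2) it has modulus at most `2` at only finitely many points. -/
def SatisfiesBQ {C : Type*} (f : C → ℂ) : Prop :=
  (∀ c, f c ∉ Complex.ofReal '' Set.Icc (-2 : ℝ) 2) ∧ {c | ‖f c‖ ≤ 2}.Finite

/-! ### The punctured torus group and its simple closed curves -/

/-- The fundamental group `Γ = ⟨a, b⟩` of the once-punctured torus, free on
`a = of 0` and `b = of 1`. -/
abbrev Γ : Type := FreeGroup (Fin 2)

/-- `g ∼ h` if and only if `g` is conjugate to `h` or to `h⁻¹`. -/
def curveSetoid : Setoid Γ where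
  r g h := IsConj g h ∨ IsConj g h⁻¹
  iseqv :=
    { refl := fun g => Or.inl (IsConj.refl g)
      symm := by
        rintro g h (hc | hc)
        · exact Or.inl hc.symm
        · refine Or.inr ?_
          obtain ⟨c, hc⟩ := isConj_iff.1 hc.symm
          exact isConj_iff.2 ⟨c, by rw [← hc]; group⟩
      trans := by
        have inv : ∀ {g h : Γ}, IsConj g h → IsConj g⁻¹ h⁻¹ := by
          intro g h hc
          obtain ⟨c, hc⟩ := isConj_iff.1 hc
          exact isConj_iff.2 ⟨c, by rw [← hc]; group⟩
        rintro g h k (h1 | h1) (h2 | h2)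
        · exact Or.inl (h1.trans h2)
        · exact Or.inr (h1.trans h2)
        · exact Or.inr (h1.trans (inv h2))
        · exact Or.inl (h1.trans (by simpa using inv h2)) }

/-- `Γ/∼`: the free homotopy classes of unoriented closed curves on the torus. -/
abbrev Curve : Type := Quotient curveSetoid

/-- `g` is a member of a free basis of `Γ`, i.e. the image of `a` under an automorphism. -/
def IsPrimitive (g : Γ) : Prop := ∃ α : MulAut Γ, α (FreeGroup.of 0) = g

/-- Automorphisms of `Γ` act on classes of closed curves. -/
instance : MulAction (MulAut Γ) Curve where
  smul α := Quotient.map α (by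
    rintro g h (hc | hc)
    · exact Or.inl (α.toMonoidHom.map_isConj hc)
    · refine Or.inr ?_
      rw [← map_inv]
      exact α.toMonoidHom.map_isConj hc)
  one_smul := by rintro ⟨g⟩; rfl
  mul_smul := by rintro α β ⟨g⟩; rfl

/-- The set `Ω̂` of classes of essential (non-trivial, non-peripheral) simple closed curves on the
once-punctured torus: these are the classes in `Γ/∼` of the primitive elements of `Γ`. -/
def SimpleCurve : Type := {c : Curve // ∃ g : Γ, IsPrimitive g ∧ Quotient.mk _ g = c}

/-- Automorphisms of `Γ` act on `Ω̂`. -/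
instance : MulAction (MulAut Γ) SimpleCurve where
  smul α c := ⟨α • c.1, by
    obtain ⟨g, ⟨β, hβ⟩, hg⟩ := c.2
    exact ⟨α g, ⟨α * β, by rw [← hβ]; rfl⟩, by rw [← hg]; rfl⟩⟩
  one_smul c := Subtype.ext (one_smul _ c.1)
  mul_smul α β c := Subtype.ext (mul_smul α β c.1)

/-! ### Representations -/

/-- `ρ` is a `τ`-representation: `tr ρ([a, b]) = τ` with `[a, b] = a b a⁻¹ b⁻¹`. -/
def IsTauRepresentation (τ : ℂ) (ρ : Γ →* SL(2, ℂ)) : Prop :=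
  (ρ (FreeGroup.of 0 * FreeGroup.of 1 * (FreeGroup.of 0)⁻¹ * (FreeGroup.of 1)⁻¹)).val.trace = τ

theorem trace_eq_of_isConj {A B : SL(2, ℂ)} (h : IsConj A B) : A.val.trace = B.val.trace := by
  obtain ⟨c, rfl⟩ := isConj_iff.1 h
  rw [Matrix.SpecialLinearGroup.coe_mul, Matrix.trace_mul_comm,
    ← Matrix.SpecialLinearGroup.coe_mul, inv_mul_cancel_left]

theorem trace_inv (A : SL(2, ℂ)) : (A⁻¹).val.trace = A.val.trace := by
  rw [Matrix.SpecialLinearGroup.SL2_inv_expl, Matrix.trace_fin_two, Matrix.trace_fin_two]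
  simp [add_comm]

/-- The trace `tr ρ(g)` as a function of the class `[g] ∈ Γ/∼`. -/
def curveTrace (ρ : Γ →* SL(2, ℂ)) : Curve → ℂ :=
  Quotient.lift (fun g => (ρ g).val.trace) (by
    rintro g h (hc | hc)
    · exact trace_eq_of_isConj (ρ.map_isConj hc)
    · have := trace_eq_of_isConj (ρ.map_isConj hc)
      rwa [map_inv, trace_inv] at this)

/-- The class of `g` in the abelianization `ℤ²` of `Γ`: the exponent sums of `a` and `b`. -/
def exponentSum (g : Γ) : Fin 2 → ℤ :=
  (FreeGroup.lift (fun i : Fin 2 => Multiplicative.ofAdd (Pi.single i 1 : Fin 2 → ℤ)) g).toAdd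

/-- `α` is an automorphism `H_*` of `Γ` induced by the mapping class `H ∈ SL(2, ℤ)`: it acts on the
abelianization `ℤ²` by the matrix `H`. (The mapping class group of the once-punctured torus is
identified with `SL(2, ℤ)` in this way, and `H` determines `α` up to inner automorphisms.) -/
def IsInducedBy (α : MulAut Γ) (H : SL(2, ℤ)) : Prop :=
  ∀ g : Γ, exponentSum (α g) = H.val.mulVec (exponentSum g)

/-- The class of `ρ` modulo conjugation is fixed by `α`: the representation `ρ ∘ α` is conjugate
to `ρ` in `SL(2, ℂ)`. -/
def IsStabilizedBy (ρ : Γ →* SL(2, ℂ)) (α : MulAut Γ) : Prop :=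
  ∃ P : SL(2, ℂ), ∀ g : Γ, ρ (α g) = P * ρ g * P⁻¹

theorem curveTrace_smul {ρ : Γ →* SL(2, ℂ)} {α : MulAut Γ} (h : IsStabilizedBy ρ α)
    (c : SimpleCurve) : curveTrace ρ (α • c).1 = curveTrace ρ c.1 := by
  obtain ⟨P, hP⟩ := h
  obtain ⟨⟨g⟩, hc⟩ := c
  exact (trace_eq_of_isConj (isConj_iff.2 ⟨P, (hP g).symm⟩)).symm

/-- The trace function `[g] ↦ tr ρ(g)` on `Ω̂/⟨α⟩`, for `ρ` stabilized by `α`. -/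
def orbitTrace (ρ : Γ →* SL(2, ℂ)) (α : MulAut Γ) (h : IsStabilizedBy ρ α) :
    CyclicQuotient SimpleCurve α → ℂ :=
  orbitLift α (fun c => curveTrace ρ c.1) (curveTrace_smul h)

/-! ### Generalized Markoff maps -/

/-- The set `Ω` of complementary regions of the binary tree `Σ` dual to the Farey triangulation;
the regions correspond to the vertices `ℚ ∪ {∞}` of the triangulation. -/
abbrev Region : Type := OnePoint ℚ

/-- The numerator `p` of a region `p/q` in lowest terms, with `∞ = 1/0`. -/
def Region.num : Region → ℤ
  | none => 1
  | some q => q.num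

/-- The denominator `q ≥ 0` of a region `p/q` in lowest terms, with `∞ = 1/0`. -/
def Region.den : Region → ℤ
  | none => 0
  | some q => q.den

/-- `p/q` and `r/s` are Farey neighbours if `ps - rq = ±1`, that is, if the two regions meet along
an edge of `Σ`. -/
def FareyNeighbors (X Y : Region) : Prop := |X.num * Y.den - Y.num * X.den| = 1

/-- `φ` is a `μ`-Markoff map. Three regions meet at a vertex of `Σ` when they are pairwise Farey
neighbours (the corners of a Farey triangle), and an edge `X ∩ Y` has its two endpoints on the
two regions `Z ≠ W` that are Farey neighbours of both `X` and `Y`. -/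
def IsMarkoffMap (μ : ℂ) (φ : Region → ℂ) : Prop :=
  (∀ X Y Z : Region, FareyNeighbors X Y → FareyNeighbors Y Z → FareyNeighbors Z X →
    φ X ^ 2 + φ Y ^ 2 + φ Z ^ 2 - φ X * φ Y * φ Z = μ) ∧
  (∀ X Y Z W : Region, FareyNeighbors X Y → FareyNeighbors X Z → FareyNeighbors Y Z →
    FareyNeighbors X W → FareyNeighbors Y W → Z ≠ W → φ X * φ Y = φ Z + φ W)

/-- `H ∈ SL(2, ℤ)` as an element of `GL(2, ℚ)`, which acts on `ℚ ∪ {∞}` by Möbius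
transformations. -/
abbrev moebius (H : SL(2, ℤ)) : GL (Fin 2) ℚ := Matrix.SpecialLinearGroup.mapGL ℚ H

/-- The function `[X] ↦ φ(X)` on `Ω/⟨H⟩`, for `φ` invariant under `H`. -/
def orbitMarkoff (φ : Region → ℂ) (H : SL(2, ℤ)) (h : ∀ X : Region, φ (moebius H • X) = φ X) :
    CyclicQuotient Region (moebius H) → ℂ :=
  orbitLift (moebius H) φ h

end PuncturedTorus

end

/-!
## Why the identity holds

**Markoff maps.** An edge of the dual tree of the Farey triangulation separates two regions with
values `x`, `y`, and its endpoints lie on two further regions with values `w` and `z = x y - w`.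
With `α = exp (cosh⁻¹ (x / 2))`, `κ = exp ν` and `g(x) = α + κ / α` one has
`exp (𝔥(x)) = g(x)² / (x² - μ)`, and the edge function
`ratio = (x y + (κ - 1) w) / (g(x) g(y))` satisfies the cocycle relation
`ratio e = exp (𝔥(z)) * ratio e.left * ratio e.right`, in which `e.left`, `e.right` are the two
edges following `e` (`EdgeTriple.ratio_eq_exp_gap_mul`). If the sum of `𝔥` over all regions beyond
`e` converges, one therefore expects `exp (∑ 𝔥) = ratio e` (`EdgeTriple.HasIdentity`); the quotient
of the two sides, `EdgeTriple.defect`, is multiplicative along the tree. The identity is proved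

* for edges whose values are large (`EdgeTriple.exists_isLarge_hasIdentity`), since `log defect` is
  bounded by a weight whose total over the edges at depth `n` tends to zero;
* for the edges going around a fixed region far enough out
  (`EdgeTriple.exists_left_iterate_hasIdentity`), because the values around a region grow
  exponentially when its value is outside `[-2, 2]`;
* in general (`EdgeTriple.IsAdmissible.hasIdentity_of_finite`), because an edge where it fails is
  followed by one where it fails, and an infinite path of such edges would have to run through
  values of modulus tending to `2`, which forces `μ = 4`
  (`EdgeTriple.eq_two_of_descending_path`).

A hyperbolic `H` is conjugate, up to sign, to a product of the two elementary parabolic matrices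
(`exists_conj_pos`), that is, to a word `W` in the two turns of the tree. Hence `H` translates some
edge `e` to an edge `e'` behind it, and the regions between the two are representatives of the
orbits of `H` (`bijective_node`). Dividing the identities of `e` and of `e'` gives
`exp (∑ 𝔥) = ratio e / ratio e'`, which is `1` as `e` and `e'` carry the same values
(`orbitMarkoff_identity`).

**Representations.** Nielsen's theorem in rank two (`closure_nielsen_eq_top`) is obtained from a
cancellation argument for a shortest pair of generators. Given the generators of the automorphism
group, the Euclidean algorithm produces for each slope one class of words on which automorphisms
act as on homology (`smul_curveOfHomology`), so that simple closed curves correspond to slopes,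
equivariantly (`bijective_curveSlope`, `curveSlope_smul`). The trace as a function of the slope is a
generalized Markoff map by Fricke's trace identity (`isMarkoffMap_slopeTrace`), and the first part
of the theorem follows from the second.
-/

noncomputable section

namespace PuncturedTorus

/-! ### The eigenvalue `λ(x)` and the gap function -/

/-- The eigenvalue of modulus at least one of a matrix in `SL(2, ℂ)` of trace `x`; thus
`exp (l(x)) = λ(x)²`. -/
def eigenvalue (x : ℂ) : ℂ := Complex.exp (arcosh (x / 2))

/-- `κ = exp ν`, a root of `κ² + τ κ + 1 = 0`. -/
def boundaryEigenvalue (τ : ℂ) : ℂ := Complex.exp (halfBoundaryLength τ)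

/-- The square root of `(x² - τ - 2) · exp (𝔥_τ(x))` given by `λ(x) + κ / λ(x)`. -/
def gapRoot (τ x : ℂ) : ℂ := eigenvalue x + boundaryEigenvalue τ / eigenvalue x

theorem sqrt_mul_sqrt_sq (z : ℂ) :
    ((z + 1) ^ (1 / 2 : ℂ) * (z - 1) ^ (1 / 2 : ℂ)) ^ 2 = z ^ 2 - 1 := by
  have h (w : ℂ) : (w ^ (1 / 2 : ℂ)) ^ 2 = w := by
    rw [← Complex.cpow_nat_mul]; norm_num
  rw [mul_pow, h, h]; ring

theorem exp_arcosh_mul (z : ℂ) :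
    (z + (z + 1) ^ (1 / 2 : ℂ) * (z - 1) ^ (1 / 2 : ℂ)) *
      (z - (z + 1) ^ (1 / 2 : ℂ) * (z - 1) ^ (1 / 2 : ℂ)) = 1 := by
  linear_combination - sqrt_mul_sqrt_sq z

theorem exp_arcosh (z : ℂ) :
    Complex.exp (arcosh z) = z + (z + 1) ^ (1 / 2 : ℂ) * (z - 1) ^ (1 / 2 : ℂ) := by
  rw [arcosh, Complex.exp_log]
  intro h
  have := exp_arcosh_mul z
  rw [h] at this; simp at this

theorem exp_arcosh_add_inv (z : ℂ) :
    Complex.exp (arcosh z) + (Complex.exp (arcosh z))⁻¹ = 2 * z := by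
  have h : (Complex.exp (arcosh z))⁻¹ =
      z - (z + 1) ^ (1 / 2 : ℂ) * (z - 1) ^ (1 / 2 : ℂ) := by
    rw [exp_arcosh]; exact inv_eq_of_mul_eq_one_right (exp_arcosh_mul z)
  rw [h, exp_arcosh]; ring

theorem re_sqrt_mul_conj_sqrt_nonneg {v w : ℂ} (h : v.im = w.im) :
    0 ≤ (v ^ (1 / 2 : ℂ) * (starRingEnd ℂ) (w ^ (1 / 2 : ℂ))).re := by
  -- principal square roots lie in the closed right half plane, on the same side of the real
  -- axis as their squares
  have key (u : ℂ) : 0 ≤ (u ^ (1 / 2 : ℂ)).re ∧ (0 ≤ u.im → 0 ≤ (u ^ (1 / 2 : ℂ)).im) ∧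
      (u.im < 0 → (u ^ (1 / 2 : ℂ)).im ≤ 0) := by
    have e : (1 / 2 : ℂ) = ((1 / 2 : ℝ) : ℂ) := by norm_num
    rw [e, Complex.cpow_ofReal]
    have h1 := Complex.neg_pi_lt_arg u
    have h2 := Complex.arg_le_pi u
    have h3 : 0 ≤ ‖u‖ ^ (1 / 2 : ℝ) := by positivity
    refine ⟨?_, fun hu => ?_, fun hu => ?_⟩
    · simp only [Complex.add_re, Complex.ofReal_re, Complex.I_re, Complex.mul_re,
        Complex.ofReal_im]
      have : 0 ≤ Real.cos (u.arg * (1 / 2)) := Real.cos_nonneg_of_mem_Icc ⟨by linarith, by linarith⟩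
      nlinarith [mul_nonneg h3 this]
    · have h4 := Complex.arg_nonneg_iff.2 hu
      have : 0 ≤ Real.sin (u.arg * (1 / 2)) :=
        Real.sin_nonneg_of_nonneg_of_le_pi (by linarith) (by linarith)
      simp only [Complex.add_im, Complex.ofReal_re, Complex.I_re, Complex.I_im, Complex.mul_im,
        Complex.ofReal_im]
      nlinarith [mul_nonneg h3 this]
    · have h4 := Complex.arg_neg_iff.2 hu
      have : Real.sin (u.arg * (1 / 2)) ≤ 0 :=
        Real.sin_nonpos_of_nonpos_of_neg_pi_le (by linarith) (by linarith)
      simp only [Complex.add_im, Complex.ofReal_re, Complex.I_re, Complex.I_im, Complex.mul_im,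
        Complex.ofReal_im]
      nlinarith [mul_nonpos_of_nonneg_of_nonpos h3 this]
  obtain ⟨a1, a2, a3⟩ := key v
  obtain ⟨b1, b2, b3⟩ := key w
  simp only [Complex.mul_re, Complex.conj_re, Complex.conj_im]
  rcases le_or_gt 0 v.im with hv | hv
  · nlinarith [mul_nonneg a1 b1, mul_nonneg (a2 hv) (b2 (h ▸ hv))]
  · nlinarith [mul_nonneg a1 b1, mul_nonneg_of_nonpos_of_nonpos (a3 hv) (b3 (h ▸ hv))]

theorem one_le_norm_exp_arcosh (z : ℂ) : 1 ≤ ‖Complex.exp (arcosh z)‖ := by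
  set p := (z + 1) ^ (1 / 2 : ℂ) with hp
  set q := (z - 1) ^ (1 / 2 : ℂ) with hq
  have hpq : 0 ≤ (p * (starRingEnd ℂ) q).re := re_sqrt_mul_conj_sqrt_nonneg (by simp)
  have h2 (w : ℂ) : (w ^ (1 / 2 : ℂ)) ^ 2 = w := by
    rw [← Complex.cpow_nat_mul]; norm_num
  have hz : z = (p ^ 2 + q ^ 2) / 2 := by rw [hp, hq, h2, h2]; ring
  have hmul := congrArg norm (exp_arcosh_mul z)
  rw [norm_mul, norm_one, ← hp, ← hq] at hmul
  rw [exp_arcosh, ← hp, ← hq]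
  -- `z + pq = (p + q)² / 2` and `z - pq = (p - q)² / 2`
  have e1 : z + p * q = (p + q) ^ 2 / 2 := by rw [hz]; ring
  have e2 : z - p * q = (p - q) ^ 2 / 2 := by rw [hz]; ring
  have hle : ‖p - q‖ ^ 2 ≤ ‖p + q‖ ^ 2 := by
    rw [← Complex.normSq_eq_norm_sq, ← Complex.normSq_eq_norm_sq, Complex.normSq_add,
      Complex.normSq_sub]
    linarith
  have hle' : ‖z - p * q‖ ≤ ‖z + p * q‖ := by
    rw [e1, e2, norm_div, norm_div, norm_pow, norm_pow]; gcongr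
  nlinarith [norm_nonneg (z - p * q), norm_nonneg (z + p * q)]

theorem eigenvalue_ne_zero (x : ℂ) : eigenvalue x ≠ 0 := Complex.exp_ne_zero _

theorem eigenvalue_add_inv (x : ℂ) : eigenvalue x + (eigenvalue x)⁻¹ = x := by
  rw [eigenvalue, exp_arcosh_add_inv]; ring

theorem one_le_norm_eigenvalue (x : ℂ) : 1 ≤ ‖eigenvalue x‖ := one_le_norm_exp_arcosh _

theorem one_lt_norm_eigenvalue {x : ℂ} (hx : x ∉ Complex.ofReal '' Set.Icc (-2 : ℝ) 2) :
    1 < ‖eigenvalue x‖ := by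
  refine lt_of_le_of_ne (one_le_norm_eigenvalue x) fun h => hx ?_
  have h1 : (eigenvalue x)⁻¹ = (starRingEnd ℂ) (eigenvalue x) := Complex.inv_eq_conj h.symm
  have h2 := eigenvalue_add_inv x
  rw [h1, Complex.add_conj] at h2
  have h3 := Complex.abs_re_le_norm (eigenvalue x)
  rw [← h, abs_le] at h3
  exact ⟨2 * (eigenvalue x).re, ⟨by linarith [h3.1], by linarith [h3.2]⟩, by exact_mod_cast h2⟩

theorem boundaryEigenvalue_ne_zero (τ : ℂ) : boundaryEigenvalue τ ≠ 0 := Complex.exp_ne_zero _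

theorem boundaryEigenvalue_add_inv (τ : ℂ) :
    boundaryEigenvalue τ + (boundaryEigenvalue τ)⁻¹ = -τ := by
  rw [boundaryEigenvalue, halfBoundaryLength, exp_arcosh_add_inv]; ring

theorem boundaryEigenvalue_sq (τ : ℂ) :
    boundaryEigenvalue τ ^ 2 + τ * boundaryEigenvalue τ + 1 = 0 := by
  have h := boundaryEigenvalue_add_inv τ
  have h0 := boundaryEigenvalue_ne_zero τ
  field_simp at h
  linear_combination h

/-- The product of the numerator and denominator of `exp (𝔥_τ(x))` is a multiple of
`x² - τ - 2`. -/
theorem gap_num_mul_den (τ x : ℂ) :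
    (eigenvalue x + boundaryEigenvalue τ / eigenvalue x) *
      (eigenvalue x + (boundaryEigenvalue τ)⁻¹ / eigenvalue x) = x ^ 2 - (τ + 2) := by
  have h0 := eigenvalue_ne_zero x
  have h1 := eigenvalue_add_inv x
  have k0 := boundaryEigenvalue_ne_zero τ
  have k1 := boundaryEigenvalue_add_inv τ
  have : (eigenvalue x + boundaryEigenvalue τ / eigenvalue x) *
      (eigenvalue x + (boundaryEigenvalue τ)⁻¹ / eigenvalue x) =
      (eigenvalue x + (eigenvalue x)⁻¹) ^ 2 - 2 +
        (boundaryEigenvalue τ + (boundaryEigenvalue τ)⁻¹) := by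
    field_simp; ring
  rw [this, h1, k1]; ring

theorem gapRoot_ne_zero {τ x : ℂ} (hx : x ^ 2 ≠ τ + 2) : gapRoot τ x ≠ 0 := by
  intro h
  have := gap_num_mul_den τ x
  rw [← gapRoot, h, zero_mul] at this
  exact hx (sub_eq_zero.1 this.symm)

theorem gap_eq_log (τ x : ℂ) : gap τ x =
    Complex.log ((boundaryEigenvalue τ + eigenvalue x ^ 2) /
      ((boundaryEigenvalue τ)⁻¹ + eigenvalue x ^ 2)) := by
  rw [gap, boundaryEigenvalue, eigenvalue, complexLength, Complex.exp_neg, two_mul,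
    Complex.exp_add, sq]

theorem exp_gap {τ x : ℂ} (hx : x ^ 2 ≠ τ + 2) :
    Complex.exp (gap τ x) = gapRoot τ x ^ 2 / (x ^ 2 - (τ + 2)) := by
  have h0 := eigenvalue_ne_zero x
  have h1 := gap_num_mul_den τ x
  have h2 : gapRoot τ x = (boundaryEigenvalue τ + eigenvalue x ^ 2) / eigenvalue x := by
    rw [gapRoot]; field_simp; ring
  have h3 : eigenvalue x + (boundaryEigenvalue τ)⁻¹ / eigenvalue x =
      ((boundaryEigenvalue τ)⁻¹ + eigenvalue x ^ 2) / eigenvalue x := by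
    rw [add_div, sq, mul_div_assoc, div_self h0]; ring
  have h4 := sub_ne_zero.2 hx
  rw [← h1] at h4
  have h5 := left_ne_zero_of_mul h4
  have h6 := right_ne_zero_of_mul h4
  rw [← gapRoot, h2] at h5
  rw [h3] at h6
  have h7 := (div_ne_zero_iff.1 h5).1
  have h8 := (div_ne_zero_iff.1 h6).1
  rw [gap_eq_log, Complex.exp_log (div_ne_zero h7 h8), ← h1, ← gapRoot, h2, h3]
  generalize boundaryEigenvalue τ + eigenvalue x ^ 2 = A at *
  generalize (boundaryEigenvalue τ)⁻¹ + eigenvalue x ^ 2 = B at *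
  field_simp

theorem norm_sub_one_le_norm_eigenvalue (x : ℂ) : ‖x‖ - 1 ≤ ‖eigenvalue x‖ := by
  have h1 := one_le_norm_eigenvalue x
  have h2 : ‖(eigenvalue x)⁻¹‖ ≤ 1 := by rw [norm_inv]; exact inv_le_one_of_one_le₀ h1
  have h3 := norm_add_le (eigenvalue x) (eigenvalue x)⁻¹
  rw [eigenvalue_add_inv] at h3
  linarith

theorem norm_eigenvalue_le (x : ℂ) : ‖eigenvalue x‖ ≤ ‖x‖ + 1 := by
  have h1 := one_le_norm_eigenvalue x
  have h2 : ‖(eigenvalue x)⁻¹‖ ≤ 1 := by rw [norm_inv]; exact inv_le_one_of_one_le₀ h1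
  have h3 := norm_sub_le x (eigenvalue x)⁻¹
  rw [← eq_sub_iff_add_eq.2 (eigenvalue_add_inv x)] at h3
  linarith

/-- `𝔥_τ(x) = O(|x|⁻²)` as `x → ∞`. -/
theorem exists_norm_gap_le (τ : ℂ) :
    ∃ R C : ℝ, 0 ≤ C ∧ ∀ x : ℂ, R ≤ ‖x‖ → ‖gap τ x‖ ≤ C / ‖x‖ ^ 2 := by
  set κ := boundaryEigenvalue τ with hκ
  refine ⟨2 + 8 * ‖κ‖ + 16 * ‖κ⁻¹‖, 12 * ‖κ - κ⁻¹‖, by positivity, fun x hx => ?_⟩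
  have n1 := norm_nonneg κ
  have n2 := norm_nonneg κ⁻¹
  have hx2 : 2 ≤ ‖x‖ := by linarith
  have hl : ‖x‖ / 2 ≤ ‖eigenvalue x‖ := by linarith [norm_sub_one_le_norm_eigenvalue x]
  have hl2 : ‖x‖ ^ 2 / 4 ≤ ‖eigenvalue x ^ 2‖ := by
    rw [norm_pow]; nlinarith
  have hd : ‖x‖ ^ 2 / 8 ≤ ‖κ⁻¹ + eigenvalue x ^ 2‖ := by
    have := norm_sub_le (κ⁻¹ + eigenvalue x ^ 2) κ⁻¹
    rw [add_sub_cancel_left] at this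
    nlinarith
  have hd0 : 0 < ‖κ⁻¹ + eigenvalue x ^ 2‖ := lt_of_lt_of_le (by positivity) hd
  have hne : κ⁻¹ + eigenvalue x ^ 2 ≠ 0 := norm_pos_iff.1 hd0
  have e : (κ + eigenvalue x ^ 2) / (κ⁻¹ + eigenvalue x ^ 2) =
      1 + (κ - κ⁻¹) / (κ⁻¹ + eigenvalue x ^ 2) := by
    rw [div_eq_iff hne, add_mul, div_mul_cancel₀ _ hne]; ring
  have hb : ‖(κ - κ⁻¹) / (κ⁻¹ + eigenvalue x ^ 2)‖ ≤ 8 * ‖κ - κ⁻¹‖ / ‖x‖ ^ 2 := by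
    rw [norm_div, div_le_div_iff₀ hd0 (by positivity)]
    nlinarith [norm_nonneg (κ - κ⁻¹)]
  have hs : 8 * ‖κ - κ⁻¹‖ / ‖x‖ ^ 2 ≤ 1 / 2 := by
    rw [div_le_iff₀ (by positivity)]
    have := norm_sub_le κ κ⁻¹
    nlinarith
  rw [gap_eq_log, ← hκ, e]
  refine (Complex.norm_log_one_add_half_le_self (hb.trans hs)).trans ?_
  calc 3 / 2 * ‖(κ - κ⁻¹) / (κ⁻¹ + eigenvalue x ^ 2)‖ ≤ 3 / 2 * (8 * ‖κ - κ⁻¹‖ / ‖x‖ ^ 2) := by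
        gcongr
    _ = _ := by ring

/-! ### Markoff triples on a rooted binary tree -/

/-- The values of a generalized Markoff map around an oriented edge of the binary tree: `x` and `y`
on the two regions meeting along the edge, and `w` on the region at its tail. -/
structure EdgeTriple where
  /-- The value on the first region along the edge. -/
  x : ℂ
  /-- The value on the second region along the edge. -/
  y : ℂ
  /-- The value on the region at the tail of the edge. -/
  w : ℂ

namespace EdgeTriple

/-- The value on the region at the head of the edge. -/
def z (s : EdgeTriple) : ℂ := s.x * s.y - s.w

/-- The outgoing edge between the first region and the region at the head. -/
def left (s : EdgeTriple) : EdgeTriple := ⟨s.x, s.z, s.y⟩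

/-- The outgoing edge between the region at the head and the second region. -/
def right (s : EdgeTriple) : EdgeTriple := ⟨s.z, s.y, s.x⟩

/-- The same edge with the two adjacent regions interchanged. -/
def swap (s : EdgeTriple) : EdgeTriple := ⟨s.y, s.x, s.w⟩

/-- The values on the regions beyond the head of the edge, indexed by the vertices of the binary
tree of paths that start at the head (`false` for `left` and `true` for `right`). -/
def val : EdgeTriple → List Bool → ℂ
  | s, [] => s.z
  | s, false :: u => s.left.val u
  | s, true :: u => s.right.val u

/-- The vertex relation of a `μ`-Markoff map. -/
def IsMarkoff (μ : ℂ) (s : EdgeTriple) : Prop :=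
  s.x ^ 2 + s.y ^ 2 + s.w ^ 2 - s.x * s.y * s.w = μ

variable {μ τ : ℂ} {s : EdgeTriple}

theorem IsMarkoff.left (h : s.IsMarkoff μ) : s.left.IsMarkoff μ := by
  simp only [IsMarkoff, EdgeTriple.left, z] at *
  linear_combination h

theorem IsMarkoff.right (h : s.IsMarkoff μ) : s.right.IsMarkoff μ := by
  simp only [IsMarkoff, EdgeTriple.right, z] at *
  linear_combination h

theorem IsMarkoff.swap (h : s.IsMarkoff μ) : s.swap.IsMarkoff μ := by
  simp only [IsMarkoff, EdgeTriple.swap] at *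
  linear_combination h

/-- The closed form of `exp (∑ 𝔥_τ)`, the sum being over all regions beyond the edge. -/
def ratio (τ : ℂ) (s : EdgeTriple) : ℂ :=
  (s.x * s.y + (boundaryEigenvalue τ - 1) * s.w) / (gapRoot τ s.x * gapRoot τ s.y)

theorem ratio_swap : s.swap.ratio τ = s.ratio τ := by
  simp only [ratio, swap, mul_comm]

/-- The closed form `ratio` is multiplicative at the vertices of the tree. -/
theorem ratio_eq_exp_gap_mul (h : s.IsMarkoff (τ + 2)) (hx : s.x ^ 2 ≠ τ + 2)
    (hy : s.y ^ 2 ≠ τ + 2) (hz : s.z ^ 2 ≠ τ + 2) :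
    s.ratio τ = Complex.exp (gap τ s.z) * (s.left.ratio τ * s.right.ratio τ) := by
  have gx := gapRoot_ne_zero hx
  have gy := gapRoot_ne_zero hy
  have gz := gapRoot_ne_zero hz
  have hz' := sub_ne_zero.2 hz
  have hκ := boundaryEigenvalue_sq τ
  rw [exp_gap hz]
  have key : (s.x * s.y + (boundaryEigenvalue τ - 1) * s.w) * (s.z ^ 2 - (τ + 2)) =
      (s.x * s.z + (boundaryEigenvalue τ - 1) * s.y) *
      (s.z * s.y + (boundaryEigenvalue τ - 1) * s.x) := by
    simp only [IsMarkoff, z] at *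
    linear_combination -(boundaryEigenvalue τ - 1) * (s.x * s.y - s.w) * h - s.x * s.y * hκ
  simp only [ratio, left, right]
  rw [div_mul_div_comm, div_mul_div_comm, div_eq_div_iff (by positivity) (by positivity)]
  linear_combination gapRoot τ s.x * gapRoot τ s.y * gapRoot τ s.z ^ 2 * key

theorem ratio_ne_zero (h : s.IsMarkoff (τ + 2)) (hx : s.x ^ 2 ≠ τ + 2)
    (hy : s.y ^ 2 ≠ τ + 2) : s.ratio τ ≠ 0 := by
  refine div_ne_zero (fun h0 => ?_) (mul_ne_zero (gapRoot_ne_zero hx) (gapRoot_ne_zero hy))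
  have hκ := boundaryEigenvalue_sq τ
  -- multiply by the expression with `κ⁻¹` in place of `κ`
  have key : boundaryEigenvalue τ * ((s.x ^ 2 - (τ + 2)) * (s.y ^ 2 - (τ + 2))) = 0 := by
    simp only [IsMarkoff] at h
    linear_combination (s.x * s.y * boundaryEigenvalue τ + (1 - boundaryEigenvalue τ) * s.w) * h0
      - s.w * (s.x * s.y - s.w) * hκ - (boundaryEigenvalue τ * (τ + 2)) * h
  rcases mul_eq_zero.1 key with h1 | h1
  · exact boundaryEigenvalue_ne_zero τ h1
  · exact (mul_ne_zero (sub_ne_zero.2 hx) (sub_ne_zero.2 hy)) h1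

/-! ### Sums over the vertices of the tree -/

theorem hasSum_list_bool {E : Type*} [AddCommMonoid E] [TopologicalSpace E] [ContinuousAdd E]
    {f : List Bool → E} {a b : E} (ha : HasSum (fun u => f (false :: u)) a)
    (hb : HasSum (fun u => f (true :: u)) b) : HasSum f (f [] + (a + b)) := by
  let e : Unit ⊕ (List Bool ⊕ List Bool) ≃ List Bool :=
    { toFun := Sum.elim (fun _ => []) (Sum.elim (List.cons false) (List.cons true))
      invFun := fun u => match u with
        | [] => Sum.inl ()
        | false :: u => Sum.inr (Sum.inl u)
        | true :: u => Sum.inr (Sum.inr u)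
      left_inv := by rintro (_ | _ | _) <;> rfl
      right_inv := by rintro (_ | ⟨_ | _, _⟩) <;> rfl }
  rw [← e.hasSum_iff]
  exact HasSum.sum (hasSum_unique _) (HasSum.sum ha hb)

/-- The sum of `|𝔥_τ|` over the regions at depth less than `n` beyond the edge. -/
def depthSum (τ : ℂ) : ℕ → EdgeTriple → ℝ
  | 0, _ => 0
  | n + 1, s => ‖gap τ s.z‖ + (depthSum τ n s.left + depthSum τ n s.right)

theorem hasSum_depthSum (n : ℕ) (s : EdgeTriple) :
    HasSum (fun u => if u.length < n then ‖gap τ (s.val u)‖ else 0) (depthSum τ n s) := by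
  induction n generalizing s with
  | zero => simp [depthSum]
  | succ n ih =>
    have := hasSum_list_bool
      (f := fun u : List Bool => if u.length < n + 1 then ‖gap τ (s.val u)‖ else 0)
      (a := depthSum τ n s.left) (b := depthSum τ n s.right)
      (by simpa [val] using ih s.left) (by simpa [val] using ih s.right)
    simpa [depthSum, val] using this

/-- The sum of `𝔥_τ` over all regions beyond the edge. -/
def gapSum (τ : ℂ) (s : EdgeTriple) : ℂ := ∑' u, gap τ (s.val u)

theorem summable_of_depthSum_le {B : ℝ} (h : ∀ n, depthSum τ n s ≤ B) :
    Summable (fun u => ‖gap τ (s.val u)‖) ∧ ‖s.gapSum τ‖ ≤ B := by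
  have key (F : Finset (List Bool)) : ∑ u ∈ F, ‖gap τ (s.val u)‖ ≤ B := by
    obtain ⟨n, hn⟩ : ∃ n, ∀ u ∈ F, u.length < n :=
      ⟨F.sup List.length + 1, fun u hu => Nat.lt_succ_of_le (Finset.le_sup hu)⟩
    calc ∑ u ∈ F, ‖gap τ (s.val u)‖
        = ∑ u ∈ F, if u.length < n then ‖gap τ (s.val u)‖ else 0 :=
          Finset.sum_congr rfl fun u hu => by rw [if_pos (hn u hu)]
      _ ≤ depthSum τ n s := sum_le_hasSum F (fun u _ => by positivity) (hasSum_depthSum n s)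
      _ ≤ B := h n
  have hs := summable_of_sum_le (fun u => norm_nonneg (gap τ (s.val u))) key
  exact ⟨hs, (norm_tsum_le_tsum_norm hs).trans (hs.tsum_le_of_sum_le key)⟩

/-- McShane's identity holds beyond the edge: the sum of `𝔥_τ` over the regions beyond the edge
converges absolutely, and its exponential is given by the closed form. -/
def HasIdentity (τ : ℂ) (s : EdgeTriple) : Prop :=
  Summable (fun u => ‖gap τ (s.val u)‖) ∧ Complex.exp (s.gapSum τ) = s.ratio τ

theorem hasSum_gap (hl : Summable (fun u => ‖gap τ (s.left.val u)‖))
    (hr : Summable (fun u => ‖gap τ (s.right.val u)‖)) :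
    HasSum (fun u => gap τ (s.val u)) (gap τ s.z + (s.left.gapSum τ + s.right.gapSum τ)) :=
  hasSum_list_bool (f := fun u => gap τ (s.val u)) hl.of_norm.hasSum hr.of_norm.hasSum

theorem summable_norm_gap (hl : Summable (fun u => ‖gap τ (s.left.val u)‖))
    (hr : Summable (fun u => ‖gap τ (s.right.val u)‖)) :
    Summable (fun u => ‖gap τ (s.val u)‖) :=
  (hasSum_list_bool (f := fun u => ‖gap τ (s.val u)‖) hl.hasSum hr.hasSum).summable

theorem HasIdentity.of_left_right (h : s.IsMarkoff (τ + 2)) (hx : s.x ^ 2 ≠ τ + 2)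
    (hy : s.y ^ 2 ≠ τ + 2) (hz : s.z ^ 2 ≠ τ + 2) (hl : s.left.HasIdentity τ)
    (hr : s.right.HasIdentity τ) : s.HasIdentity τ := by
  refine ⟨summable_norm_gap hl.1 hr.1, ?_⟩
  rw [gapSum, (hasSum_gap hl.1 hr.1).tsum_eq, Complex.exp_add, Complex.exp_add, hl.2, hr.2,
    ratio_eq_exp_gap_mul h hx hy hz]

theorem val_swap (s : EdgeTriple) (u : List Bool) : s.swap.val u = s.val (u.map not) := by
  induction u generalizing s with
  | nil => simp [val, z, swap, mul_comm]
  | cons b u ih =>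
    cases b
    · have : s.swap.left = s.right.swap := by simp [left, right, swap, z, mul_comm]
      simp [val, this, ih]
    · have : s.swap.right = s.left.swap := by simp [left, right, swap, z, mul_comm]
      simp [val, this, ih]

/-- Interchanging left and right in the binary tree. -/
def mirror : List Bool ≃ List Bool where
  toFun := List.map not
  invFun := List.map not
  left_inv u := by simp [Function.comp_def]
  right_inv u := by simp [Function.comp_def]

theorem HasIdentity.swap (h : s.HasIdentity τ) : s.swap.HasIdentity τ := by
  refine ⟨?_, ?_⟩
  · have := (mirror.summable_iff (f := fun u => ‖gap τ (s.val u)‖)).2 h.1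
    refine this.congr fun u => ?_
    rw [val_swap]; rfl
  · rw [ratio_swap, ← h.2, gapSum, gapSum, ← mirror.tsum_eq (fun u => gap τ (s.val u))]
    congr 1
    exact tsum_congr fun u => by rw [val_swap]; rfl

/-! ### The quotient of both sides of the identity -/

/-- The quotient of the closed form by the exponential of the sum. -/
def defect (τ : ℂ) (s : EdgeTriple) : ℂ := s.ratio τ * Complex.exp (-s.gapSum τ)

theorem hasIdentity_of_defect_eq_one (hs : Summable (fun u => ‖gap τ (s.val u)‖))
    (h : s.defect τ = 1) : s.HasIdentity τ := by
  refine ⟨hs, ?_⟩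
  rw [defect, Complex.exp_neg, mul_inv_eq_one₀ (Complex.exp_ne_zero _)] at h
  exact h.symm

theorem HasIdentity.defect_eq_one (h : s.HasIdentity τ) : s.defect τ = 1 := by
  rw [defect, ← h.2, ← Complex.exp_add]; simp

theorem defect_eq_mul (h : s.IsMarkoff (τ + 2)) (hx : s.x ^ 2 ≠ τ + 2)
    (hy : s.y ^ 2 ≠ τ + 2) (hz : s.z ^ 2 ≠ τ + 2)
    (hl : Summable (fun u => ‖gap τ (s.left.val u)‖))
    (hr : Summable (fun u => ‖gap τ (s.right.val u)‖)) :
    s.defect τ = s.left.defect τ * s.right.defect τ := by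
  have h1 : s.gapSum τ = gap τ s.z + (s.left.gapSum τ + s.right.gapSum τ) :=
    (hasSum_gap hl hr).tsum_eq
  simp only [defect]
  rw [h1, ratio_eq_exp_gap_mul h hx hy hz, neg_add, neg_add, Complex.exp_add, Complex.exp_add,
    Complex.exp_neg (gap τ s.z)]
  have := Complex.exp_ne_zero (gap τ s.z)
  field_simp

/-! ### Edges with large values -/

/-- The values along the edge have modulus at least `R`, and the value at the head is not smaller
than the value at the tail. -/
structure IsLarge (R : ℝ) (s : EdgeTriple) : Prop where
  le_x : R ≤ ‖s.x‖
  le_y : R ≤ ‖s.y‖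
  w_le_z : ‖s.w‖ ≤ ‖s.z‖

/-- The size `|x y|⁻²` of an edge, which bounds the tail of the series beyond it. -/
def weight (s : EdgeTriple) : ℝ := (‖s.x‖ ^ 2 * ‖s.y‖ ^ 2)⁻¹

theorem weight_nonneg (s : EdgeTriple) : 0 ≤ s.weight := by unfold weight; positivity

theorem norm_mul_le_two_mul_norm_z (h : ‖s.w‖ ≤ ‖s.z‖) : ‖s.x‖ * ‖s.y‖ ≤ 2 * ‖s.z‖ := by
  have := norm_add_le s.z s.w
  rw [z, sub_add_cancel, norm_mul] at this
  simp only [z] at *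
  linarith

namespace IsLarge

variable {R : ℝ}

theorem left (hR : 2 ≤ R) (h : s.IsLarge R) : s.left.IsLarge R := by
  have h1 := norm_mul_le_two_mul_norm_z h.w_le_z
  have hx := h.le_x
  have hy := h.le_y
  refine ⟨hx, ?_, ?_⟩
  · simp only [EdgeTriple.left]; nlinarith
  · simp only [EdgeTriple.left]
    have := norm_sub_norm_le (s.x * s.z) s.y
    rw [norm_mul] at this
    simp only [z] at *
    nlinarith [mul_nonneg (sub_nonneg.2 (hR.trans hx)) (norm_nonneg (s.x * s.y - s.w)),
      mul_nonneg (sub_nonneg.2 (hR.trans hx)) (norm_nonneg s.y)]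

theorem right (hR : 2 ≤ R) (h : s.IsLarge R) : s.right.IsLarge R := by
  have h1 := norm_mul_le_two_mul_norm_z h.w_le_z
  have hx := h.le_x
  have hy := h.le_y
  refine ⟨?_, hy, ?_⟩
  · simp only [EdgeTriple.right]; nlinarith
  · simp only [EdgeTriple.right]
    have := norm_sub_norm_le (s.z * s.y) s.x
    rw [norm_mul] at this
    simp only [z] at *
    nlinarith [mul_nonneg (sub_nonneg.2 (hR.trans hy)) (norm_nonneg (s.x * s.y - s.w)),
      mul_nonneg (sub_nonneg.2 (hR.trans hy)) (norm_nonneg s.x)]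

theorem inv_norm_z_sq_le (hR : 2 ≤ R) (h : s.IsLarge R) : (‖s.z‖ ^ 2)⁻¹ ≤ 4 * s.weight := by
  have h1 := norm_mul_le_two_mul_norm_z h.w_le_z
  have hx : 0 < ‖s.x‖ := by linarith [h.le_x]
  have hy : 0 < ‖s.y‖ := by linarith [h.le_y]
  have h2 : ‖s.x‖ ^ 2 * ‖s.y‖ ^ 2 ≤ 4 * ‖s.z‖ ^ 2 := by
    have := pow_le_pow_left₀ (by positivity) h1 2
    nlinarith
  have hz : 0 < ‖s.z‖ := by nlinarith [mul_pos hx hy]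
  rw [weight, inv_eq_one_div, ← div_eq_mul_inv, div_le_div_iff₀ (by positivity) (by positivity)]
  linarith

theorem weight_left_le (hR : 4 ≤ R) (h : s.IsLarge R) : s.left.weight ≤ s.weight / 4 := by
  have h1 := inv_norm_z_sq_le (by linarith) h
  have hx : 4 ≤ ‖s.x‖ := by linarith [h.le_x]
  have hx2 : (‖s.x‖ ^ 2)⁻¹ ≤ 1 / 16 := by
    rw [inv_eq_one_div]; exact one_div_le_one_div_of_le (by norm_num) (by nlinarith)
  have h0 := s.weight_nonneg
  have h2 : (0 : ℝ) ≤ (‖s.z‖ ^ 2)⁻¹ := by positivity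
  simp only [EdgeTriple.weight, EdgeTriple.left, mul_inv] at *
  nlinarith

theorem weight_right_le (hR : 4 ≤ R) (h : s.IsLarge R) : s.right.weight ≤ s.weight / 4 := by
  have h1 := inv_norm_z_sq_le (by linarith) h
  have hx : 4 ≤ ‖s.y‖ := by linarith [h.le_y]
  have hx2 : (‖s.y‖ ^ 2)⁻¹ ≤ 1 / 16 := by
    rw [inv_eq_one_div]; exact one_div_le_one_div_of_le (by norm_num) (by nlinarith)
  have h0 := s.weight_nonneg
  have h2 : (0 : ℝ) ≤ (‖s.z‖ ^ 2)⁻¹ := by positivity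
  simp only [EdgeTriple.weight, EdgeTriple.right, mul_inv] at *
  nlinarith

theorem le_norm_z (hR : 2 ≤ R) (h : s.IsLarge R) : R ≤ ‖s.z‖ := (left hR h).le_y

end IsLarge

theorem IsLarge.depthSum_le {R C : ℝ} (hR : 4 ≤ R) (hC : 0 ≤ C)
    (hgap : ∀ x : ℂ, R ≤ ‖x‖ → ‖gap τ x‖ ≤ C / ‖x‖ ^ 2) (n : ℕ) (h : s.IsLarge R) :
    depthSum τ n s ≤ 8 * C * s.weight := by
  induction n generalizing s with
  | zero => have := s.weight_nonneg; simp only [depthSum]; positivity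
  | succ n ih =>
    have h1 := ih (h.left (by linarith))
    have h2 := ih (h.right (by linarith))
    have h3 := hgap _ (h.le_norm_z (by linarith))
    have h4 := h.inv_norm_z_sq_le (by linarith)
    have h5 := h.weight_left_le hR
    have h6 := h.weight_right_le hR
    rw [div_eq_mul_inv] at h3
    simp only [depthSum]
    nlinarith [mul_le_mul_of_nonneg_left h4 hC, mul_le_mul_of_nonneg_left h5 hC,
      mul_le_mul_of_nonneg_left h6 hC]

/-- The closed form is close to `1` on large edges. The value `w` differs from
`W = α / β + β / α`, where `α = λ(x)` and `β = λ(y)`, by `(4 - μ) / (z - W)`, which is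
`O(|x y|⁻¹)`; and `ratio = 1` up to a term of the same order as `(w - W) / (x y)`. -/
theorem exists_norm_ratio_sub_one_le (τ : ℂ) :
    ∃ R C : ℝ, 0 ≤ C ∧ ∀ s : EdgeTriple, s.IsMarkoff (τ + 2) → s.IsLarge R →
      ‖s.ratio τ - 1‖ ≤ C * s.weight := by
  set κ := boundaryEigenvalue τ with hκ
  refine ⟨8 + 8 * ‖κ‖, 16 * ‖κ - 1‖ * (4 * ‖2 - τ‖ + 4 * ‖κ + 1‖), by positivity,
    fun s hs hl => ?_⟩
  have nκ := norm_nonneg κ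
  -- estimates for a single value
  have one (x : ℂ) (hx : 8 + 8 * ‖κ‖ ≤ ‖x‖) : ‖x‖ / 2 ≤ ‖eigenvalue x‖ ∧
      ‖eigenvalue x‖ ≤ 2 * ‖x‖ ∧ ‖x‖ / 4 ≤ ‖gapRoot τ x‖ := by
    have h1 := norm_sub_one_le_norm_eigenvalue x
    have h2 := norm_eigenvalue_le x
    have h3 : ‖κ / eigenvalue x‖ ≤ 1 := by
      rw [norm_div]; exact div_le_one_of_le₀ (by linarith) (norm_nonneg _)
    have h4 := norm_sub_le (gapRoot τ x) (κ / eigenvalue x)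
    rw [gapRoot, ← hκ, add_sub_cancel_right] at h4
    refine ⟨by linarith, by linarith, ?_⟩
    rw [gapRoot, ← hκ]; linarith
  obtain ⟨x, y, w⟩ := s
  obtain ⟨hx, hy, hw⟩ := hl
  have hz2 := norm_mul_le_two_mul_norm_z hw
  simp only at hx hy
  obtain ⟨ax1, ax2, ax3⟩ := one x hx
  obtain ⟨ay1, ay2, ay3⟩ := one y hy
  simp only [IsMarkoff, z, ratio, EdgeTriple.weight] at *
  have x0 : 0 < ‖x‖ := by linarith
  have y0 : 0 < ‖y‖ := by linarith
  have hα := eigenvalue_ne_zero x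
  have hβ := eigenvalue_ne_zero y
  have eα := eigenvalue_add_inv x
  have eβ := eigenvalue_add_inv y
  set α := eigenvalue x with hαd
  set β := eigenvalue y with hβd
  set W := α / β + β / α with hW
  have hprod : (w - W) * ((x * y - w) - W) = 2 - τ := by
    have e1 : W * (x * y - W) = x ^ 2 + y ^ 2 - 4 := by
      rw [hW, ← eα, ← eβ]; field_simp; ring
    linear_combination -hs - e1
  have hnum : x * y + (κ - 1) * w - gapRoot τ x * gapRoot τ y =
      (κ - 1) * ((w - W) - (κ + 1) / (α * β)) := by
    have e1 : x * y = α * β + W + 1 / (α * β) := by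
      rw [hW, ← eα, ← eβ]; field_simp; ring
    have e2 : gapRoot τ x * gapRoot τ y = α * β + κ * W + κ ^ 2 / (α * β) := by
      rw [gapRoot, gapRoot, ← hαd, ← hβd, ← hκ, hW]; field_simp; ring
    rw [e1, e2]; field_simp; ring
  have hWn : ‖W‖ ≤ ‖x‖ * ‖y‖ / 4 := by
    have w1 : ‖α / β‖ ≤ ‖x‖ * ‖y‖ / 8 := by
      rw [norm_div, div_le_iff₀ (by linarith)]
      nlinarith [mul_pos x0 y0, mul_nonneg x0.le (sub_nonneg.2 ay1)]
    have w2 : ‖β / α‖ ≤ ‖x‖ * ‖y‖ / 8 := by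
      rw [norm_div, div_le_iff₀ (by linarith)]
      nlinarith [mul_pos x0 y0, mul_nonneg y0.le (sub_nonneg.2 ax1)]
    linarith [norm_add_le (α / β) (β / α)]
  have hq : ‖x‖ * ‖y‖ / 4 ≤ ‖(x * y - w) - W‖ := by
    have := norm_sub_norm_le (x * y - w) W
    linarith
  have hxy := mul_pos x0 y0
  have hp : ‖w - W‖ ≤ 4 * ‖2 - τ‖ / (‖x‖ * ‖y‖) := by
    have := congrArg norm hprod
    rw [norm_mul] at this
    rw [le_div_iff₀ hxy]
    nlinarith [norm_nonneg (w - W)]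
  have hαβ : ‖(κ + 1) / (α * β)‖ ≤ 4 * ‖κ + 1‖ / (‖x‖ * ‖y‖) := by
    rw [norm_div, norm_mul, div_le_div_iff₀ (by nlinarith) hxy]
    have : ‖x‖ * ‖y‖ ≤ 4 * (‖α‖ * ‖β‖) := by nlinarith
    nlinarith [norm_nonneg (κ + 1)]
  have hD : ‖x‖ * ‖y‖ / 16 ≤ ‖gapRoot τ x * gapRoot τ y‖ := by
    rw [norm_mul]; nlinarith
  have hD0 : gapRoot τ x * gapRoot τ y ≠ 0 := norm_pos_iff.1 (by linarith)
  rw [div_sub_one hD0, hnum, norm_div, norm_mul, div_le_iff₀ (by linarith)]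
  have htri := norm_sub_le (w - W) ((κ + 1) / (α * β))
  calc ‖κ - 1‖ * ‖w - W - (κ + 1) / (α * β)‖
      ≤ ‖κ - 1‖ * (4 * ‖2 - τ‖ / (‖x‖ * ‖y‖) + 4 * ‖κ + 1‖ / (‖x‖ * ‖y‖)) := by
        gcongr; linarith
    _ = 16 * ‖κ - 1‖ * (4 * ‖2 - τ‖ + 4 * ‖κ + 1‖) * (‖x‖ ^ 2 * ‖y‖ ^ 2)⁻¹ *
        (‖x‖ * ‖y‖ / 16) := by field_simp
    _ ≤ _ := by gcongr

theorem norm_mul_sub_one_le {a b : ℂ} {p q : ℝ} (ha : ‖a - 1‖ ≤ Real.exp p - 1)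
    (hb : ‖b - 1‖ ≤ Real.exp q - 1) : ‖a * b - 1‖ ≤ Real.exp (p + q) - 1 := by
  have e : a * b - 1 = (a - 1) * (b - 1) + (a - 1) + (b - 1) := by ring
  have h1 : ‖a * b - 1‖ ≤ ‖a - 1‖ * ‖b - 1‖ + ‖a - 1‖ + ‖b - 1‖ := by
    rw [e, ← norm_mul]
    exact (norm_add_le _ _).trans (by gcongr; exact norm_add_le _ _)
  rw [Real.exp_add]
  have h2 := norm_nonneg (a - 1)
  have h3 := norm_nonneg (b - 1)
  nlinarith [mul_le_mul ha hb h3 (h2.trans ha)]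

theorem norm_exp_sub_one_le_exp (a : ℂ) : ‖Complex.exp a - 1‖ ≤ Real.exp ‖a‖ - 1 := by
  simpa using Complex.norm_exp_sub_sum_le_exp_norm_sub_sum a 1

theorem sq_ne_of_large {R : ℝ} {x : ℂ} (hR : 1 ≤ R) (hRμ : ‖μ‖ < R) (hx : R ≤ ‖x‖) :
    x ^ 2 ≠ μ := by
  rintro rfl
  rw [norm_pow] at hRμ
  nlinarith

/-- McShane's identity beyond large edges. -/
theorem exists_isLarge_hasIdentity (τ : ℂ) :
    ∃ R K : ℝ, 4 ≤ R ∧ ‖τ + 2‖ < R ∧ 0 ≤ K ∧ (∀ x : ℂ, R ≤ ‖x‖ → ‖gap τ x‖ ≤ K / ‖x‖ ^ 2) ∧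
      ∀ s : EdgeTriple, s.IsMarkoff (τ + 2) → s.IsLarge R →
        s.HasIdentity τ ∧ ∀ n, depthSum τ n s ≤ K * s.weight := by
  obtain ⟨R₁, C₁, hC₁, h₁⟩ := exists_norm_gap_le τ
  obtain ⟨R₂, C₂, hC₂, h₂⟩ := exists_norm_ratio_sub_one_le τ
  set R := max (max 4 (‖τ + 2‖ + 1)) (max R₁ R₂) with hR
  have hR4 : 4 ≤ R := (le_max_left _ _).trans (le_max_left _ _)
  have hRμ : ‖τ + 2‖ < R :=
    (lt_add_one _).trans_le ((le_max_right _ _).trans (le_max_left _ _))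
  have hR1 : R₁ ≤ R := (le_max_left _ _).trans (le_max_right _ _)
  have hR2 : R₂ ≤ R := (le_max_right _ _).trans (le_max_right _ _)
  have hgap (x : ℂ) (hx : R ≤ ‖x‖) : ‖gap τ x‖ ≤ C₁ / ‖x‖ ^ 2 := h₁ x (hR1.trans hx)
  have hdepth (s : EdgeTriple) (hs : s.IsLarge R) (n : ℕ) : depthSum τ n s ≤ 8 * C₁ * s.weight :=
    hs.depthSum_le hR4 hC₁ hgap n
  refine ⟨R, 8 * C₁, hR4, hRμ, by positivity, fun x hx => (hgap x hx).trans ?_,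
    fun s hm hs => ⟨?_, hdepth s hs⟩⟩
  · gcongr; linarith
  have hsum (s : EdgeTriple) (hs : s.IsLarge R) := summable_of_depthSum_le (hdepth s hs)
  refine hasIdentity_of_defect_eq_one (hsum s hs).1 ?_
  -- the defect is multiplicative, and the total weight of the edges halves at each step
  have key (n : ℕ) : ∀ s : EdgeTriple, s.IsMarkoff (τ + 2) → s.IsLarge R →
      ‖s.defect τ - 1‖ ≤ Real.exp ((C₂ + 8 * C₁) * s.weight * (1 / 2) ^ n) - 1 := by
    induction n with
    | zero =>
      intro s hm hs
      have e1 : ‖s.ratio τ - 1‖ ≤ Real.exp (C₂ * s.weight) - 1 := by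
        have := h₂ s hm ⟨hR2.trans hs.le_x, hR2.trans hs.le_y, hs.w_le_z⟩
        linarith [Real.add_one_le_exp (C₂ * s.weight)]
      have e2 : ‖Complex.exp (-s.gapSum τ) - 1‖ ≤ Real.exp (8 * C₁ * s.weight) - 1 := by
        refine (norm_exp_sub_one_le_exp _).trans ?_
        rw [norm_neg]
        gcongr
        exact (hsum s hs).2
      have := norm_mul_sub_one_le e1 e2
      rw [defect, pow_zero, mul_one, add_mul]
      exact this
    | succ n ih =>
      intro s hm hs
      have hl := hs.left (by linarith)
      have hr := hs.right (by linarith)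
      rw [defect_eq_mul hm (sq_ne_of_large (by linarith) hRμ hs.le_x)
        (sq_ne_of_large (by linarith) hRμ hs.le_y) (sq_ne_of_large (by linarith) hRμ hl.le_y)
        (hsum _ hl).1 (hsum _ hr).1]
      refine (norm_mul_sub_one_le (ih _ hm.left hl) (ih _ hm.right hr)).trans ?_
      gcongr
      have a1 := hs.weight_left_le hR4
      have a2 := hs.weight_right_le hR4
      have a3 : (C₂ + 8 * C₁) * (s.left.weight + s.right.weight) ≤
          (C₂ + 8 * C₁) * (s.weight / 2) := by gcongr; linarith
      have a4 : (0 : ℝ) ≤ (1 / 2) ^ n := by positivity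
      rw [pow_succ]
      nlinarith
  have hlim : Filter.Tendsto
      (fun n : ℕ => Real.exp ((C₂ + 8 * C₁) * s.weight * (1 / 2) ^ n) - 1)
      Filter.atTop (nhds 0) := by
    have h0 : Filter.Tendsto (fun n : ℕ => ((1 / 2 : ℝ)) ^ n) Filter.atTop (nhds 0) :=
      tendsto_pow_atTop_nhds_zero_of_lt_one (by norm_num) (by norm_num)
    have h1 := ((h0.const_mul ((C₂ + 8 * C₁) * s.weight)).rexp).sub_const 1
    simpa using h1
  have hle := ge_of_tendsto' hlim fun n => key n s hm hs
  exact sub_eq_zero.1 (norm_le_zero_iff.1 hle)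

end EdgeTriple

namespace EdgeTriple

variable {τ : ℂ} {s : EdgeTriple}

/-! ### The edges around a region -/

theorem left_iterate_x (s : EdgeTriple) (n : ℕ) : (left^[n] s).x = s.x := by
  induction n with
  | zero => rfl
  | succ n ih => rw [Function.iterate_succ_apply', ← ih]; rfl

theorem left_iterate_isMarkoff {μ : ℂ} (h : s.IsMarkoff μ) (n : ℕ) :
    (left^[n] s).IsMarkoff μ := by
  induction n with
  | zero => exact h
  | succ n ih => rw [Function.iterate_succ_apply']; exact ih.left

theorem left_iterate_succ_y (s : EdgeTriple) (n : ℕ) :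
    (left^[n + 1] s).y = s.x * (left^[n] s).y - (left^[n] s).w := by
  rw [Function.iterate_succ_apply', ← left_iterate_x s n]; rfl

theorem left_iterate_succ_w (s : EdgeTriple) (n : ℕ) :
    (left^[n + 1] s).w = (left^[n] s).y := by
  rw [Function.iterate_succ_apply']; rfl

/-- Going around a region with value `α + α⁻¹`, the neighbouring values are combinations of
`αⁿ` and `α⁻ⁿ`; this isolates the coefficient of the first. -/
theorem left_iterate_y_sub (s : EdgeTriple) (n : ℕ) :
    (left^[n] s).y - (left^[n] s).w / eigenvalue s.x =
      eigenvalue s.x ^ n * (s.y - s.w / eigenvalue s.x) := by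
  have h0 := eigenvalue_ne_zero s.x
  have h1 := eigenvalue_add_inv s.x
  induction n with
  | zero => simp
  | succ n ih =>
    rw [left_iterate_succ_y, left_iterate_succ_w, pow_succ', mul_assoc, ← ih, mul_sub,
      mul_div_cancel₀ _ h0, div_eq_mul_inv]
    linear_combination -(left^[n] s).y * h1

theorem left_iterate_y_sub_mul (s : EdgeTriple) (n : ℕ) :
    (left^[n] s).y - eigenvalue s.x * (left^[n] s).w =
      (eigenvalue s.x)⁻¹ ^ n * (s.y - eigenvalue s.x * s.w) := by
  have h0 := eigenvalue_ne_zero s.x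
  have h1 := eigenvalue_add_inv s.x
  induction n with
  | zero => simp
  | succ n ih =>
    rw [left_iterate_succ_y, left_iterate_succ_w, pow_succ', mul_assoc, ← ih, mul_sub,
      inv_mul_cancel_left₀ h0]
    linear_combination -(left^[n] s).y * h1

theorem mul_coeff_eq {μ : ℂ} (h : s.IsMarkoff μ) :
    (s.y - s.w / eigenvalue s.x) * (s.y - eigenvalue s.x * s.w) = μ - s.x ^ 2 := by
  have h0 := eigenvalue_ne_zero s.x
  have h1 := eigenvalue_add_inv s.x
  simp only [IsMarkoff] at h
  rw [div_eq_mul_inv]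
  linear_combination h - s.y * s.w * h1 + s.w ^ 2 * inv_mul_cancel₀ h0

/-- The values around a region grow exponentially, in a fixed direction. -/
theorem tendsto_left_iterate (hm : s.IsMarkoff (τ + 2))
    (hx : s.x ∉ Complex.ofReal '' Set.Icc (-2 : ℝ) 2) (hx2 : s.x ^ 2 ≠ τ + 2) :
    ∃ L : ℂ, L ≠ 0 ∧ Filter.Tendsto (fun n => (left^[n] s).y / eigenvalue s.x ^ n) Filter.atTop
      (nhds L) ∧ Filter.Tendsto (fun n => (left^[n] s).w / (left^[n] s).y) Filter.atTop
      (nhds (eigenvalue s.x)⁻¹) := by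
  have h0 := eigenvalue_ne_zero s.x
  have hlt := one_lt_norm_eigenvalue hx
  have hc := mul_coeff_eq hm
  have hfst := left_iterate_y_sub s
  have hsnd := left_iterate_y_sub_mul s
  set α := eigenvalue s.x with hα
  set c := s.y - s.w / α
  set d := s.y - α * s.w
  have hc0 : c ≠ 0 := left_ne_zero_of_mul (hc.trans_ne (sub_ne_zero.2 (Ne.symm hx2)))
  have hα1 : α - α⁻¹ ≠ 0 := by
    intro h
    have h1 : ‖α‖ = ‖α⁻¹‖ := congrArg norm (sub_eq_zero.1 h)
    rw [norm_inv] at h1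
    have := inv_lt_one_of_one_lt₀ hlt
    linarith
  have hpow : Filter.Tendsto (fun n : ℕ => (α⁻¹ ^ n) ^ 2) Filter.atTop (nhds 0) := by
    have := tendsto_pow_atTop_nhds_zero_of_norm_lt_one (x := α⁻¹)
      (by rw [norm_inv]; exact inv_lt_one_of_one_lt₀ hlt)
    simpa using this.pow 2
  have hy : (fun n => (left^[n] s).y / α ^ n) =
      fun n => (α * c - α⁻¹ * (α⁻¹ ^ n) ^ 2 * d) / (α - α⁻¹) := by
    funext n
    have hp : α ^ n * α⁻¹ ^ n = 1 := by rw [← mul_pow, mul_inv_cancel₀ h0, one_pow]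
    have hp0 : α ^ n ≠ 0 := pow_ne_zero _ h0
    rw [div_eq_div_iff hp0 hα1]
    have e1 := hfst n
    have e2 := hsnd n
    rw [div_eq_mul_inv] at e1
    linear_combination α * e1 - α⁻¹ * e2 - (left^[n] s).w * (mul_inv_cancel₀ h0) +
      (left^[n] s).w * (inv_mul_cancel₀ h0) + α⁻¹ * α⁻¹ ^ n * d * hp
  have hL : α * c / (α - α⁻¹) ≠ 0 := div_ne_zero (mul_ne_zero h0 hc0) hα1
  have ht : Filter.Tendsto (fun n => (left^[n] s).y / α ^ n) Filter.atTop
      (nhds (α * c / (α - α⁻¹))) := by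
    rw [hy]
    have := (((hpow.const_mul α⁻¹).mul_const d).const_sub (α * c)).div_const (α - α⁻¹)
    simpa using this
  refine ⟨_, hL, ht, ?_⟩
  have ht2 : Filter.Tendsto (fun n => (1 - (α⁻¹ ^ n) ^ 2 * d / ((left^[n] s).y / α ^ n)) / α)
      Filter.atTop (nhds α⁻¹) := by
    have := (((hpow.mul_const d).div ht hL).const_sub 1).div_const α
    simpa using this
  refine ht2.congr' ?_
  filter_upwards [ht.eventually_ne hL] with n hn
  have hp0 : α ^ n ≠ 0 := pow_ne_zero _ h0
  have hy0 : (left^[n] s).y ≠ 0 := fun h => hn (by rw [h, zero_div])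
  have e2 := hsnd n
  have e3 : (left^[n] s).w = ((left^[n] s).y - α⁻¹ ^ n * d) / α := by
    rw [← e2]; field_simp; ring
  have hp : α ^ n * α⁻¹ ^ n = 1 := by rw [← mul_pow, mul_inv_cancel₀ h0, one_pow]
  rw [e3]
  generalize α⁻¹ ^ n = b at *
  field_simp
  linear_combination -b * d * hp

theorem tendsto_gapRoot_div (τ : ℂ) :
    Filter.Tendsto (fun y => gapRoot τ y / y) (Bornology.cobounded ℂ) (nhds 1) := by
  set κ := boundaryEigenvalue τ with hκ
  have h1 : Filter.Tendsto (fun y : ℂ => 1 + (κ - 1) * ((eigenvalue y)⁻¹ * y⁻¹))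
      (Bornology.cobounded ℂ) (nhds 1) := by
    have h2 : Filter.Tendsto (fun y : ℂ => (eigenvalue y)⁻¹ * y⁻¹)
        (Bornology.cobounded ℂ) (nhds 0) := by
      refine squeeze_zero_norm (a := fun y : ℂ => ‖y⁻¹‖) (fun y => ?_) ?_
      · rw [norm_mul, norm_inv]
        exact mul_le_of_le_one_left (norm_nonneg _)
          (inv_le_one_of_one_le₀ (one_le_norm_eigenvalue y))
      · simpa using (Filter.tendsto_inv₀_cobounded (α := ℂ)).norm
    simpa using (h2.const_mul (κ - 1)).const_add 1
  refine h1.congr' ?_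
  filter_upwards [Bornology.eventually_ne_cobounded 0] with y hy
  have h0 := eigenvalue_ne_zero y
  have h3 := eigenvalue_add_inv y
  rw [gapRoot, ← hκ, div_eq_mul_inv κ]
  field_simp
  have h4 : eigenvalue y ^ 2 = y * eigenvalue y - 1 := by
    field_simp at h3; linear_combination h3
  linear_combination -h4

/-- McShane's identity holds beyond all but finitely many of the edges around a region. -/
theorem exists_left_iterate_hasIdentity (hm : s.IsMarkoff (τ + 2))
    (hx : s.x ∉ Complex.ofReal '' Set.Icc (-2 : ℝ) 2) (hx2 : s.x ^ 2 ≠ τ + 2) :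
    ∃ N, (left^[N] s).HasIdentity τ := by
  obtain ⟨R, K, hR, hRμ, hK, hgap, hlarge⟩ := exists_isLarge_hasIdentity τ
  obtain ⟨L, hL, htend, hratio⟩ := tendsto_left_iterate hm hx hx2
  have h0 := eigenvalue_ne_zero s.x
  have hlt := one_lt_norm_eigenvalue hx
  set α := eigenvalue s.x with hα
  set y : ℕ → ℂ := fun n => (left^[n] s).y with hy
  set e := ‖L‖ / 2 with he
  have he0 : 0 < e := by have := norm_pos_iff.2 hL; positivity
  set q := (‖α‖ ^ 2)⁻¹ with hq
  have hq0 : 0 < q := by positivity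
  have hq1 : q < 1 := inv_lt_one_of_one_lt₀ (by nlinarith)
  have hgrow : ∀ᶠ n in Filter.atTop, e * ‖α‖ ^ n ≤ ‖y n‖ := by
    filter_upwards [htend.norm.eventually_const_le (show e < ‖L‖ by linarith [norm_pos_iff.2 hL])]
      with n hn
    rwa [norm_div, norm_pow, le_div_iff₀ (by positivity)] at hn
  have hytop : Filter.Tendsto (fun n => ‖y n‖) Filter.atTop Filter.atTop :=
    Filter.tendsto_atTop_mono' _ hgrow
      ((tendsto_pow_atTop_atTop_of_one_lt hlt).const_mul_atTop he0)
  obtain ⟨N, hN⟩ := Filter.eventually_atTop.1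
    (hgrow.and (hytop.eventually_ge_atTop (R + ‖s.x‖)))
  have hyR (n : ℕ) (hn : N ≤ n) : R ≤ ‖y n‖ := by linarith [(hN n hn).2, norm_nonneg s.x]
  have hz (n : ℕ) : (left^[n] s).z = y (n + 1) := by
    simp only [hy]; rw [Function.iterate_succ_apply']; rfl
  -- the lateral edges at the region `x`
  have hside (n : ℕ) (hn : N ≤ n) : (left^[n] s).right.IsLarge R := by
    refine ⟨?_, hyR n hn, ?_⟩
    · change R ≤ ‖(left^[n] s).z‖
      rw [hz]; exact hyR _ (by omega)
    · change ‖(left^[n] s).x‖ ≤ ‖(left^[n] s).z * (left^[n] s).y - (left^[n] s).x‖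
      rw [hz, left_iterate_x]
      have h1 := norm_sub_norm_le (y (n + 1) * (left^[n] s).y) s.x
      rw [norm_mul] at h1
      have h2 := hyR (n + 1) (by omega)
      have h3 : R + ‖s.x‖ ≤ ‖(left^[n] s).y‖ := (hN n hn).2
      nlinarith [norm_nonneg s.x]
  have hinv (n : ℕ) (hn : N ≤ n) : (‖y n‖ ^ 2)⁻¹ ≤ (e ^ 2)⁻¹ * q ^ n := by
    have h1 := (hN n hn).1
    have h2 : (e * ‖α‖ ^ n) ^ 2 ≤ ‖y n‖ ^ 2 := pow_le_pow_left₀ (by positivity) h1 2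
    have h3 := inv_anti₀ (by positivity) h2
    refine h3.trans (le_of_eq ?_)
    rw [hq, mul_pow, mul_inv, inv_pow, ← pow_mul, ← pow_mul, mul_comm n 2]
  set Q := 2 * K * (e ^ 2)⁻¹ / (1 - q) with hQ
  have hQ0 : 0 ≤ Q := div_nonneg (by positivity) (by linarith)
  have hdepth (n : ℕ) : ∀ k, N ≤ k → depthSum τ n (left^[k] s) ≤ Q * q ^ k := by
    induction n with
    | zero => intro k _; simp only [depthSum]; positivity
    | succ n ih =>
      intro k hk
      have h1 := ih (k + 1) (by omega)
      rw [Function.iterate_succ_apply'] at h1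
      have h2 := (hlarge _ (left_iterate_isMarkoff hm k).right (hside k hk)).2 n
      have h3 := hgap _ (hyR (k + 1) (by omega))
      have h4 := hinv (k + 1) (by omega)
      have h5 := hinv k hk
      have h6 : (left^[k] s).right.weight ≤ (e ^ 2)⁻¹ * q ^ k := by
        refine le_trans ?_ h5
        have h7 : 1 ≤ ‖y (k + 1)‖ := by linarith [hyR (k + 1) (by omega)]
        have h8 : 0 < ‖y k‖ := by linarith [hyR k hk]
        change (‖(left^[k] s).z‖ ^ 2 * ‖y k‖ ^ 2)⁻¹ ≤ _
        rw [hz]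
        refine inv_anti₀ (by positivity) ?_
        exact le_mul_of_one_le_left (by positivity) (one_le_pow₀ h7)
      have h9 : (e ^ 2)⁻¹ * q ^ (k + 1) ≤ (e ^ 2)⁻¹ * q ^ k :=
        mul_le_mul_of_nonneg_left (pow_le_pow_of_le_one hq0.le hq1.le (by omega)) (by positivity)
      have h10 : Q * q ^ k = 2 * K * ((e ^ 2)⁻¹ * q ^ k) + Q * q ^ (k + 1) := by
        have : 1 - q ≠ 0 := by linarith
        rw [hQ, pow_succ]; field_simp; ring
      simp only [depthSum]
      rw [hz, h10]
      rw [div_eq_mul_inv] at h3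
      nlinarith [mul_le_mul_of_nonneg_left (h4.trans h9) hK, mul_le_mul_of_nonneg_left h6 hK]
  have hsum (k : ℕ) (hk : N ≤ k) := summable_of_depthSum_le fun n => hdepth n k hk
  refine ⟨N, hasIdentity_of_defect_eq_one (hsum N le_rfl).1 ?_⟩
  -- the defect is constant and tends to `1`
  have hsq (n : ℕ) (hn : N ≤ n) : (left^[n] s).y ^ 2 ≠ τ + 2 :=
    sq_ne_of_large (by linarith) hRμ (hyR n hn)
  have hxn (n : ℕ) : (left^[n] s).x ^ 2 ≠ τ + 2 := by rwa [left_iterate_x]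
  have hconst (n : ℕ) (hn : N ≤ n) : (left^[n] s).defect τ = (left^[N] s).defect τ := by
    induction n, hn using Nat.le_induction with
    | base => rfl
    | succ n hn ih =>
      have hl := (hsum (n + 1) (by omega)).1
      rw [Function.iterate_succ_apply'] at hl ⊢
      rw [← ih, defect_eq_mul (left_iterate_isMarkoff hm n) (hxn n) (hsq n hn)
        (by rw [hz]; exact hsq (n + 1) (by omega)) hl
        (hlarge _ (left_iterate_isMarkoff hm n).right (hside n hn)).1.1,
        (hlarge _ (left_iterate_isMarkoff hm n).right (hside n hn)).1.defect_eq_one, mul_one]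
  have hcob : Filter.Tendsto y Filter.atTop (Bornology.cobounded ℂ) :=
    tendsto_norm_atTop_iff_cobounded.1 hytop
  have hgx := gapRoot_ne_zero hx2
  have hrat : Filter.Tendsto (fun n => (left^[n] s).ratio τ) Filter.atTop (nhds 1) := by
    have h1 : Filter.Tendsto (fun n => (s.x + (boundaryEigenvalue τ - 1) *
        ((left^[n] s).w / (left^[n] s).y)) / (gapRoot τ s.x * (gapRoot τ (y n) / y n)))
        Filter.atTop (nhds ((s.x + (boundaryEigenvalue τ - 1) * α⁻¹) / (gapRoot τ s.x * 1))) :=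
      ((hratio.const_mul _).const_add _).div
        (((tendsto_gapRoot_div τ).comp hcob).const_mul _) (by simpa using hgx)
    have h2 : (s.x + (boundaryEigenvalue τ - 1) * α⁻¹) / (gapRoot τ s.x * 1) = 1 := by
      rw [mul_one, div_eq_one_iff_eq hgx, gapRoot, ← hα]
      have := eigenvalue_add_inv s.x
      rw [← hα] at this
      rw [div_eq_mul_inv]
      linear_combination -this
    rw [h2] at h1
    refine h1.congr' ?_
    filter_upwards [Filter.eventually_ge_atTop N] with n hn
    have hy0 : y n ≠ 0 := norm_pos_iff.1 (by linarith [hyR n hn])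
    have hgy := gapRoot_ne_zero (hsq n hn)
    simp only [ratio, left_iterate_x]
    change _ = (s.x * y n + _) / (gapRoot τ s.x * gapRoot τ (y n))
    change gapRoot τ (y n) ≠ 0 at hgy
    change (s.x + _ * (_ / y n)) / _ = _
    field_simp
  have hS : Filter.Tendsto (fun n => (left^[n] s).gapSum τ) Filter.atTop (nhds 0) := by
    refine squeeze_zero_norm' (a := fun n => Q * q ^ n) ?_ ?_
    · filter_upwards [Filter.eventually_ge_atTop N] with n hn
      exact (hsum n hn).2
    · simpa using (tendsto_pow_atTop_nhds_zero_of_lt_one hq0.le hq1).const_mul Q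
  have hdef : Filter.Tendsto (fun n => (left^[n] s).defect τ) Filter.atTop (nhds 1) := by
    simpa [defect] using hrat.mul hS.neg.cexp
  refine tendsto_nhds_unique (tendsto_const_nhds.congr' ?_) hdef
  filter_upwards [Filter.eventually_ge_atTop N] with n hn using (hconst n hn).symm

end EdgeTriple

namespace EdgeTriple

variable {τ : ℂ} {s : EdgeTriple}

/-! ### Paths in the tree -/

/-- A path that decreases the values forever while turning infinitely often, with all values of
modulus greater than `2`, forces `μ = τ + 2 = 4`. The moduli of the values tend to `2`, and the
values approach those of a trivial representation up to signs. -/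
theorem eq_two_of_descending_path (t : ℕ → EdgeTriple) (hm : ∀ n, (t n).IsMarkoff (τ + 2))
    (hstep : ∀ n, t (n + 1) = (t n).left ∨ t (n + 1) = (t n).right.swap)
    (hturn : ∃ᶠ n in Filter.atTop, t (n + 1) = (t n).right.swap)
    (hx : ∀ n, 2 < ‖(t n).x‖) (hy : ∀ n, 2 < ‖(t n).y‖) (hw : ∀ n, ‖(t n).z‖ < ‖(t n).w‖) :
    τ = 2 := by
  have hxw (n : ℕ) : (t (n + 1)).x * (t (n + 1)).w = (t n).x * (t n).y := by
    rcases hstep n with h | h <;> rw [h]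
    · rfl
    · exact mul_comm _ _
  have hyz (n : ℕ) : (t (n + 1)).y = (t n).z := by
    rcases hstep n with h | h <;> rw [h] <;> rfl
  have hzw (n : ℕ) : (t n).z + (t n).w = (t n).x * (t n).y := sub_add_cancel _ _
  set p : ℕ → ℝ := fun n => ‖(t n).x‖ * ‖(t n).y‖ with hp
  have hp4 (n : ℕ) : 4 ≤ p n := by simp only [hp]; nlinarith [hx n, hy n]
  have hpw (n : ℕ) : ‖(t (n + 1)).x‖ * ‖(t (n + 1)).w‖ = p n := by
    rw [← norm_mul, hxw, norm_mul]
  have hdec (n : ℕ) : ‖(t (n + 1)).x‖ * p (n + 1) ≤ 2 * p n := by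
    have h1 := norm_add_le (t (n + 1)).z (t (n + 1)).w
    rw [hzw, norm_mul] at h1
    have h2 := hw (n + 1)
    have h3 : p (n + 1) ≤ 2 * ‖(t (n + 1)).w‖ := by simp only [hp]; linarith
    rw [← hpw n]
    nlinarith [hx (n + 1)]
  have hanti : Antitone p := antitone_nat_of_succ_le fun n => by
    nlinarith [hdec n, hx (n + 1), hp4 (n + 1)]
  obtain ⟨P, hP⟩ : ∃ P, Filter.Tendsto p Filter.atTop (nhds P) :=
    ⟨_, tendsto_atTop_ciInf hanti ⟨4, by rintro _ ⟨n, rfl⟩; exact hp4 n⟩⟩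
  have hP4 : 4 ≤ P := ge_of_tendsto' hP hp4
  have hP0 : P ≠ 0 := by linarith
  have hP1 := (Filter.tendsto_add_atTop_iff_nat 1).2 hP
  have hx1 : Filter.Tendsto (fun n => ‖(t (n + 1)).x‖) Filter.atTop (nhds 2) := by
    have hup : Filter.Tendsto (fun n => 2 * p n / p (n + 1)) Filter.atTop (nhds 2) := by
      have h1 := (hP.const_mul 2).div hP1 hP0
      rw [mul_div_cancel_right₀ _ hP0] at h1
      exact h1
    refine tendsto_of_tendsto_of_tendsto_of_le_of_le tendsto_const_nhds hup
      (fun n => (hx (n + 1)).le) fun n => ?_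
    rw [le_div_iff₀ (by linarith [hp4 (n + 1)])]
    exact hdec n
  have hx0 : Filter.Tendsto (fun n => ‖(t n).x‖) Filter.atTop (nhds 2) :=
    (Filter.tendsto_add_atTop_iff_nat 1).1 hx1
  have hPeq : P = 4 := by
    refine le_antisymm ?_ hP4
    have h1 : Filter.Tendsto (fun n => ‖(t n).x‖ * ‖(t (n + 1)).x‖) Filter.atTop
        (nhds (2 * 2)) := hx0.mul hx1
    have h2 : P ≤ 2 * 2 := by
      refine ge_of_tendsto_of_frequently h1 (hturn.mono fun n hn => ?_)
      rw [hn]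
      exact hanti.le_of_tendsto hP n
    linarith
  rw [hPeq] at hP hP1 hP0
  have hy0 : Filter.Tendsto (fun n => ‖(t n).y‖) Filter.atTop (nhds 2) := by
    have h1 := hP.div hx0 (by norm_num)
    rw [show (4 / 2 : ℝ) = 2 by norm_num] at h1
    refine h1.congr fun n => ?_
    simp only [hp, Pi.div_apply]
    rw [mul_div_cancel_left₀]
    linarith [hx n]
  have hw1 : Filter.Tendsto (fun n => ‖(t (n + 1)).w‖) Filter.atTop (nhds 2) := by
    have h1 := hP.div hx1 (by norm_num)
    rw [show (4 / 2 : ℝ) = 2 by norm_num] at h1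
    refine h1.congr fun n => ?_
    simp only [Pi.div_apply]
    rw [← hpw, mul_div_cancel_left₀]
    linarith [hx (n + 1)]
  have hw0 : Filter.Tendsto (fun n => ‖(t n).w‖) Filter.atTop (nhds 2) :=
    (Filter.tendsto_add_atTop_iff_nat 1).1 hw1
  have hz0 : Filter.Tendsto (fun n => ‖(t n).z‖) Filter.atTop (nhds 2) := by
    simpa only [hyz] using (Filter.tendsto_add_atTop_iff_nat 1).2 hy0
  have hδ : Filter.Tendsto (fun n => ‖(t n).z - (t n).w‖ ^ 2) Filter.atTop (nhds 0) := by
    have h1 := (((hz0.pow 2).add (hw0.pow 2)).const_mul 2).sub (hP.pow 2)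
    rw [show (2 * (2 ^ 2 + 2 ^ 2) - 4 ^ 2 : ℝ) = 0 by norm_num] at h1
    refine h1.congr fun n => ?_
    have h2 := parallelogram_law_with_norm ℝ (t n).z (t n).w
    rw [hzw, norm_mul] at h2
    simp only [hp]
    linarith
  have hδ' : Filter.Tendsto (fun n => ‖(t n).z - (t n).w‖) Filter.atTop (nhds 0) := by
    simpa using hδ.sqrt
  have hx4 : Filter.Tendsto (fun n => ‖(t (n + 1)).x ^ 2 - 4‖) Filter.atTop (nhds 0) := by
    have h1 := ((((Filter.tendsto_add_atTop_iff_nat 1).2 hδ').const_mul 2).add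
      (hx1.mul hδ')).div_const 2
    simp only [mul_zero, add_zero, zero_div] at h1
    refine squeeze_zero (fun n => norm_nonneg _) (fun n => ?_) h1
    rw [le_div_iff₀ (by norm_num)]
    have e : ((t (n + 1)).x ^ 2 - 4) * (t (n + 1)).w =
        2 * ((t (n + 1)).z - (t (n + 1)).w) - (t (n + 1)).x * ((t n).z - (t n).w) := by
      linear_combination (t (n + 1)).x * hxw n - (t (n + 1)).x * hzw n - 2 * hzw (n + 1) -
        2 * (t (n + 1)).x * hyz n
    have h2 := congrArg norm e
    have h3 := norm_sub_le (2 * ((t (n + 1)).z - (t (n + 1)).w))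
      ((t (n + 1)).x * ((t n).z - (t n).w))
    rw [← h2, norm_mul, norm_mul, norm_mul, Complex.norm_ofNat] at h3
    have h4 : 2 < ‖(t (n + 1)).w‖ := (hyz (n + 1) ▸ hy (n + 2)).trans (hw (n + 1))
    nlinarith [norm_nonneg ((t (n + 1)).x ^ 2 - 4)]
  have hfin : Filter.Tendsto (fun n => ‖(t (n + 1)).x ^ 2 - 4‖ * (‖(t (n + 1)).y‖ ^ 2 + 4) +
      ‖(t (n + 1)).z - (t (n + 1)).w‖ ^ 2) Filter.atTop (nhds 0) := by
    have h1 := (hx4.mul ((((Filter.tendsto_add_atTop_iff_nat 1).2 hy0).pow 2).add_const 4)).add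
      ((Filter.tendsto_add_atTop_iff_nat 1).2 hδ)
    simpa using h1
  have hle (n : ℕ) : ‖16 - 4 * (τ + 2)‖ ≤ ‖(t (n + 1)).x ^ 2 - 4‖ * (‖(t (n + 1)).y‖ ^ 2 + 4) +
      ‖(t (n + 1)).z - (t (n + 1)).w‖ ^ 2 := by
    have e : 16 - 4 * (τ + 2) = ((t (n + 1)).x ^ 2 - 4) * ((t (n + 1)).y ^ 2 - 4) -
        ((t (n + 1)).z - (t (n + 1)).w) ^ 2 := by
      have h1 := hm (n + 1)
      simp only [IsMarkoff, z] at *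
      linear_combination 4 * h1
    rw [e]
    refine (norm_sub_le _ _).trans ?_
    rw [norm_mul, norm_pow]
    gcongr
    refine (norm_sub_le _ _).trans ?_
    rw [norm_pow, Complex.norm_ofNat]
  have h0 := norm_le_zero_iff.1 (ge_of_tendsto' hfin hle)
  linear_combination (-1 / 4 : ℂ) * h0

/-- The standing assumptions on the values at an edge and beyond it. -/
structure IsAdmissible (τ : ℂ) (s : EdgeTriple) : Prop where
  isMarkoff : s.IsMarkoff (τ + 2)
  x_notMem : s.x ∉ Complex.ofReal '' Set.Icc (-2 : ℝ) 2
  y_notMem : s.y ∉ Complex.ofReal '' Set.Icc (-2 : ℝ) 2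
  x_sq_ne : s.x ^ 2 ≠ τ + 2
  y_sq_ne : s.y ^ 2 ≠ τ + 2
  val_notMem : ∀ u, s.val u ∉ Complex.ofReal '' Set.Icc (-2 : ℝ) 2
  val_sq_ne : ∀ u, s.val u ^ 2 ≠ τ + 2

namespace IsAdmissible

theorem left (h : s.IsAdmissible τ) : s.left.IsAdmissible τ where
  isMarkoff := h.isMarkoff.left
  x_notMem := h.x_notMem
  y_notMem := h.val_notMem []
  x_sq_ne := h.x_sq_ne
  y_sq_ne := h.val_sq_ne []
  val_notMem u := h.val_notMem (false :: u)
  val_sq_ne u := h.val_sq_ne (false :: u)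

theorem right (h : s.IsAdmissible τ) : s.right.IsAdmissible τ where
  isMarkoff := h.isMarkoff.right
  x_notMem := h.val_notMem []
  y_notMem := h.y_notMem
  x_sq_ne := h.val_sq_ne []
  y_sq_ne := h.y_sq_ne
  val_notMem u := h.val_notMem (true :: u)
  val_sq_ne u := h.val_sq_ne (true :: u)

theorem swap (h : s.IsAdmissible τ) : s.swap.IsAdmissible τ where
  isMarkoff := h.isMarkoff.swap
  x_notMem := h.y_notMem
  y_notMem := h.x_notMem
  x_sq_ne := h.y_sq_ne
  y_sq_ne := h.x_sq_ne
  val_notMem u := by rw [val_swap]; exact h.val_notMem _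
  val_sq_ne u := by rw [val_swap]; exact h.val_sq_ne _

theorem hasIdentity (h : s.IsAdmissible τ) (hl : s.left.HasIdentity τ)
    (hr : s.right.HasIdentity τ) : s.HasIdentity τ :=
  hl.of_left_right h.isMarkoff h.x_sq_ne h.y_sq_ne (h.val_sq_ne []) hr

end IsAdmissible

theorem IsLarge.swap {R : ℝ} (h : s.IsLarge R) : s.swap.IsLarge R :=
  ⟨h.le_y, h.le_x, by simpa only [EdgeTriple.swap, z, mul_comm] using h.w_le_z⟩

/-- McShane's identity beyond an edge if all values beyond it have modulus greater than `2`. If it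
fails, then it fails all along some infinite path. The path cannot stay at one region; if the values
do not decrease along it, then they grow without bound. -/
theorem hasIdentity_of_forall_two_lt (hτ : τ ≠ 2) (hs : s.IsAdmissible τ)
    (hv : ∀ u, 2 < ‖s.val u‖) : s.HasIdentity τ := by
  by_contra hfail
  let Bad : EdgeTriple → Prop := fun s =>
    (s.IsAdmissible τ ∧ ∀ u, 2 < ‖s.val u‖) ∧ ¬ s.HasIdentity τ
  have hnext (s : {s // Bad s}) :
      ∃ s' : {s // Bad s}, s'.1 = s.1.left ∨ s'.1 = s.1.right.swap := by
    obtain ⟨s, ⟨ha, hv⟩, hn⟩ := s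
    by_cases hl : s.left.HasIdentity τ
    · have hr : ¬ s.right.swap.HasIdentity τ := fun hr => hn (ha.hasIdentity hl hr.swap)
      exact ⟨⟨s.right.swap, ⟨ha.right.swap, fun u => by
        rw [val_swap]; exact hv (true :: u.map not)⟩, hr⟩, Or.inr rfl⟩
    · exact ⟨⟨s.left, ⟨ha.left, fun u => hv (false :: u)⟩, hl⟩, Or.inl rfl⟩
  choose f hf using hnext
  let t' : ℕ → {s // Bad s} := fun n => f^[n] ⟨s, ⟨hs, hv⟩, hfail⟩
  let t : ℕ → EdgeTriple := fun n => (t' n).1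
  have hbad (n : ℕ) : Bad (t n) := (t' n).2
  have hstep (n : ℕ) : t (n + 1) = (t n).left ∨ t (n + 1) = (t n).right.swap := by
    have := hf (t' n)
    simp only [t, t', Function.iterate_succ_apply'] at *
    exact this
  clear_value t
  have hturn : ∃ᶠ n in Filter.atTop, t (n + 1) = (t n).right.swap := by
    intro hev
    obtain ⟨n₀, hn₀⟩ := Filter.eventually_atTop.1 hev
    have hleft (m : ℕ) : t (n₀ + m) = left^[m] (t n₀) := by
      induction m with
      | zero => rfl
      | succ m ih =>
        rw [Function.iterate_succ_apply', ← ih, ← add_assoc]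
        exact (hstep _).resolve_right (hn₀ _ (by omega))
    have ha := (hbad n₀).1.1
    obtain ⟨N, hN⟩ := exists_left_iterate_hasIdentity ha.isMarkoff ha.x_notMem ha.x_sq_ne
    rw [← hleft] at hN
    exact (hbad _).2 hN
  have hyz (n : ℕ) : (t (n + 1)).y = (t n).z := by
    rcases hstep n with h | h <;> rw [h] <;> rfl
  have hy (n : ℕ) : 2 < ‖(t (n + 1)).y‖ := by rw [hyz]; exact (hbad n).1.2 []
  obtain ⟨n₁, hn₁, ht₁⟩ := Filter.frequently_atTop.1 hturn 1
  have hx (n : ℕ) : 2 < ‖(t (n₁ + 1 + n)).x‖ := by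
    induction n with
    | zero =>
      rw [add_zero, ht₁]
      obtain ⟨m, rfl⟩ := Nat.exists_eq_add_of_le hn₁
      rw [add_comm 1 m]
      exact hy m
    | succ n ih =>
      rcases hstep (n₁ + 1 + n) with h | h <;> rw [← add_assoc, h]
      · exact ih
      · rw [show n₁ + 1 + n = n₁ + n + 1 by omega]
        exact hy (n₁ + n)
  by_cases hwz : ∃ n, ‖(t (n₁ + 1 + n)).w‖ ≤ ‖(t (n₁ + 1 + n)).z‖
  · obtain ⟨n₂, hn₂⟩ := hwz
    set N := n₁ + 1 + n₂ with hN
    have hxN : 2 < ‖(t N).x‖ := hx n₂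
    have hyN : 2 < ‖(t N).y‖ := by
      rw [hN, show n₁ + 1 + n₂ = n₁ + n₂ + 1 by omega]; exact hy _
    set m := min ‖(t N).x‖ ‖(t N).y‖ with hm
    have hm2 : 2 < m := lt_min hxN hyN
    have hpers {R : ℝ} (hR : 2 ≤ R) {k : ℕ} (hk : (t k).IsLarge R) (j : ℕ) (hj : k ≤ j) :
        (t j).IsLarge R := by
      induction j, hj using Nat.le_induction with
      | base => exact hk
      | succ j hj ih =>
        rcases hstep j with h | h <;> rw [h]
        · exact ih.left hR
        · exact (ih.right hR).swap
    have hgrow (j : ℕ) : ∃ k, (t k).IsLarge (m * (m / 2) ^ j) := by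
      induction j with
      | zero => exact ⟨N, by rw [pow_zero, mul_one]; exact ⟨min_le_left _ _, min_le_right _ _, hn₂⟩⟩
      | succ j ih =>
        obtain ⟨k, hk⟩ := ih
        set R := m * (m / 2) ^ j with hR
        have hone : 1 ≤ (m / 2) ^ j := one_le_pow₀ (by linarith)
        have hRm : m ≤ R := by rw [hR]; nlinarith
        have hnew (i : ℕ) (hi : k ≤ i) : R * (m / 2) ≤ ‖(t (i + 1)).y‖ := by
          have h1 := hpers (by linarith) hk i hi
          have h2 := norm_mul_le_two_mul_norm_z h1.w_le_z
          rw [hyz]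
          nlinarith [h1.le_x, h1.le_y]
        obtain ⟨i, hi, hti⟩ := Filter.frequently_atTop.1 hturn (k + 1)
        refine ⟨i + 1, ?_⟩
        rw [pow_succ, ← mul_assoc, ← hR]
        refine ⟨?_, hnew i (by omega), (hpers (by linarith) hk (i + 1) (by omega)).w_le_z⟩
        rw [hti]
        obtain ⟨l, rfl⟩ := Nat.exists_eq_add_of_le hi
        have := hnew (k + l) (by omega)
        rwa [show k + l + 1 = k + 1 + l by omega] at this
    obtain ⟨R, K, hR, -, -, -, hlarge⟩ := exists_isLarge_hasIdentity τ
    obtain ⟨j, hj⟩ := pow_unbounded_of_one_lt R (show 1 < m / 2 by linarith)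
    obtain ⟨k, hk⟩ := hgrow j
    have hle : R ≤ m * (m / 2) ^ j := by nlinarith
    exact (hbad k).2 (hlarge _ (hbad k).1.1.isMarkoff
      ⟨hle.trans hk.le_x, hle.trans hk.le_y, hk.w_le_z⟩).1
  · push Not at hwz
    refine hτ (eq_two_of_descending_path (fun n => t (n₁ + 1 + n))
      (fun n => (hbad _).1.1.isMarkoff) (fun n => hstep _) ?_ hx (fun n => ?_) hwz)
    · rw [Filter.frequently_atTop] at hturn ⊢
      intro a
      obtain ⟨b, hb, h⟩ := hturn (n₁ + 1 + a)
      obtain ⟨l, rfl⟩ := Nat.exists_eq_add_of_le hb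
      exact ⟨a + l, by omega, by simpa only [← add_assoc] using h⟩
    · rw [show n₁ + 1 + n = n₁ + n + 1 by omega]; exact hy _

/-- McShane's identity beyond an edge. -/
theorem IsAdmissible.hasIdentity_of_finite (hτ : τ ≠ 2) (hs : s.IsAdmissible τ)
    (hfin : {u | ‖s.val u‖ ≤ 2}.Finite) : s.HasIdentity τ := by
  obtain ⟨N, hN⟩ : ∃ N, ∀ u, N ≤ u.length → 2 < ‖s.val u‖ := by
    refine ⟨hfin.toFinset.sup List.length + 1, fun u hu => ?_⟩
    by_contra! h
    have := Finset.le_sup (f := List.length) (hfin.mem_toFinset.2 h)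
    omega
  clear hfin
  induction N generalizing s with
  | zero => exact hasIdentity_of_forall_two_lt hτ hs fun u => hN u (Nat.zero_le _)
  | succ N ih =>
    exact hs.hasIdentity (ih hs.left fun u hu => hN (false :: u) (by simpa using hu))
      (ih hs.right fun u hu => hN (true :: u) (by simpa using hu))

end EdgeTriple

namespace EdgeTriple

variable {τ : ℂ} {s : EdgeTriple}

/-! ### Sums over the complement of a subtree -/

/-- The edge reached by following a path in the tree. -/
def follow : EdgeTriple → List Bool → EdgeTriple
  | s, [] => s
  | s, false :: u => s.left.follow u
  | s, true :: u => s.right.follow u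

theorem finite_cons {s t : EdgeTriple} {b : Bool} (h : ∀ u, t.val u = s.val (b :: u))
    {A B : Set (List Bool)} (hAB : ∀ u, u ∈ B → b :: u ∈ A)
    (hfin : {u | u ∈ A ∧ ‖s.val u‖ ≤ 2}.Finite) : {u | u ∈ B ∧ ‖t.val u‖ ≤ 2}.Finite := by
  refine (hfin.preimage (f := List.cons b) (List.cons_injective.injOn)).subset ?_
  rintro u ⟨h1, h2⟩
  exact ⟨hAB u h1, by rwa [← h]⟩

/-- McShane's identity between two edges of a path: the sum of `𝔥_τ` over the regions beyond the
first edge that are not beyond the last edge. -/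
theorem IsAdmissible.exists_hasSum_not_prefix (hτ : τ ≠ 2) (hs : s.IsAdmissible τ)
    (W : List Bool) (hfin : {u | u ∈ {u | ¬ W <+: u} ∧ ‖s.val u‖ ≤ 2}.Finite) :
    ∃ S : ℂ, Summable (Set.indicator {u | ¬ W <+: u} fun u => ‖gap τ (s.val u)‖) ∧
      HasSum (Set.indicator {u | ¬ W <+: u} fun u => gap τ (s.val u)) S ∧
      Complex.exp S * (s.follow W).ratio τ = s.ratio τ := by
  induction W generalizing s with
  | nil =>
    refine ⟨0, ?_, ?_, by simp [follow]⟩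
    · simp
    · simp
  | cons b W ih =>
    have hind {E : Type} [Zero E] (g : List Bool → E) (b' : Bool) :
        (fun u => Set.indicator {u | ¬ (b :: W) <+: u} g (b' :: u)) =
        if b = b' then Set.indicator {u | ¬ W <+: u} fun u => g (b' :: u) else
          fun u => g (b' :: u) := by
      funext u
      split_ifs with h
      · subst h; simp [Set.indicator]
      · simp [Set.indicator, h]
    have hnil {E : Type} [Zero E] (g : List Bool → E) :
        Set.indicator {u | ¬ (b :: W) <+: u} g [] = g [] := by simp [Set.indicator]
    have hexp := ratio_eq_exp_gap_mul hs.isMarkoff hs.x_sq_ne hs.y_sq_ne (hs.val_sq_ne [])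
    cases b
    · obtain ⟨S, h1, h2, h3⟩ := ih hs.left (finite_cons (b := false) (fun u => rfl)
        (fun u hu => by simpa using hu) hfin)
      have hr := hs.right.hasIdentity_of_finite hτ (by
        simpa using finite_cons (s := s) (b := true) (B := Set.univ) (fun u => rfl)
          (fun u _ => by simp) hfin)
      refine ⟨gap τ s.z + (S + s.right.gapSum τ), ?_, ?_, ?_⟩
      · refine (hasSum_list_bool (by rw [hind]; simpa [val] using h1.hasSum)
          (by rw [hind]; simpa [val] using hr.1.hasSum)).summable
      · have := hasSum_list_bool
          (f := Set.indicator {u | ¬ (false :: W) <+: u} fun u => gap τ (s.val u))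
          (a := S) (b := s.right.gapSum τ)
          (by rw [hind]; simpa [val] using h2)
          (by rw [hind]; simpa [val, gapSum] using hr.1.of_norm.hasSum)
        rwa [hnil] at this
      · rw [Complex.exp_add, Complex.exp_add, hr.2, hexp, ← h3, follow]; ring
    · obtain ⟨S, h1, h2, h3⟩ := ih hs.right (finite_cons (b := true) (fun u => rfl)
        (fun u hu => by simpa using hu) hfin)
      have hl := hs.left.hasIdentity_of_finite hτ (by
        simpa using finite_cons (s := s) (b := false) (B := Set.univ) (fun u => rfl)
          (fun u _ => by simp) hfin)
      refine ⟨gap τ s.z + (s.left.gapSum τ + S), ?_, ?_, ?_⟩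
      · refine (hasSum_list_bool (by rw [hind]; simpa [val] using hl.1.hasSum)
          (by rw [hind]; simpa [val] using h1.hasSum)).summable
      · have := hasSum_list_bool
          (f := Set.indicator {u | ¬ (true :: W) <+: u} fun u => gap τ (s.val u))
          (a := s.left.gapSum τ) (b := S)
          (by rw [hind]; simpa [val, gapSum] using hl.1.of_norm.hasSum)
          (by rw [hind]; simpa [val] using h2)
        rwa [hnil] at this
      · rw [Complex.exp_add, Complex.exp_add, hl.2, hexp, ← h3, follow]; ring

/-- If the values at the two ends of a path agree, then the sum of `𝔥_τ` between the ends lies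
in `2πiℤ`. -/
theorem IsAdmissible.tsum_not_prefix (hτ : τ ≠ 2) (hs : s.IsAdmissible τ)
    (W : List Bool) (hW : s.follow W = s)
    (hfin : {u | u ∈ {u | ¬ W <+: u} ∧ ‖s.val u‖ ≤ 2}.Finite) :
    Summable (fun u : {u // ¬ W <+: u} => ‖gap τ (s.val u)‖) ∧
      ∃ n : ℤ, ∑' u : {u // ¬ W <+: u}, gap τ (s.val u) = n * (2 * Real.pi * Complex.I) := by
  obtain ⟨S, h1, h2, h3⟩ := hs.exists_hasSum_not_prefix hτ W hfin
  refine ⟨summable_subtype_iff_indicator.2 h1, ?_⟩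
  have h4 : HasSum (fun u : {u // ¬ W <+: u} => gap τ (s.val u)) S :=
    hasSum_subtype_iff_indicator.2 h2
  rw [h4.tsum_eq]
  rw [hW] at h3
  have h5 : Complex.exp S = 1 :=
    mul_right_cancel₀ (ratio_ne_zero hs.isMarkoff hs.x_sq_ne hs.y_sq_ne) (by rw [h3, one_mul])
  exact Complex.exp_eq_one_iff.1 h5

end EdgeTriple

/-! ### Hyperbolic matrices and the Stern–Brocot tree -/

/-- The two standard unipotent matrices, which map the Farey interval `[0, ∞]` to its left and
right halves `[1, ∞]` and `[0, 1]`. -/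
def halfMatrix : Bool → SL(2, ℤ)
  | false => ⟨!![1, 1; 0, 1], by simp [Matrix.det_fin_two]⟩
  | true => ⟨!![1, 0; 1, 1], by simp [Matrix.det_fin_two]⟩

/-- The product of standard unipotent matrices spelled by a word. -/
def wordMatrix : List Bool → SL(2, ℤ)
  | [] => 1
  | b :: u => halfMatrix b * wordMatrix u

theorem exists_wordMatrix_eq (P : SL(2, ℤ)) (hP : ∀ i j, 0 ≤ P.val i j) :
    ∃ W, P = wordMatrix W := by
  obtain ⟨N, hN⟩ : ∃ N : ℕ, P.val 0 0 + P.val 0 1 + P.val 1 0 + P.val 1 1 ≤ N :=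
    ⟨_, Int.self_le_toNat _⟩
  induction N generalizing P with
  | zero =>
    have hd := P.det_coe
    rw [Matrix.det_fin_two] at hd
    have h1 := hP 0 0
    have h2 := hP 0 1
    have h3 := hP 1 0
    have h4 := hP 1 1
    have : P.val 0 0 = 0 := by push_cast at hN; omega
    have h6 : P.val 0 1 = 0 := by push_cast at hN; omega
    rw [this, h6] at hd
    simp at hd
  | succ N ih =>
    have hd := P.det_coe
    rw [Matrix.det_fin_two] at hd
    have h1 := hP 0 0
    have h2 := hP 0 1
    have h3 := hP 1 0
    have h4 := hP 1 1
    set a := P.val 0 0 with ha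
    set b := P.val 0 1 with hb
    set c := P.val 1 0 with hc
    set d := P.val 1 1 with hdd
    push_cast at hN
    have hPe : P.val = !![a, b; c, d] := Matrix.eta_fin_two _
    by_cases hL : c ≤ a ∧ d ≤ b
    · have hcd : 0 < c + d := by
        by_contra h
        have h5 : c = 0 := by omega
        have h6 : d = 0 := by omega
        rw [h5, h6] at hd; simp at hd
      obtain ⟨W, hW⟩ := ih ⟨!![a - c, b - d; c, d], by
        rw [Matrix.det_fin_two_of]; linarith⟩ (by
          intro i j; fin_cases i <;> fin_cases j <;> simp <;> omega) (by simp; omega)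
      refine ⟨false :: W, ?_⟩
      rw [wordMatrix, ← hW]
      apply Subtype.ext
      rw [hPe]
      change _ = !![1, 1; 0, 1] * !![a - c, b - d; c, d]
      simp
    · by_cases hR : a ≤ c ∧ b ≤ d
      · have hab : 0 < a + b := by
          by_contra h
          have h5 : a = 0 := by omega
          have h6 : b = 0 := by omega
          rw [h5, h6] at hd; simp at hd
        obtain ⟨W, hW⟩ := ih ⟨!![a, b; c - a, d - b], by
          rw [Matrix.det_fin_two_of]; linarith⟩ (by
            intro i j; fin_cases i <;> fin_cases j <;> simp <;> omega) (by simp; omega)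
        refine ⟨true :: W, ?_⟩
        rw [wordMatrix, ← hW]
        apply Subtype.ext
        rw [hPe]
        change _ = !![1, 0; 1, 1] * !![a, b; c - a, d - b]
        simp
      · refine ⟨[], ?_⟩
        apply Subtype.ext
        rw [hPe, wordMatrix]
        have hcase : (c + 1 ≤ a ∧ b + 1 ≤ d) ∨ (a + 1 ≤ c ∧ d + 1 ≤ b) := by omega
        rcases hcase with ⟨h5, h6⟩ | ⟨h5, h6⟩
        · have h7 : b + c = 0 := by nlinarith
          have hb0 : b = 0 := by omega
          have hc0 : c = 0 := by omega
          rw [hb0, hc0, mul_zero, sub_zero] at hd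
          have h8 : a = 1 := Int.eq_one_of_mul_eq_one_right h1 hd
          have h9 : d = 1 := by rw [h8] at hd; linarith
          rw [hb0, hc0, h8, h9]
          exact Matrix.one_fin_two.symm
        · nlinarith

theorem exists_abs_sub_mul_le (m c : ℤ) (hc : c ≠ 0) : ∃ k : ℤ, |m - 2 * k * c| ≤ |c| := by
  have h1 := Int.emod_nonneg m (show 2 * c ≠ 0 by omega)
  have h2 := Int.emod_lt_abs m (show 2 * c ≠ 0 by omega)
  have h3 := Int.emod_add_mul_ediv m (2 * c)
  rw [abs_mul, abs_two] at h2
  by_cases h : m % (2 * c) ≤ |c|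
  · exact ⟨m / (2 * c), by rw [abs_le]; constructor <;> nlinarith [abs_nonneg c]⟩
  · rcases abs_cases c with ⟨h4, -⟩ | ⟨h4, -⟩
    · exact ⟨m / (2 * c) + 1, by rw [abs_le]; constructor <;> nlinarith⟩
    · exact ⟨m / (2 * c) - 1, by rw [abs_le]; constructor <;> nlinarith⟩

/-- A hyperbolic element of `SL(2, ℤ)` is conjugate up to sign to a matrix with positive entries.
A conjugate with smallest lower left entry `c` and with `|a - d| ≤ |c|` has `b c > 0`. -/
theorem exists_conj_pos {H : SL(2, ℤ)} (hH : H.val.IsHyperbolic) :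
    ∃ M P : SL(2, ℤ), (∀ i j, 0 < P.val i j) ∧ (H * M = M * P ∨ H * M = M * -P) := by
  have hex : ∃ n : ℕ, ∃ M : SL(2, ℤ), ((M⁻¹ * H * M).val 1 0).natAbs = n := ⟨_, 1, rfl⟩
  classical
  obtain ⟨M₀, hM₀⟩ := Nat.find_spec hex
  have hmin (M : SL(2, ℤ)) :
      ((M₀⁻¹ * H * M₀).val 1 0).natAbs ≤ ((M⁻¹ * H * M).val 1 0).natAbs := by
    rw [hM₀]; exact Nat.find_min' hex ⟨M, rfl⟩
  -- invariants of a conjugate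
  have hinv (M : SL(2, ℤ)) : 0 < ((M⁻¹ * H * M).val 0 0 - (M⁻¹ * H * M).val 1 1) ^ 2 +
      4 * ((M⁻¹ * H * M).val 0 1 * (M⁻¹ * H * M).val 1 0) := by
    have htr : (M⁻¹ * H * M).val.trace = H.val.trace := by
      rw [Matrix.SpecialLinearGroup.coe_mul, Matrix.trace_mul_comm,
        ← Matrix.SpecialLinearGroup.coe_mul, mul_inv_cancel_left]
    have h1 := (M⁻¹ * H * M).det_coe
    have h2 := H.det_coe
    rw [Matrix.IsHyperbolic, Matrix.discr_fin_two, h2, ← htr, Matrix.trace_fin_two] at hH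
    rw [Matrix.det_fin_two] at h1
    nlinarith
  have hc0 : (M₀⁻¹ * H * M₀).val 1 0 ≠ 0 := by
    intro h
    have h1 := (M₀⁻¹ * H * M₀).det_coe
    have h2 := hinv M₀
    rw [Matrix.det_fin_two, h, mul_zero, sub_zero] at h1
    rw [h, mul_zero, mul_zero, add_zero] at h2
    rcases Int.eq_one_or_neg_one_of_mul_eq_one' h1 with ⟨h3, h4⟩ | ⟨h3, h4⟩ <;>
      rw [h3, h4] at h2 <;> simp at h2
  obtain ⟨k, hk⟩ := exists_abs_sub_mul_le
    ((M₀⁻¹ * H * M₀).val 0 0 - (M₀⁻¹ * H * M₀).val 1 1) _ hc0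
  obtain ⟨T, hT⟩ : ∃ T : SL(2, ℤ), T.val = !![1, k; 0, 1] :=
    ⟨⟨_, by simp [Matrix.det_fin_two]⟩, rfl⟩
  obtain ⟨S, hS⟩ : ∃ S : SL(2, ℤ), S.val = !![0, -1; 1, 0] :=
    ⟨⟨_, by simp [Matrix.det_fin_two]⟩, rfl⟩
  set A := (M₀ * T)⁻¹ * H * (M₀ * T) with hA
  have hAT : A = T⁻¹ * (M₀⁻¹ * H * M₀) * T := by rw [hA]; group
  have hconj (B : SL(2, ℤ)) : (S⁻¹ * B * S).val =
      !![B.val 1 1, -B.val 1 0; -B.val 0 1, B.val 0 0] := by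
    rw [Matrix.SpecialLinearGroup.coe_mul, Matrix.SpecialLinearGroup.coe_mul,
      Matrix.SpecialLinearGroup.coe_inv, hS, Matrix.eta_fin_two B.val]
    simp [Matrix.adjugate_fin_two]
  have hTe : A.val = !![(M₀⁻¹ * H * M₀).val 0 0 - k * (M₀⁻¹ * H * M₀).val 1 0, A.val 0 1;
      (M₀⁻¹ * H * M₀).val 1 0, (M₀⁻¹ * H * M₀).val 1 1 + k * (M₀⁻¹ * H * M₀).val 1 0] := by
    rw [hAT]
    generalize M₀⁻¹ * H * M₀ = B
    rw [Matrix.SpecialLinearGroup.coe_mul, Matrix.SpecialLinearGroup.coe_mul,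
      Matrix.SpecialLinearGroup.coe_inv, hT, Matrix.eta_fin_two B.val]
    simp [Matrix.adjugate_fin_two]
    ring_nf
    simp
  have hc : A.val 1 0 = (M₀⁻¹ * H * M₀).val 1 0 := by rw [hTe]; rfl
  have had : |A.val 0 0 - A.val 1 1| ≤ |A.val 1 0| := by
    rw [hc]
    refine le_of_eq_of_le (congrArg abs ?_) hk
    rw [hTe]; simp; ring
  have hb : |A.val 1 0| ≤ |A.val 0 1| := by
    have h1 := hmin (M₀ * T * S)
    have h2 : (M₀ * T * S)⁻¹ * H * (M₀ * T * S) = S⁻¹ * A * S := by rw [hA]; group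
    rw [h2, hconj, ← hc] at h1
    simp at h1
    rw [Int.abs_eq_natAbs, Int.abs_eq_natAbs]
    exact_mod_cast h1
  have hdisc := hinv (M₀ * T)
  rw [← hA] at hdisc
  rw [← hc] at hc0
  have hdet := A.det_coe
  rw [Matrix.det_fin_two] at hdet
  have hHA : H * (M₀ * T) = (M₀ * T) * A := by rw [hA]; group
  clear_value A
  have hAe := Matrix.eta_fin_two A.val
  set a := A.val 0 0
  set b := A.val 0 1
  set c := A.val 1 0
  set d := A.val 1 1
  have hbc : 0 < b * c := by
    by_contra hneg
    have h1 : |c| * |c| ≤ |b| * |c| := by gcongr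
    rw [abs_mul_abs_self, ← abs_mul, abs_of_nonpos (not_lt.1 hneg)] at h1
    have h2 : (a - d) ^ 2 ≤ c ^ 2 := sq_le_sq.2 had
    have h3 : 0 < c ^ 2 := by positivity
    nlinarith
  have hHS (B : SL(2, ℤ)) (h : H * (M₀ * T) = (M₀ * T) * B) :
      H * (M₀ * T * S) = (M₀ * T * S) * (S⁻¹ * B * S) := by
    rw [← mul_assoc H, h]; group
  have hneg (B : SL(2, ℤ)) : S⁻¹ * -B * S = -(S⁻¹ * B * S) := by simp
  have hadpos : 0 < a * d := by linarith
  rcases pos_and_pos_or_neg_and_neg_of_mul_pos hbc with ⟨hb1, hc1⟩ | ⟨hb1, hc1⟩ <;>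
  rcases pos_and_pos_or_neg_and_neg_of_mul_pos hadpos with ⟨ha1, hd1⟩ | ⟨ha1, hd1⟩
  · refine ⟨M₀ * T, A, ?_, Or.inl hHA⟩
    rw [hAe]; intro i j; fin_cases i <;> fin_cases j <;> simpa
  · refine ⟨M₀ * T * S, -(S⁻¹ * A * S), ?_, Or.inr ?_⟩
    · intro i j
      rw [Matrix.SpecialLinearGroup.coe_neg, hconj]
      fin_cases i <;> fin_cases j <;> simpa
    · rw [neg_neg]; exact hHS A hHA
  · refine ⟨M₀ * T * S, S⁻¹ * A * S, ?_, Or.inl (hHS A hHA)⟩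
    intro i j
    rw [hconj]
    fin_cases i <;> fin_cases j <;> simpa
  · refine ⟨M₀ * T, -A, ?_, Or.inr (by rw [neg_neg]; exact hHA)⟩
    rw [Matrix.SpecialLinearGroup.coe_neg, hAe]
    intro i j; fin_cases i <;> fin_cases j <;> simpa

/-! ### Regions as primitive vectors -/

/-- The region `p/q` of a nonzero vector `(p, q)`, with `p/0 = ∞`. -/
def slope (p q : ℤ) : Region :=
  if q = 0 then OnePoint.infty else (((p : ℚ) / q : ℚ) : OnePoint ℚ)

theorem slope_neg (p q : ℤ) : slope (-p) (-q) = slope p q := by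
  simp [slope, neg_div_neg_eq]

theorem slope_num_den (X : Region) : slope X.num X.den = X := by
  rcases X with _ | q
  · rfl
  · change slope q.num q.den = _
    rw [slope, if_neg (by exact_mod_cast q.den_ne_zero)]
    exact congrArg _ (by exact_mod_cast Rat.num_div_den q)

theorem isCoprime_num_den (X : Region) : IsCoprime X.num X.den := by
  rcases X with _ | q
  · exact isCoprime_one_left
  · exact Rat.isCoprime_num_den q

theorem num_den_slope {p q : ℤ} (h : IsCoprime p q) :
    ((slope p q).num = p ∧ (slope p q).den = q) ∨
      ((slope p q).num = -p ∧ (slope p q).den = -q) := by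
  have key {p q : ℤ} (h : IsCoprime p q) (hq : 0 < q) :
      (slope p q).num = p ∧ (slope p q).den = q := by
    rw [slope, if_neg hq.ne']
    have h1 := Int.isCoprime_iff_gcd_eq_one.1 h
    exact ⟨Rat.num_div_eq_of_coprime hq h1, Rat.den_div_eq_of_coprime hq h1⟩
  rcases lt_trichotomy q 0 with hq | rfl | hq
  · right
    rw [← slope_neg]
    exact key h.neg_neg (by omega)
  · rw [slope, if_pos rfl]
    rcases Int.isUnit_iff.1 (isCoprime_zero_right.1 h) with rfl | rfl
    · exact Or.inl ⟨rfl, rfl⟩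
    · exact Or.inr ⟨rfl, rfl⟩
  · exact Or.inl (key h hq)

theorem fareyNeighbors_slope {p q r s : ℤ} (h₁ : IsCoprime p q) (h₂ : IsCoprime r s) :
    FareyNeighbors (slope p q) (slope r s) ↔ |p * s - r * q| = 1 := by
  rw [FareyNeighbors]
  rcases num_den_slope h₁ with ⟨e1, e2⟩ | ⟨e1, e2⟩ <;>
    rcases num_den_slope h₂ with ⟨e3, e4⟩ | ⟨e3, e4⟩ <;> rw [e1, e2, e3, e4]
  · rw [← abs_neg]; ring_nf
  · rw [← abs_neg]; ring_nf
  · ring_nf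

theorem moebius_smul_slope (M : SL(2, ℤ)) {p q : ℤ} (h : IsCoprime p q) :
    moebius M • slope p q =
      slope (M.val 0 0 * p + M.val 0 1 * q) (M.val 1 0 * p + M.val 1 1 * q) := by
  have hM (i j) : moebius M i j = (M.val i j : ℚ) := rfl
  by_cases hq : q = 0
  · subst hq
    have hp : p ≠ 0 := by rintro rfl; exact not_isCoprime_zero_zero h
    have hp' : (p : ℚ) ≠ 0 := by exact_mod_cast hp
    rw [slope, if_pos rfl, OnePoint.smul_infty_eq_ite, slope, hM, hM]
    simp only [mul_zero, add_zero, mul_eq_zero, hp, or_false, Int.cast_eq_zero]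
    split_ifs with h1
    · rfl
    · congr 1
      push_cast
      rw [mul_div_mul_right _ _ hp']
  · have hq' : (q : ℚ) ≠ 0 := by exact_mod_cast hq
    rw [slope, if_neg hq, OnePoint.smul_some_eq_ite, slope]
    simp only [hM]
    have e1 : (M.val 1 0 : ℚ) * (p / q) + M.val 1 1 =
        ((M.val 1 0 * p + M.val 1 1 * q : ℤ) : ℚ) / q := by push_cast; field_simp
    have e2 : (M.val 0 0 : ℚ) * (p / q) + M.val 0 1 =
        ((M.val 0 0 * p + M.val 0 1 * q : ℤ) : ℚ) / q := by push_cast; field_simp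
    rw [e1, e2, div_div_div_cancel_right₀ hq']
    simp only [div_eq_zero_iff, hq', or_false, Int.cast_eq_zero]

theorem isCoprime_mulVec (M : SL(2, ℤ)) {p q : ℤ} (h : IsCoprime p q) :
    IsCoprime (M.val 0 0 * p + M.val 0 1 * q) (M.val 1 0 * p + M.val 1 1 * q) := by
  obtain ⟨a, b, hab⟩ := h
  have hd := M.det_coe
  rw [Matrix.det_fin_two] at hd
  exact ⟨a * M.val 1 1 - b * M.val 1 0, -a * M.val 0 1 + b * M.val 0 0, by
    linear_combination hab + (a * p + b * q) * hd⟩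

theorem moebius_neg_smul (M : SL(2, ℤ)) (X : Region) : moebius (-M) • X = moebius M • X := by
  rw [← slope_num_den X, moebius_smul_slope _ (isCoprime_num_den X),
    moebius_smul_slope _ (isCoprime_num_den X), ← slope_neg]
  congr 1 <;> simp [add_comm]

theorem fareyNeighbors_moebius (M : SL(2, ℤ)) {X Y : Region} (h : FareyNeighbors X Y) :
    FareyNeighbors (moebius M • X) (moebius M • Y) := by
  have hX := isCoprime_num_den X
  have hY := isCoprime_num_den Y
  rw [← slope_num_den X, ← slope_num_den Y] at h ⊢
  rw [fareyNeighbors_slope hX hY] at h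
  rw [moebius_smul_slope _ hX, moebius_smul_slope _ hY,
    fareyNeighbors_slope (isCoprime_mulVec M hX) (isCoprime_mulVec M hY)]
  refine Eq.trans ?_ h
  have hd := M.det_coe
  rw [Matrix.det_fin_two] at hd
  congr 1
  linear_combination (X.num * Y.den - Y.num * X.den) * hd

theorem exists_moebius_smul_infty (X : Region) :
    ∃ M : SL(2, ℤ), moebius M • (OnePoint.infty : Region) = X := by
  obtain ⟨a, b, hab⟩ := isCoprime_num_den X
  obtain ⟨M, hM⟩ : ∃ M : SL(2, ℤ), M.val = !![X.num, -b; X.den, a] :=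
    ⟨⟨_, by rw [Matrix.det_fin_two_of]; linarith⟩, rfl⟩
  refine ⟨M, ?_⟩
  have : (OnePoint.infty : Region) = slope 1 0 := rfl
  rw [this, moebius_smul_slope _ isCoprime_one_left]
  simp [hM, slope_num_den]

/-! ### The Stern–Brocot enumeration of the regions beyond an edge -/

/-- The nodes of the Stern–Brocot tree, as positive rational numbers. -/
def node : List Bool → ℚ
  | [] => 1
  | false :: u => node u + 1
  | true :: u => node u / (node u + 1)

theorem node_pos (u : List Bool) : 0 < node u := by
  induction u with
  | nil => exact one_pos
  | cons b u ih => cases b <;> simp only [node] <;> positivity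

theorem node_injective : Function.Injective node := by
  have h1 (u) : 1 < node (false :: u) := by have := node_pos u; simp only [node]; linarith
  have h2 (u) : node (true :: u) < 1 := by
    have := node_pos u
    simp only [node]
    rw [div_lt_one (by linarith)]; linarith
  intro u
  induction u with
  | nil =>
    rintro (_ | ⟨_ | _, v⟩) h
    · rfl
    · exact absurd h (h1 v).ne
    · exact absurd h (h2 v).ne'
  | cons b u ih =>
    rintro (_ | ⟨b', v⟩) h
    · cases b
      · exact absurd h (h1 u).ne'
      · exact absurd h (h2 u).ne
    · cases b <;> cases b'
      · rw [ih (add_right_cancel h)]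
      · exact absurd h ((h2 v).trans (h1 u)).ne'
      · exact absurd h ((h2 u).trans (h1 v)).ne
      · have hu := node_pos u
        have hv := node_pos v
        simp only [node] at h
        rw [div_eq_div_iff (by linarith) (by linarith)] at h
        rw [ih (by linarith : node u = node v)]

theorem exists_node_eq {p q : ℤ} (hp : 0 < p) (hq : 0 < q) (h : IsCoprime p q) :
    ∃ u, node u = (p : ℚ) / q := by
  obtain ⟨N, hN⟩ : ∃ N : ℕ, p + q ≤ N := ⟨_, Int.self_le_toNat _⟩
  induction N generalizing p q with
  | zero => push_cast at hN; omega
  | succ N ih =>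
    push_cast at hN
    have hp' : (0 : ℚ) < p := by exact_mod_cast hp
    have hq' : (0 : ℚ) < q := by exact_mod_cast hq
    rcases lt_trichotomy p q with hlt | rfl | hlt
    · obtain ⟨u, hu⟩ := ih hp (show 0 < q - p by omega)
        (by simpa [sub_eq_add_neg] using h.add_mul_left_right (-1))
        (by omega)
      refine ⟨true :: u, ?_⟩
      have : (0 : ℚ) < q - p := by exact_mod_cast (show 0 < q - p by omega)
      simp only [node, hu]
      push_cast
      field_simp
      ring
    · refine ⟨[], ?_⟩
      rw [div_self hp'.ne']; rfl
    · obtain ⟨u, hu⟩ := ih (show 0 < p - q by omega) hq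
        (by simpa [sub_eq_add_neg] using h.add_mul_left_left (-1))
        (by omega)
      refine ⟨false :: u, ?_⟩
      simp only [node, hu]
      push_cast
      field_simp
      ring

theorem moebius_halfMatrix_false_smul {x : ℚ} :
    moebius (halfMatrix false) • (x : Region) = ((x + 1 : ℚ) : Region) := by
  have hM (i j) : moebius (halfMatrix false) i j =
      ((!![1, 1; 0, 1] : Matrix (Fin 2) (Fin 2) ℤ) i j : ℚ) := rfl
  rw [OnePoint.smul_some_eq_ite]
  simp [hM]

theorem moebius_halfMatrix_true_smul {x : ℚ} (hx : x + 1 ≠ 0) :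
    moebius (halfMatrix true) • (x : Region) = ((x / (x + 1) : ℚ) : Region) := by
  have hM (i j) : moebius (halfMatrix true) i j =
      ((!![1, 0; 1, 1] : Matrix (Fin 2) (Fin 2) ℤ) i j : ℚ) := rfl
  rw [OnePoint.smul_some_eq_ite]
  simp [hM, hx]

theorem moebius_halfMatrix_false_smul_infty :
    moebius (halfMatrix false) • (OnePoint.infty : Region) = OnePoint.infty := by
  have hM (i j) : moebius (halfMatrix false) i j =
      ((!![1, 1; 0, 1] : Matrix (Fin 2) (Fin 2) ℤ) i j : ℚ) := rfl
  rw [OnePoint.smul_infty_eq_ite]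
  simp [hM]

theorem moebius_halfMatrix_true_smul_infty :
    moebius (halfMatrix true) • (OnePoint.infty : Region) = ((1 : ℚ) : Region) := by
  have hM (i j) : moebius (halfMatrix true) i j =
      ((!![1, 0; 1, 1] : Matrix (Fin 2) (Fin 2) ℤ) i j : ℚ) := rfl
  rw [OnePoint.smul_infty_eq_ite]
  simp [hM]

theorem moebius_halfMatrix_true_smul_neg_one :
    moebius (halfMatrix true) • ((-1 : ℚ) : Region) = OnePoint.infty := by
  have hM (i j) : moebius (halfMatrix true) i j =
      ((!![1, 0; 1, 1] : Matrix (Fin 2) (Fin 2) ℤ) i j : ℚ) := rfl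
  rw [OnePoint.smul_some_eq_ite]
  simp [hM]

theorem moebius_wordMatrix_smul_node (W u : List Bool) :
    moebius (wordMatrix W) • (node u : Region) = (node (W ++ u) : Region) := by
  induction W with
  | nil => simp [wordMatrix]
  | cons b W ih =>
    have hpos := node_pos (W ++ u)
    rw [wordMatrix, moebius, map_mul, mul_smul, ih]
    cases b
    · exact moebius_halfMatrix_false_smul
    · exact moebius_halfMatrix_true_smul (by positivity)

/-! ### The edges of a generalized Markoff map -/

/-- The values of `φ` around the image under `M` of the edge between the regions `∞` and `0`,
directed from `-1` to `1`. -/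
def edgeTriple (φ : Region → ℂ) (M : SL(2, ℤ)) : EdgeTriple where
  x := φ (moebius M • OnePoint.infty)
  y := φ (moebius M • ((0 : ℚ) : Region))
  w := φ (moebius M • ((-1 : ℚ) : Region))

section

variable {μ : ℂ} {φ : Region → ℂ}

theorem fareyNeighbors_infty (n : ℤ) :
    FareyNeighbors OnePoint.infty (((n : ℚ)) : Region) := by
  change |(1 : ℤ) * (n : ℚ).den - (n : ℚ).num * 0| = 1
  simp

theorem fareyNeighbors_intCast (m n : ℤ) (h : |m - n| = 1) :
    FareyNeighbors (((m : ℚ)) : Region) (((n : ℚ)) : Region) := by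
  change |(m : ℚ).num * (n : ℚ).den - (n : ℚ).num * (m : ℚ).den| = 1
  simpa using h

theorem FareyNeighbors.symm {X Y : Region} (h : FareyNeighbors X Y) : FareyNeighbors Y X := by
  rw [FareyNeighbors, abs_sub_comm]; exact h

theorem edgeTriple_isMarkoff (hφ : IsMarkoffMap μ φ) (M : SL(2, ℤ)) :
    (edgeTriple φ M).IsMarkoff μ := by
  have h1 := fareyNeighbors_moebius M (fareyNeighbors_infty 0)
  have h2 := fareyNeighbors_moebius M (fareyNeighbors_infty (-1))
  have h3 := fareyNeighbors_moebius M (fareyNeighbors_intCast 0 (-1) (by norm_num))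
  push_cast at h1 h2 h3
  exact hφ.1 _ _ _ h1 h3 h2.symm

theorem edgeTriple_z (hφ : IsMarkoffMap μ φ) (M : SL(2, ℤ)) :
    (edgeTriple φ M).z = φ (moebius M • ((1 : ℚ) : Region)) := by
  have h1 := fareyNeighbors_moebius M (fareyNeighbors_infty 0)
  have h2 := fareyNeighbors_moebius M (fareyNeighbors_infty (-1))
  have h3 := fareyNeighbors_moebius M (fareyNeighbors_intCast 0 (-1) (by norm_num))
  have h4 := fareyNeighbors_moebius M (fareyNeighbors_infty 1)
  have h5 := fareyNeighbors_moebius M (fareyNeighbors_intCast 0 1 (by norm_num))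
  push_cast at h1 h2 h3 h4 h5
  have hne : moebius M • ((1 : ℚ) : Region) ≠ moebius M • ((-1 : ℚ) : Region) := by
    intro h
    have := OnePoint.coe_injective (smul_left_cancel _ h)
    norm_num at this
  have := hφ.2 _ _ _ _ h1 h4 h5 h2 h3 hne
  rw [EdgeTriple.z, edgeTriple]
  linear_combination this

theorem edgeTriple_left (hφ : IsMarkoffMap μ φ) (M : SL(2, ℤ)) :
    (edgeTriple φ M).left = edgeTriple φ (M * halfMatrix false) := by
  rw [EdgeTriple.left, edgeTriple_z hφ]
  simp only [edgeTriple, moebius, map_mul, mul_smul]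
  have h0 := moebius_halfMatrix_false_smul_infty
  have h1 := moebius_halfMatrix_false_smul (x := 0)
  have h2 := moebius_halfMatrix_false_smul (x := -1)
  rw [zero_add] at h1
  rw [neg_add_cancel] at h2
  rw [h0, h1, h2]

theorem edgeTriple_right (hφ : IsMarkoffMap μ φ) (M : SL(2, ℤ)) :
    (edgeTriple φ M).right = edgeTriple φ (M * halfMatrix true) := by
  rw [EdgeTriple.right, edgeTriple_z hφ]
  simp only [edgeTriple, moebius, map_mul, mul_smul]
  have h0 := moebius_halfMatrix_true_smul_infty
  have h1 := moebius_halfMatrix_true_smul (x := 0) (by norm_num)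
  have h2 := moebius_halfMatrix_true_smul_neg_one
  rw [zero_div] at h1
  rw [h0, h1, h2]

theorem edgeTriple_follow (hφ : IsMarkoffMap μ φ) (M : SL(2, ℤ)) (u : List Bool) :
    (edgeTriple φ M).follow u = edgeTriple φ (M * wordMatrix u) := by
  induction u generalizing M with
  | nil => simp [EdgeTriple.follow, wordMatrix]
  | cons b u ih =>
    cases b
    · rw [EdgeTriple.follow, edgeTriple_left hφ, ih, wordMatrix, mul_assoc]
    · rw [EdgeTriple.follow, edgeTriple_right hφ, ih, wordMatrix, mul_assoc]

theorem edgeTriple_val (hφ : IsMarkoffMap μ φ) (M : SL(2, ℤ)) (u : List Bool) :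
    (edgeTriple φ M).val u = φ (moebius M • (node u : Region)) := by
  induction u generalizing M with
  | nil => exact edgeTriple_z hφ M
  | cons b u ih =>
    have e : (node (b :: u) : Region) = moebius (halfMatrix b) • (node u : Region) := by
      have := moebius_wordMatrix_smul_node [b] u
      rw [wordMatrix, wordMatrix, mul_one] at this
      exact this.symm
    cases b
    · rw [EdgeTriple.val, edgeTriple_left hφ, ih, e, moebius, map_mul, mul_smul]
    · rw [EdgeTriple.val, edgeTriple_right hφ, ih, e, moebius, map_mul, mul_smul]

end

/-! ### A fundamental domain for a hyperbolic matrix -/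

/-- A matrix with positive entries eventually moves every region into the positive rationals. -/
theorem exists_pow_smul_eq_node {P : SL(2, ℤ)} (hP : ∀ i j, 0 < P.val i j) (X : Region) :
    ∃ (n : ℕ) (u : List Bool), moebius P ^ n • X = (node u : Region) := by
  have ha := hP 0 0
  have hb := hP 0 1
  have hc := hP 1 0
  have hd := hP 1 1
  have hdet := P.det_coe
  rw [Matrix.det_fin_two] at hdet
  have hcop {p q : ℤ} (h : IsCoprime p q) := isCoprime_mulVec P h
  have hsm {p q : ℤ} (h : IsCoprime p q) := moebius_smul_slope P h
  set a := P.val 0 0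
  set b := P.val 0 1
  set c := P.val 1 0
  set d := P.val 1 1
  have hpos {p q : ℤ} (h : IsCoprime p q) (hpq : 0 < p * q) :
      ∃ (n : ℕ) (u : List Bool), moebius P ^ n • slope p q = (node u : Region) := by
    have key {p q : ℤ} (h : IsCoprime p q) (hp : 0 < p) (hq : 0 < q) :
        ∃ u : List Bool, slope p q = (node u : Region) := by
      obtain ⟨u, hu⟩ := exists_node_eq hp hq h
      exact ⟨u, by rw [slope, if_neg hq.ne', hu]⟩
    rcases pos_and_pos_or_neg_and_neg_of_mul_pos hpq with ⟨h1, h2⟩ | ⟨h1, h2⟩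
    · obtain ⟨u, hu⟩ := key h h1 h2
      exact ⟨0, u, by rw [pow_zero, one_smul, hu]⟩
    · obtain ⟨u, hu⟩ := key h.neg_neg (neg_pos.2 h1) (neg_pos.2 h2)
      exact ⟨0, u, by rw [pow_zero, one_smul, ← slope_neg, hu]⟩
  have hnext {p q : ℤ} (h : IsCoprime p q)
      (hn : ∃ (n : ℕ) (u : List Bool),
        moebius P ^ n • slope (a * p + b * q) (c * p + d * q) = (node u : Region)) :
      ∃ (n : ℕ) (u : List Bool), moebius P ^ n • slope p q = (node u : Region) := by
    obtain ⟨n, u, hu⟩ := hn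
    exact ⟨n + 1, u, by rw [pow_succ, mul_smul, hsm h, hu]⟩
  have hnonneg {p q : ℤ} (h : IsCoprime p q) (hpq : 0 ≤ p * q) :
      ∃ (n : ℕ) (u : List Bool), moebius P ^ n • slope p q = (node u : Region) := by
    rcases hpq.lt_or_eq with h1 | h1
    · exact hpos h h1
    · refine hnext h (hpos (hcop h) ?_)
      rcases mul_eq_zero.1 h1.symm with rfl | rfl
      · have : q ≠ 0 := by rintro rfl; exact not_isCoprime_zero_zero h
        have : 0 < q * q := mul_self_pos.2 this
        nlinarith [mul_pos hb hd]
      · have : p ≠ 0 := by rintro rfl; exact not_isCoprime_zero_zero h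
        have : 0 < p * p := mul_self_pos.2 this
        nlinarith [mul_pos ha hc]
  have main (N : ℕ) : ∀ {p q : ℤ}, IsCoprime p q → |p| + |q| ≤ N →
      ∃ (n : ℕ) (u : List Bool), moebius P ^ n • slope p q = (node u : Region) := by
    induction N with
    | zero =>
      intro p q h hN
      refine hnonneg h ?_
      have : p = 0 := abs_nonpos_iff.1 (by push_cast at hN; linarith [abs_nonneg q])
      rw [this, zero_mul]
    | succ N ih =>
      intro p q h hN
      rcases le_or_gt 0 (p * q) with hpq | hpq
      · exact hnonneg h hpq
      refine hnext h ?_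
      set p' := a * p + b * q with hp'
      set q' := c * p + d * q with hq'
      rcases le_or_gt 0 (p' * q') with hpq' | hpq'
      · exact hnonneg (hcop h) hpq'
      -- both vectors have coordinates of opposite signs, so the second one is shorter
      refine ih (hcop h) ?_
      have e1 : p = d * p' - b * q' := by rw [hp', hq']; linear_combination -p * hdet
      have e2 : q = a * q' - c * p' := by rw [hp', hq']; linear_combination -q * hdet
      push_cast at hN
      rcases mul_neg_iff.1 hpq' with ⟨h1, h2⟩ | ⟨h1, h2⟩
      · have f1 : p' - q' ≤ p := by rw [e1]; nlinarith
        have f2 : q ≤ q' - p' := by rw [e2]; nlinarith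
        rw [abs_of_pos (by linarith : 0 < p), abs_of_neg (by linarith : q < 0)] at hN
        rw [abs_of_pos h1, abs_of_neg h2]
        linarith
      · have f1 : p ≤ p' - q' := by rw [e1]; nlinarith
        have f2 : q' - p' ≤ q := by rw [e2]; nlinarith
        rw [abs_of_neg (by linarith : p < 0), abs_of_pos (by linarith : 0 < q)] at hN
        rw [abs_of_neg h1, abs_of_pos h2]
        linarith
  rw [← slope_num_den X]
  exact main (|X.num| + |X.den|).toNat (isCoprime_num_den X) (Int.self_le_toNat _)

theorem exists_iterate_append (W : List Bool) (hW : W ≠ []) (u : List Bool) :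
    ∃ (k : ℕ) (v : List Bool), ¬ W <+: v ∧ (W ++ ·)^[k] v = u := by
  obtain ⟨N, hN⟩ : ∃ N, u.length ≤ N := ⟨_, le_rfl⟩
  have hlen : 0 < W.length := List.length_pos_iff.2 hW
  induction N generalizing u with
  | zero =>
    refine ⟨0, u, fun h => ?_, rfl⟩
    have := h.length_le
    omega
  | succ N ih =>
    by_cases h : W <+: u
    · obtain ⟨t, rfl⟩ := h
      rw [List.length_append] at hN
      obtain ⟨k, v, hv, rfl⟩ := ih t (by omega)
      exact ⟨k + 1, v, hv, Function.iterate_succ_apply' _ _ _⟩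
    · exact ⟨0, u, h, rfl⟩

/-- The nodes that are not below the node `W` represent the orbits of a matrix conjugate, up to
sign, to the product of standard unipotent matrices spelled by `W`. -/
theorem bijective_node {H M : SL(2, ℤ)} {W : List Bool}
    (hpos : ∀ i j, 0 < (wordMatrix W).val i j)
    (hH : H * M = M * wordMatrix W ∨ H * M = M * -wordMatrix W) :
    Function.Bijective (fun u : {u // ¬ W <+: u} =>
      (Quotient.mk'' (moebius M • (node u : Region)) : CyclicQuotient Region (moebius H))) := by
  have hcomm (X : Region) :
      moebius H • moebius M • X = moebius M • moebius (wordMatrix W) • X := by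
    rw [← mul_smul, ← mul_smul, moebius, moebius, ← map_mul, moebius, ← map_mul]
    rcases hH with h | h
    · rw [h]
    · rw [h, mul_neg]; exact moebius_neg_smul _ _
  have hpow (k : ℕ) (X : Region) :
      moebius H ^ k • moebius M • X = moebius M • moebius (wordMatrix W) ^ k • X := by
    induction k with
    | zero => simp
    | succ k ih => rw [pow_succ', mul_smul, ih, hcomm, ← mul_smul _ _ X, ← pow_succ']
  have hnode (k : ℕ) (u : List Bool) : moebius H ^ k • moebius M • (node u : Region) =
      moebius M • (node ((W ++ ·)^[k] u) : Region) := by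
    induction k with
    | zero => simp
    | succ k ih =>
      rw [pow_succ', mul_smul, ih, hcomm, moebius_wordMatrix_smul_node,
        Function.iterate_succ_apply']
  have hW : W ≠ [] := by
    rintro rfl
    have := hpos 0 1
    simp [wordMatrix] at this
  constructor
  · have key (k : ℕ) (u v : List Bool) (hu : ¬ W <+: u)
        (h : moebius H ^ k • moebius M • (node v : Region) = moebius M • (node u : Region)) :
        v = u := by
      rw [hnode] at h
      have h2 := node_injective (OnePoint.coe_injective (smul_left_cancel _ h))
      cases k with
      | zero => exact h2
      | succ k =>
        rw [Function.iterate_succ_apply'] at h2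
        exact absurd ⟨_, h2⟩ hu
    rintro ⟨u, hu⟩ ⟨v, hv⟩ h
    have h1 := Quotient.exact h
    obtain ⟨⟨g, n, rfl⟩, hn⟩ := h1
    change moebius H ^ n • moebius M • (node v : Region) = moebius M • (node u : Region) at hn
    apply Subtype.ext
    obtain ⟨k, rfl | rfl⟩ := n.eq_nat_or_neg
    · rw [zpow_natCast] at hn
      exact (key k u v hu hn).symm
    · rw [zpow_neg, zpow_natCast, inv_smul_eq_iff] at hn
      exact key k v u hv hn.symm
  · intro c
    induction c using Quotient.inductionOn' with | h X => ?_
    obtain ⟨n, u, hu⟩ := exists_pow_smul_eq_node hpos ((moebius M)⁻¹ • X)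
    obtain ⟨k, v, hv, rfl⟩ := exists_iterate_append W hW u
    refine ⟨⟨v, hv⟩, Quotient.sound' ?_⟩
    have h1 := hpow n ((moebius M)⁻¹ • X)
    rw [smul_inv_smul, hu, ← hnode] at h1
    refine ⟨⟨moebius H ^ (-(k : ℤ) + n), ⟨_, rfl⟩⟩, ?_⟩
    change moebius H ^ (-(k : ℤ) + n) • X = _
    rw [zpow_add, zpow_natCast, mul_smul, h1, zpow_neg, zpow_natCast, inv_smul_smul]

/-! ### McShane's identity for generalized Markoff maps -/

theorem zero_mem_of_left_iterate_y_mem {s : EdgeTriple} {V : Set ℂ} (hV : V.Finite)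
    (hx : s.x ∉ Complex.ofReal '' Set.Icc (-2 : ℝ) 2) (hs : s.y - s.w / eigenvalue s.x = 0)
    (hmem : ∀ n, ‖(EdgeTriple.left^[n] s).y‖ ≤ 2 → (EdgeTriple.left^[n] s).y ∈ V) :
    (0 : ℂ) ∈ V := by
  have h0 := eigenvalue_ne_zero s.x
  have hlt := one_lt_norm_eigenvalue hx
  have hy (n : ℕ) : (EdgeTriple.left^[n] s).y = (eigenvalue s.x)⁻¹ ^ n * s.y := by
    induction n with
    | zero => simp
    | succ n ih =>
      have h1 := EdgeTriple.left_iterate_y_sub s (n + 1)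
      rw [hs, mul_zero, EdgeTriple.left_iterate_succ_w, ih, sub_eq_zero] at h1
      rw [h1, pow_succ]; field_simp
  have ht : Filter.Tendsto (fun n => (EdgeTriple.left^[n] s).y) Filter.atTop (nhds 0) := by
    have := tendsto_pow_atTop_nhds_zero_of_norm_lt_one (x := (eigenvalue s.x)⁻¹)
      (by rw [norm_inv]; exact inv_lt_one_of_one_lt₀ hlt)
    simp only [hy]
    simpa using this.mul_const s.y
  refine hV.isClosed.mem_of_tendsto ht ?_
  have h2 := ht.norm.eventually_le_const (show ‖(0 : ℂ)‖ < 2 by simp)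
  filter_upwards [h2] with n hn using hmem n hn

/-- Going around a region with value `±√μ` in one of the two directions, the neighbouring values
form a geometric sequence that tends to zero; thus infinitely many of them would have modulus at
most `2`. -/
theorem markoffMap_sq_ne {μ : ℂ} {φ : Region → ℂ} (hφ : IsMarkoffMap μ φ)
    (hI : ∀ X, φ X ∉ Complex.ofReal '' Set.Icc (-2 : ℝ) 2)
    (hfin : (φ '' {X | ‖φ X‖ ≤ 2}).Finite) (X : Region) : φ X ^ 2 ≠ μ := by
  intro hX
  have h0mem : (0 : ℂ) ∉ φ '' {X | ‖φ X‖ ≤ 2} := by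
    rintro ⟨Y, -, hY⟩
    exact hI Y ⟨0, by norm_num, by rw [hY]; simp⟩
  obtain ⟨M, rfl⟩ := exists_moebius_smul_infty X
  set x := φ (moebius M • (OnePoint.infty : Region)) with hx
  let Y : ℤ → ℂ := fun n => φ (moebius M • (((n : ℚ)) : Region))
  have hrec (n : ℤ) : Y (n + 1) = x * Y n - Y (n - 1) := by
    have h1 := fareyNeighbors_moebius M (fareyNeighbors_infty n)
    have h2 := fareyNeighbors_moebius M (fareyNeighbors_infty (n - 1))
    have h3 := fareyNeighbors_moebius M (fareyNeighbors_intCast n (n - 1) (by simp))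
    have h4 := fareyNeighbors_moebius M (fareyNeighbors_infty (n + 1))
    have h5 := fareyNeighbors_moebius M (fareyNeighbors_intCast n (n + 1) (by simp))
    have hne : moebius M • (((n + 1 : ℤ) : ℚ) : Region) ≠
        moebius M • (((n - 1 : ℤ) : ℚ) : Region) := by
      intro h
      have := OnePoint.coe_injective (smul_left_cancel _ h)
      push_cast at this
      linarith
    have := hφ.2 _ _ _ _ h1 h4 h5 h2 h3 hne
    linear_combination -this
  have hY (n : ℤ) (h : ‖Y n‖ ≤ 2) : Y n ∈ φ '' {X | ‖φ X‖ ≤ 2} := ⟨_, h, rfl⟩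
  have hm : (EdgeTriple.mk x (Y 0) (Y (-1))).IsMarkoff μ := by
    have := edgeTriple_isMarkoff hφ M
    simpa [edgeTriple, Y] using this
  have hcoeff := EdgeTriple.mul_coeff_eq hm
  simp only [hX, sub_self, mul_eq_zero] at hcoeff
  have hα := eigenvalue_ne_zero x
  rcases hcoeff with h | h
  · refine h0mem (zero_mem_of_left_iterate_y_mem (s := ⟨x, Y 0, Y (-1)⟩) hfin (hI _) h
      fun n => ?_)
    have key (n : ℕ) : (EdgeTriple.left^[n] ⟨x, Y 0, Y (-1)⟩) = ⟨x, Y n, Y (n - 1)⟩ := by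
      induction n with
      | zero => simp
      | succ n ih =>
        rw [Function.iterate_succ_apply', ih, EdgeTriple.left, EdgeTriple.z]
        push_cast
        rw [hrec, add_sub_cancel_right]
    rw [key]
    exact hY n
  · refine h0mem (zero_mem_of_left_iterate_y_mem (s := ⟨x, Y (-1), Y 0⟩) hfin (hI _) ?_
      fun n => ?_)
    · simp only
      field_simp
      linear_combination -h
    · have key (n : ℕ) : (EdgeTriple.left^[n] ⟨x, Y (-1), Y 0⟩) = ⟨x, Y (-1 - n), Y (-n)⟩ := by
        induction n with
        | zero => simp
        | succ n ih =>
          rw [Function.iterate_succ_apply', ih, EdgeTriple.left, EdgeTriple.z]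
          have := hrec (-1 - n)
          rw [show (-1 - (n : ℤ) + 1) = -n by ring] at this
          push_cast
          congr 1
          · rw [this, show (-1 - (n : ℤ) - 1) = -1 - (n + 1) by ring]; ring
          · congr 1; ring
      rw [key]
      exact hY _

/-- McShane's identity for generalized Markoff maps invariant under a hyperbolic matrix. The orbits
are the nodes of a tree between two of its edges that carry the same values. -/
theorem orbitMarkoff_identity {μ : ℂ} (hμ : μ ≠ 4) {φ : Region → ℂ} (hφ : IsMarkoffMap μ φ)
    {H : SL(2, ℤ)} (hH : H.val.IsHyperbolic) (hs : ∀ X : Region, φ (moebius H • X) = φ X)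
    (hBQ : SatisfiesBQ (orbitMarkoff φ H hs)) :
    (∀ c, orbitMarkoff φ H hs c ^ 2 ≠ μ) ∧
      Summable (fun c => ‖gap (μ - 2) (orbitMarkoff φ H hs c)‖) ∧
      ∃ n : ℤ, ∑' c, gap (μ - 2) (orbitMarkoff φ H hs c) = n * (2 * Real.pi * Complex.I) := by
  obtain ⟨hI, hfin⟩ := hBQ
  have hI' (X : Region) : φ X ∉ Complex.ofReal '' Set.Icc (-2 : ℝ) 2 := hI (Quotient.mk'' X)
  have hsq : ∀ X, φ X ^ 2 ≠ μ := by
    refine markoffMap_sq_ne hφ hI' ((hfin.image (orbitMarkoff φ H hs)).subset ?_)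
    rintro _ ⟨X, hX, rfl⟩
    exact ⟨Quotient.mk'' X, hX, rfl⟩
  refine ⟨fun c => Quotient.inductionOn' c hsq, ?_⟩
  obtain ⟨M, P, hpos, hHM⟩ := exists_conj_pos hH
  obtain ⟨W, rfl⟩ := exists_wordMatrix_eq P fun i j => (hpos i j).le
  let e := Equiv.ofBijective _ (bijective_node hpos hHM)
  have hτ : μ - 2 ≠ 2 := fun h => hμ (by linear_combination h)
  have hμ2 : μ - 2 + 2 = μ := by ring
  have hadm : (edgeTriple φ M).IsAdmissible (μ - 2) :=
    { isMarkoff := by rw [hμ2]; exact edgeTriple_isMarkoff hφ M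
      x_notMem := hI' _
      y_notMem := hI' _
      x_sq_ne := by rw [hμ2]; exact hsq _
      y_sq_ne := by rw [hμ2]; exact hsq _
      val_notMem := fun u => by rw [edgeTriple_val hφ]; exact hI' _
      val_sq_ne := fun u => by rw [hμ2, edgeTriple_val hφ]; exact hsq _ }
  have hfollow : (edgeTriple φ M).follow W = edgeTriple φ M := by
    rw [edgeTriple_follow hφ]
    have hcomm (X : Region) : φ (moebius (M * wordMatrix W) • X) = φ (moebius M • X) := by
      have h1 : moebius H • moebius M • X = moebius (M * wordMatrix W) • X := by
        rw [← mul_smul, moebius, moebius, ← map_mul]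
        rcases hHM with h | h
        · rw [h]
        · rw [h, mul_neg]; exact moebius_neg_smul _ _
      rw [← h1, hs]
    simp only [edgeTriple, hcomm]
  have heval (u : {u // ¬ W <+: u}) :
      orbitMarkoff φ H hs (e u) = (edgeTriple φ M).val u := by
    rw [edgeTriple_val hφ]; rfl
  have hfinW : {u | u ∈ {u | ¬ W <+: u} ∧ ‖(edgeTriple φ M).val u‖ ≤ 2}.Finite := by
    have h1 := (hfin.preimage e.injective.injOn).image Subtype.val
    refine h1.subset ?_
    rintro u ⟨hu, hu2⟩
    refine ⟨⟨u, hu⟩, ?_, rfl⟩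
    change ‖orbitMarkoff φ H hs (e ⟨u, hu⟩)‖ ≤ 2
    rw [heval]
    exact hu2
  obtain ⟨h1, n, h2⟩ := hadm.tsum_not_prefix hτ W hfollow hfinW
  refine ⟨?_, n, ?_⟩
  · rw [← e.summable_iff]
    simpa only [Function.comp_def, heval] using h1
  · rw [← h2, ← e.tsum_eq]
    exact tsum_congr fun u => by rw [heval]

/-! ### Common prefixes in free groups -/

section CommonPrefix

variable {α : Type*} [DecidableEq α]

/-- The length of the longest common prefix of two lists. -/
def commonPrefixLength : List α → List α → ℕ
  | a :: l, b :: m => if a = b then commonPrefixLength l m + 1 else 0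
  | _, _ => 0

theorem commonPrefixLength_comm (l m : List α) :
    commonPrefixLength l m = commonPrefixLength m l := by
  induction l generalizing m with
  | nil => cases m <;> rfl
  | cons a l ih =>
    cases m with
    | nil => rfl
    | cons b m => simp only [commonPrefixLength, ih, eq_comm]

theorem min_commonPrefixLength_le (l m n : List α) :
    min (commonPrefixLength l m) (commonPrefixLength m n) ≤ commonPrefixLength l n := by
  induction l generalizing m n with
  | nil => cases m <;> simp [commonPrefixLength]
  | cons a l ih =>
    cases m with
    | nil => simp [commonPrefixLength]
    | cons b m =>
      cases n with
      | nil => simp [commonPrefixLength]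
      | cons c n =>
        have := ih m n
        simp only [commonPrefixLength]
        by_cases h1 : a = b
        · subst h1
          by_cases h2 : a = c
          · subst h2; simp only [if_true]; omega
          · simp [h2]
        · simp [h1]

theorem commonPrefixLength_take (l : List α) (k : ℕ) (hk : k ≤ l.length) :
    commonPrefixLength (l.take k) l = k := by
  induction l generalizing k with
  | nil =>
    have : k = 0 := by simpa using hk
    subst this; rfl
  | cons a l ih =>
    cases k with
    | zero => rfl
    | succ k =>
      rw [List.take_succ_cons]
      simp only [commonPrefixLength, if_true]
      rw [ih k (by simpa using hk)]

theorem getElem?_eq_of_lt_commonPrefixLength (l m : List α) (i : ℕ)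
    (h : i < commonPrefixLength l m) : l[i]? = m[i]? := by
  induction l generalizing m i with
  | nil => cases m <;> simp [commonPrefixLength] at h
  | cons a l ih =>
    cases m with
    | nil => simp [commonPrefixLength] at h
    | cons b m =>
      simp only [commonPrefixLength] at h
      split_ifs at h with h1
      · subst h1
        cases i with
        | zero => rfl
        | succ i => simpa using ih m i (by omega)
      · omega

/-- The length of the longest common prefix of the reduced words of two elements of a free group. -/
def gromovProduct (x y : FreeGroup α) : ℕ := commonPrefixLength x.toWord y.toWord

theorem gromovProduct_comm (x y : FreeGroup α) : gromovProduct x y = gromovProduct y x :=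
  commonPrefixLength_comm _ _

theorem min_gromovProduct_le (x y z : FreeGroup α) :
    min (gromovProduct x y) (gromovProduct y z) ≤ gromovProduct x z :=
  min_commonPrefixLength_le _ _ _

theorem norm_mk_invRev_append (l m : List (α × Bool)) (hl : FreeGroup.IsReduced l)
    (hm : FreeGroup.IsReduced m) :
    (FreeGroup.mk (FreeGroup.invRev l ++ m)).norm + 2 * commonPrefixLength l m =
      l.length + m.length := by
  have key (l m : List (α × Bool)) (hl : FreeGroup.IsReduced l) (hm : FreeGroup.IsReduced m)
      (h : ∀ a ∈ l.head?, ∀ b ∈ m.head?, a ≠ b) :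
      (FreeGroup.mk (FreeGroup.invRev l ++ m)).norm = l.length + m.length := by
    have hred : FreeGroup.IsReduced (FreeGroup.invRev l ++ m) := by
      refine List.isChain_append.2 ⟨?_, hm, ?_⟩
      · have h1 : FreeGroup.IsReduced (FreeGroup.invRev l) := by
          rw [FreeGroup.isReduced_iff_reduce_eq, FreeGroup.reduce_invRev, hl.reduce_eq]
        exact h1
      · intro a ha b hb hab
        cases l with
        | nil => simp [FreeGroup.invRev] at ha
        | cons c l =>
          have hc := h c rfl b hb
          simp only [FreeGroup.invRev, List.map_cons, List.reverse_cons,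
            List.getLast?_append, List.getLast?_singleton, Option.some_or,
            Option.mem_def, Option.some.injEq] at ha
          subst ha
          by_contra hne
          exact hc (Prod.ext hab (by simpa using hne))
    rw [FreeGroup.norm, FreeGroup.toWord_mk, hred.reduce_eq, List.length_append,
      FreeGroup.invRev_length]
  induction l generalizing m with
  | nil =>
    have : commonPrefixLength ([] : List (α × Bool)) m = 0 := by cases m <;> rfl
    rw [this]
    exact key [] m hl hm (by simp)
  | cons a l ih =>
    cases m with
    | nil => exact key (a :: l) [] hl hm (by simp)
    | cons b m =>
      by_cases hab : a = b
      · subst hab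
        have h1 := ih m (List.IsChain.tail hl) (List.IsChain.tail hm)
        have h2 : FreeGroup.mk (FreeGroup.invRev (a :: l) ++ a :: m) =
            FreeGroup.mk (FreeGroup.invRev l ++ m) := by
          rw [← FreeGroup.mul_mk, ← FreeGroup.mul_mk, ← FreeGroup.inv_mk, ← FreeGroup.inv_mk,
            ← List.singleton_append, ← List.singleton_append (l := m), ← FreeGroup.mul_mk,
            ← FreeGroup.mul_mk]
          group
        rw [h2]
        simp only [commonPrefixLength, if_true, List.length_cons]
        omega
      · have h1 := key (a :: l) (b :: m) hl hm (by simpa using hab)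
        simpa [commonPrefixLength, hab] using h1

theorem norm_inv_mul_add (x y : FreeGroup α) :
    (x⁻¹ * y).norm + 2 * gromovProduct x y = x.norm + y.norm := by
  have h := norm_mk_invRev_append x.toWord y.toWord FreeGroup.isReduced_toWord
    FreeGroup.isReduced_toWord
  rwa [← FreeGroup.mul_mk, ← FreeGroup.inv_mk, FreeGroup.mk_toWord, FreeGroup.mk_toWord] at h

theorem exists_prefix (x : FreeGroup α) (k : ℕ) (hk : k ≤ x.norm) :
    ∃ p : FreeGroup α, p.norm = k ∧ gromovProduct p x = k := by
  have h1 : FreeGroup.IsReduced (x.toWord.take k) :=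
    (FreeGroup.isReduced_toWord (x := x)).infix (List.take_prefix _ _).isInfix
  have h2 : (FreeGroup.mk (x.toWord.take k)).toWord = x.toWord.take k := by
    rw [FreeGroup.toWord_mk, h1.reduce_eq]
  refine ⟨FreeGroup.mk (x.toWord.take k), ?_, ?_⟩
  · rw [FreeGroup.norm, h2, List.length_take]; exact min_eq_left hk
  · rw [gromovProduct, h2]; exact commonPrefixLength_take _ _ hk

/-- Less than half of a reduced word cancels when it is squared. -/
theorem two_mul_gromovProduct_inv_lt {x : FreeGroup α} (hx : x ≠ 1) :
    2 * gromovProduct x x⁻¹ < x.norm := by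
  by_contra! h
  set l := x.toWord with hl
  have hn : x.norm = l.length := rfl
  have hpos : 0 < l.length := by
    rw [List.length_pos_iff, hl]; exact fun h => hx (FreeGroup.toWord_eq_nil_iff.1 h)
  have hred : FreeGroup.IsReduced l := FreeGroup.isReduced_toWord
  rw [gromovProduct, FreeGroup.toWord_inv, ← hl, hn] at h
  -- compare the letters in the middle of the word
  have key (i : ℕ) (hi : i < commonPrefixLength l (FreeGroup.invRev l)) (hil : i < l.length) :
      l[i] = (l[l.length - 1 - i].1, !l[l.length - 1 - i].2) := by
    have := getElem?_eq_of_lt_commonPrefixLength _ _ i hi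
    simpa [FreeGroup.invRev, List.getElem?_reverse, hil,
      show l.length - 1 - i < l.length by omega] using this
  rcases Nat.even_or_odd' l.length with ⟨k, hk | hk⟩
  · have h1 := key (k - 1) (by omega) (by omega)
    have h2 : l.length - 1 - (k - 1) = k - 1 + 1 := by omega
    simp only [h2] at h1
    have h3 := List.isChain_iff_getElem.1 hred (k - 1) (by omega)
    rw [h1] at h3
    simpa using h3 rfl
  · have h1 := key k (by omega) (by omega)
    have h2 : l.length - 1 - k = k := by omega
    simp only [h2] at h1
    have h3 := congrArg Prod.snd h1
    simp at h3

end CommonPrefix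

/-! ### Nielsen's theorem on bases of the free group of rank two -/

/-- A set of pairs of elements of a free group that is closed under elementary Nielsen
transformations and simultaneous conjugation. -/
structure IsNielsenClosed {α : Type*} (B : FreeGroup α → FreeGroup α → Prop) : Prop where
  swap : ∀ {x y}, B x y → B y x
  inv : ∀ {x y}, B x y → B x y⁻¹
  mul : ∀ {x y}, B x y → B x (x⁻¹ * y)
  conj : ∀ {x y}, B x y → ∀ c, B (c * x * c⁻¹) (c * y * c⁻¹)

/-- A pair in `B` of smallest total length. -/
def IsShortest {α : Type*} [DecidableEq α] (B : FreeGroup α → FreeGroup α → Prop)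
    (x y : FreeGroup α) : Prop :=
  B x y ∧ ∀ x' y', B x' y' → x.norm + y.norm ≤ x'.norm + y'.norm

section Shortest

variable {α : Type*} [DecidableEq α] {B : FreeGroup α → FreeGroup α → Prop}
  {x y : FreeGroup α}

theorem IsShortest.swap (hB : IsNielsenClosed B) (h : IsShortest B x y) : IsShortest B y x :=
  ⟨hB.swap h.1, fun x' y' h' => by rw [add_comm]; exact h.2 x' y' h'⟩

theorem IsShortest.inv (hB : IsNielsenClosed B) (h : IsShortest B x y) : IsShortest B x y⁻¹ :=
  ⟨hB.inv h.1, fun x' y' h' => by rw [FreeGroup.norm_inv_eq]; exact h.2 x' y' h'⟩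

theorem IsShortest.inv_left (hB : IsNielsenClosed B) (h : IsShortest B x y) :
    IsShortest B x⁻¹ y :=
  ((h.swap hB).inv hB).swap hB

theorem IsShortest.two_mul_gromovProduct_le_right (hB : IsNielsenClosed B)
    (h : IsShortest B x y) : 2 * gromovProduct x y ≤ x.norm := by
  have h1 := h.2 _ _ (hB.mul h.1)
  have h2 := norm_inv_mul_add x y
  omega

theorem IsShortest.two_mul_gromovProduct_le_left (hB : IsNielsenClosed B)
    (h : IsShortest B x y) : 2 * gromovProduct x y ≤ y.norm := by
  rw [gromovProduct_comm]
  exact (h.swap hB).two_mul_gromovProduct_le_right hB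

/-- If `x = p q⁻¹` and `y = p m q⁻¹` with `|p| = |q|`, then conjugation by `p` followed by a Nielsen
transformation gives the shorter pair `q⁻¹ p`, `m`. -/
theorem IsShortest.not_half_and_half (hB : IsNielsenClosed B) (h : IsShortest B x y)
    (hx : x ≠ 1) (h1 : 2 * gromovProduct x y = x.norm)
    (h2 : 2 * gromovProduct x⁻¹ y⁻¹ = x.norm) : False := by
  have hy := h.two_mul_gromovProduct_le_left hB
  have hx0 : x.norm ≠ 0 := fun h => hx (FreeGroup.norm_eq_zero.1 h)
  set k := gromovProduct x y with hk
  obtain ⟨p, hp, hpx⟩ := exists_prefix x k (by omega)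
  set q := x⁻¹ * p with hq
  have e1 := norm_inv_mul_add x p
  rw [gromovProduct_comm, ← hq] at e1
  have hqn : q.norm = k := by omega
  -- `q` is a common prefix of `x⁻¹` and `y⁻¹`
  have e2 := norm_inv_mul_add q x⁻¹
  rw [show q⁻¹ * x⁻¹ = p⁻¹ by rw [hq]; group, FreeGroup.norm_inv_eq, FreeGroup.norm_inv_eq] at e2
  have e3 := min_gromovProduct_le q x⁻¹ y⁻¹
  have hqy : k ≤ gromovProduct y⁻¹ q := by rw [gromovProduct_comm]; omega
  have e4 := min_gromovProduct_le p x y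
  have e5 := norm_inv_mul_add y p
  rw [gromovProduct_comm] at e5
  have e6 := norm_inv_mul_add (y⁻¹ * p) y⁻¹
  rw [show (y⁻¹ * p)⁻¹ * y⁻¹ = p⁻¹ by group, FreeGroup.norm_inv_eq, FreeGroup.norm_inv_eq] at e6
  have e7 := min_gromovProduct_le (y⁻¹ * p) y⁻¹ q
  have e8 := norm_inv_mul_add (y⁻¹ * p) q
  have hpair : B (p⁻¹ * x * p⁻¹⁻¹) (p⁻¹ * (y * x⁻¹) * p⁻¹⁻¹) := by
    have b1 := hB.mul (hB.inv (hB.swap (hB.inv (hB.swap h.1))))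
    have b2 := hB.swap (hB.inv (hB.swap (hB.inv b1)))
    rw [inv_inv, mul_inv_rev, inv_inv] at b2
    exact hB.conj b2 _
  have e9 := h.2 _ _ hpair
  rw [show p⁻¹ * x * p⁻¹⁻¹ = q⁻¹ * p by rw [hq]; group,
    show p⁻¹ * (y * x⁻¹) * p⁻¹⁻¹ = (y⁻¹ * p)⁻¹ * q by rw [hq]; group] at e9
  have e10 := FreeGroup.norm_mul_le q⁻¹ p
  rw [FreeGroup.norm_inv_eq] at e10
  omega

end Shortest

section Reduced

variable {α ι : Type*} [DecidableEq α]

/-- If in every product of three allowed consecutive factors the middle one is not completely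
cancelled, then the length of a product is at least the number of its factors. -/
theorem length_le_norm_prod (e : ι → FreeGroup α) (R : ι → ι → Prop) (hpos : ∀ a, e a ≠ 1)
    (h1 : ∀ a b, R a b → gromovProduct (e a)⁻¹ (e b) < (e a).norm)
    (h2 : ∀ a b, R a b → gromovProduct (e a)⁻¹ (e b) < (e b).norm)
    (h3 : ∀ a b c, R a b → R b c →
      gromovProduct (e a)⁻¹ (e b) + gromovProduct (e b)⁻¹ (e c) < (e b).norm)
    (l : List ι) (x : ι) (hl : (x :: l).IsChain R) :
    (x :: l).length ≤ ((x :: l).map e).prod.norm ∧ ∀ z, R z x →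
      gromovProduct (e z)⁻¹ ((x :: l).map e).prod = gromovProduct (e z)⁻¹ (e x) ∧
      (x :: l).length + gromovProduct (e z)⁻¹ (e x) ≤ ((x :: l).map e).prod.norm := by
  induction l generalizing x with
  | nil =>
    have h0 : (e x).norm ≠ 0 := fun h => hpos x (FreeGroup.norm_eq_zero.1 h)
    simp only [List.map_cons, List.map_nil, List.prod_cons, List.prod_nil, mul_one,
      List.length_cons, List.length_nil]
    exact ⟨by omega, fun z hz => ⟨trivial, by have := h2 z x hz; omega⟩⟩
  | cons y l ih =>
    rw [List.isChain_cons_cons] at hl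
    obtain ⟨-, hih⟩ := ih y hl.2
    obtain ⟨i1, i2⟩ := hih x hl.1
    set Q := ((y :: l).map e).prod with hQ
    rw [List.map_cons, List.prod_cons, ← hQ]
    have e1 := norm_inv_mul_add (e x)⁻¹ Q
    rw [inv_inv, FreeGroup.norm_inv_eq, i1] at e1
    have e2 := h2 x y hl.1
    have e3 := norm_inv_mul_add (e x) (e x * Q)
    rw [inv_mul_cancel_left] at e3
    simp only [List.length_cons] at i2 ⊢
    have hx1 := h1 x y hl.1
    refine ⟨by omega, fun z hz => ?_⟩
    have e4 := h3 z x y hz hl.1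
    have e5 := min_gromovProduct_le (e z)⁻¹ (e x) (e x * Q)
    have e6 := min_gromovProduct_le (e z)⁻¹ (e x * Q) (e x)
    rw [gromovProduct_comm (e x * Q)] at e6
    exact ⟨by omega, by omega⟩


/-- In a shortest pair a product of letters is at least as long as its number of letters. -/
theorem IsShortest.length_le_norm {B : FreeGroup α → FreeGroup α → Prop} {x y : FreeGroup α}
    (hB : IsNielsenClosed B) (h : IsShortest B x y) (hx : x ≠ 1) (hy : y ≠ 1)
    (l : List (Fin 2 × Bool)) (hl : FreeGroup.IsReduced l) :
    l.length ≤ (l.map fun a => cond a.2 (![x, y] a.1) (![x, y] a.1)⁻¹).prod.norm := by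
  set e : Fin 2 × Bool → FreeGroup α := fun a => cond a.2 (![x, y] a.1) (![x, y] a.1)⁻¹ with he
  have hshort (a b : Fin 2 × Bool) (hab : a.1 ≠ b.1) : IsShortest B (e a) (e b) := by
    obtain ⟨i, s⟩ := a
    obtain ⟨j, t⟩ := b
    fin_cases i <;> fin_cases j <;> cases s <;> cases t <;>
      simp only [he, cond_true, cond_false, Matrix.cons_val_zero, Matrix.cons_val_one,
        Fin.zero_eta, Fin.mk_one, ne_eq, not_true_eq_false] at hab ⊢
    · exact (h.inv hB).inv_left hB
    · exact h.inv_left hB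
    · exact h.inv hB
    · exact h
    · exact ((h.inv hB).inv_left hB).swap hB
    · exact (h.inv hB).swap hB
    · exact (h.inv_left hB).swap hB
    · exact h.swap hB
  have hinv (a : Fin 2 × Bool) : (e a)⁻¹ = e (a.1, !a.2) := by
    obtain ⟨i, s⟩ := a
    cases s <;> simp [he]
  have hne (a : Fin 2 × Bool) : e a ≠ 1 := by
    obtain ⟨i, s⟩ := a
    fin_cases i <;> cases s <;> simp [he, hx, hy]
  have hpos (a : Fin 2 × Bool) : (e a).norm ≠ 0 := fun h => hne a (FreeGroup.norm_eq_zero.1 h)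
  have hself (a : Fin 2 × Bool) : 2 * gromovProduct (e a)⁻¹ (e a) < (e a).norm := by
    rw [gromovProduct_comm]; exact two_mul_gromovProduct_inv_lt (hne a)
  have hdiff (a b : Fin 2 × Bool) (hab : a.1 ≠ b.1) :
      2 * gromovProduct (e a)⁻¹ (e b) ≤ (e a).norm ∧
        2 * gromovProduct (e a)⁻¹ (e b) ≤ (e b).norm := by
    rw [← FreeGroup.norm_inv_eq (x := e a), hinv]
    have := hshort (a.1, !a.2) b hab
    exact ⟨this.two_mul_gromovProduct_le_right hB, this.two_mul_gromovProduct_le_left hB⟩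
  have hcase (a b : Fin 2 × Bool) (hab : a.1 = b.1 → a.2 = b.2) :
      a = b ∨ a.1 ≠ b.1 := by
    by_cases h : a.1 = b.1
    · exact Or.inl (Prod.ext h (hab h))
    · exact Or.inr h
  have hle (a b : Fin 2 × Bool) (hab : a.1 = b.1 → a.2 = b.2) :
      2 * gromovProduct (e a)⁻¹ (e b) ≤ (e a).norm ∧
        2 * gromovProduct (e a)⁻¹ (e b) ≤ (e b).norm := by
    rcases hcase a b hab with rfl | hab
    · have := hself a; omega
    · exact hdiff a b hab
  cases l with
  | nil => simp
  | cons z l =>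
    refine (length_le_norm_prod e (fun a b => a.1 = b.1 → a.2 = b.2) hne ?_ ?_ ?_ l z hl).1
    · intro a b hab
      have := hle a b hab; have := hpos a; omega
    · intro a b hab
      have := hle a b hab; have := hpos b; omega
    · intro a b c hab hbc
      have e1 := (hle a b hab).2
      have e2 := (hle b c hbc).1
      rcases hcase a b hab with rfl | hab
      · have := hself a; omega
      rcases hcase b c hbc with rfl | hbc
      · have := hself b; omega
      by_contra! hcon
      have hac : a.1 = c.1 := by omega
      by_cases hs : a.2 = c.2
      · obtain rfl : a = c := Prod.ext hac hs
        -- `b` is half of `a⁻¹` and half of `a`, the configuration excluded by conjugation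
        have h1 : 2 * gromovProduct (e b) (e a)⁻¹ = (e b).norm := by
          rw [gromovProduct_comm]; omega
        have h2 : 2 * gromovProduct (e b)⁻¹ (e a)⁻¹⁻¹ = (e b).norm := by
          rw [inv_inv]; omega
        exact ((hshort b a hbc).inv hB).not_half_and_half hB (hne b) h1 h2
      · have hcinv : e c = (e a)⁻¹ := by
          rw [hinv]; congr 1
          refine Prod.ext hac.symm ?_
          revert hs; cases a.2 <;> cases c.2 <;> simp
        rw [hcinv] at hcon e2
        have e3 := min_gromovProduct_le (e b) (e a)⁻¹ (e b)⁻¹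
        rw [gromovProduct_comm (e b), gromovProduct_comm _ (e b)⁻¹] at e3
        have e4 := two_mul_gromovProduct_inv_lt (hne b)
        omega

end Reduced

/-! ### Generators of the automorphism group of the free group of rank two -/

/-- The automorphism of `Γ` sending the generators to `u 0` and `u 1`, whose inverse sends them to
`v 0` and `v 1`. -/
def autOfBasis (u v : Fin 2 → Γ) (huv : ∀ i, FreeGroup.lift u (v i) = FreeGroup.of i)
    (hvu : ∀ i, FreeGroup.lift v (u i) = FreeGroup.of i) : MulAut Γ :=
  MonoidHom.toMulEquiv (FreeGroup.lift u) (FreeGroup.lift v)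
    (FreeGroup.ext_hom _ _ fun i => by simpa using hvu i)
    (FreeGroup.ext_hom _ _ fun i => by simpa using huv i)

theorem autOfBasis_of {u v : Fin 2 → Γ} (huv hvu) (i : Fin 2) :
    autOfBasis u v huv hvu (FreeGroup.of i) = u i := by
  simp [autOfBasis]

/-- The automorphism exchanging the two generators. -/
def swapAut : MulAut Γ :=
  autOfBasis ![FreeGroup.of 1, FreeGroup.of 0] ![FreeGroup.of 1, FreeGroup.of 0]
    (by intro i; fin_cases i <;> simp) (by intro i; fin_cases i <;> simp)

/-- The automorphism fixing `a` and inverting `b`. -/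
def flipAut : MulAut Γ :=
  autOfBasis ![FreeGroup.of 0, (FreeGroup.of 1)⁻¹] ![FreeGroup.of 0, (FreeGroup.of 1)⁻¹]
    (by intro i; fin_cases i <;> simp) (by intro i; fin_cases i <;> simp)

/-- The automorphism fixing `a` and sending `b` to `ab`. -/
def twistAut : MulAut Γ :=
  autOfBasis ![FreeGroup.of 0, FreeGroup.of 0 * FreeGroup.of 1]
    ![FreeGroup.of 0, (FreeGroup.of 0)⁻¹ * FreeGroup.of 1]
    (by intro i; fin_cases i <;> simp) (by intro i; fin_cases i <;> simp)

@[simp] theorem swapAut_zero : swapAut (FreeGroup.of 0) = FreeGroup.of 1 := autOfBasis_of _ _ 0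
@[simp] theorem swapAut_one : swapAut (FreeGroup.of 1) = FreeGroup.of 0 := autOfBasis_of _ _ 1
@[simp] theorem flipAut_zero : flipAut (FreeGroup.of 0) = FreeGroup.of 0 := autOfBasis_of _ _ 0
@[simp] theorem flipAut_one : flipAut (FreeGroup.of 1) = (FreeGroup.of 1)⁻¹ := autOfBasis_of _ _ 1
@[simp] theorem twistAut_zero : twistAut (FreeGroup.of 0) = FreeGroup.of 0 := autOfBasis_of _ _ 0
@[simp] theorem twistAut_one :
    twistAut (FreeGroup.of 1) = FreeGroup.of 0 * FreeGroup.of 1 := autOfBasis_of _ _ 1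

theorem aut_ext {β γ : MulAut Γ} (h0 : β (FreeGroup.of 0) = γ (FreeGroup.of 0))
    (h1 : β (FreeGroup.of 1) = γ (FreeGroup.of 1)) : β = γ := by
  have : (β : Γ →* Γ) = γ := FreeGroup.ext_hom _ _ fun i => by fin_cases i <;> assumption
  exact MulEquiv.ext fun g => DFunLike.congr_fun this g

/-- An automorphism permuting the generators and their inverses is a product of `swapAut` and
`flipAut`. -/
theorem mem_closure_of_letters {γ : MulAut Γ} {i j : Fin 2} {s t : Bool}
    (h0 : γ (FreeGroup.of 0) = cond s (FreeGroup.of i) (FreeGroup.of i)⁻¹)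
    (h1 : γ (FreeGroup.of 1) = cond t (FreeGroup.of j) (FreeGroup.of j)⁻¹) :
    γ ∈ Subgroup.closure ({swapAut, flipAut, twistAut} ∪ Set.range (MulAut.conj (G := Γ))) := by
  set G := Subgroup.closure ({swapAut, flipAut, twistAut} ∪ Set.range (MulAut.conj (G := Γ)))
  have hs : swapAut ∈ G := Subgroup.subset_closure (by simp)
  have hf : flipAut ∈ G := Subgroup.subset_closure (by simp)
  have hinj : γ (FreeGroup.of 0) ≠ γ (FreeGroup.of 1) ∧
      γ (FreeGroup.of 0) ≠ (γ (FreeGroup.of 1))⁻¹ := by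
    constructor
    · intro h
      exact absurd (FreeGroup.of_injective (γ.injective h)) (by decide)
    · intro h
      rw [← map_inv] at h
      have := congrArg exponentSum (γ.injective h)
      simpa [exponentSum] using congrFun this 0
  have e1 := mul_mem hs hf
  have e2 := mul_mem e1 hs
  have e3 := mul_mem e2 hf
  have e4 := mul_mem hf hs
  fin_cases i <;> fin_cases j <;> cases s <;> cases t <;>
    simp only [h0, h1, Fin.zero_eta, Fin.mk_one, cond_true, cond_false, inv_inv, ne_eq,
      not_true_eq_false, and_false, false_and] at hinj
  · convert e3 using 1; apply aut_ext <;> simp [h0, h1]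
  · convert e2 using 1; apply aut_ext <;> simp [h0, h1]
  · convert hf using 1; apply aut_ext <;> simp [h0, h1]
  · convert one_mem G using 1; apply aut_ext <;> simp [h0, h1]
  · convert mul_mem hs e3 using 1; apply aut_ext <;> simp [h0, h1]
  · convert e4 using 1; apply aut_ext <;> simp [h0, h1]
  · convert e1 using 1; apply aut_ext <;> simp [h0, h1]
  · convert hs using 1; apply aut_ext <;> simp [h0, h1]

/-- **Nielsen's theorem** in rank two. -/
theorem closure_nielsen_eq_top :
    Subgroup.closure ({swapAut, flipAut, twistAut} ∪ Set.range (MulAut.conj (G := Γ))) = ⊤ := by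
  set G := Subgroup.closure ({swapAut, flipAut, twistAut} ∪ Set.range (MulAut.conj (G := Γ)))
    with hG
  have hs : swapAut ∈ G := Subgroup.subset_closure (by simp)
  have hf : flipAut ∈ G := Subgroup.subset_closure (by simp)
  have ht : twistAut ∈ G := Subgroup.subset_closure (by simp)
  have hc (c : Γ) : MulAut.conj c ∈ G := Subgroup.subset_closure (by simp)
  refine (Subgroup.eq_top_iff' _).2 fun β => ?_
  set B : Γ → Γ → Prop := fun x y =>
    ∃ h ∈ G, x = (β * h) (FreeGroup.of 0) ∧ y = (β * h) (FreeGroup.of 1) with hBdef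
  have ht' : twistAut⁻¹ (FreeGroup.of 1) = (FreeGroup.of 0)⁻¹ * FreeGroup.of 1 :=
    (MulEquiv.symm_apply_eq twistAut).2 (by simp)
  have ht0 : twistAut⁻¹ (FreeGroup.of 0) = FreeGroup.of 0 :=
    (MulEquiv.symm_apply_eq twistAut).2 (by simp)
  have hB : IsNielsenClosed B := by
    constructor
    · rintro x y ⟨h, hh, rfl, rfl⟩
      exact ⟨h * swapAut, mul_mem hh hs, by simp, by simp⟩
    · rintro x y ⟨h, hh, rfl, rfl⟩
      exact ⟨h * flipAut, mul_mem hh hf, by simp, by simp⟩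
    · rintro x y ⟨h, hh, rfl, rfl⟩
      exact ⟨h * twistAut⁻¹, mul_mem hh (inv_mem ht), by simp [ht0], by simp [ht']⟩
    · rintro x y ⟨h, hh, rfl, rfl⟩ c
      exact ⟨MulAut.conj (β⁻¹ c) * h, mul_mem (hc _) hh, by simp,
        by simp⟩
  obtain ⟨x, y, hxy⟩ : ∃ x y, IsShortest B x y := by
    have hne : {p : Γ × Γ | B p.1 p.2}.Nonempty := ⟨(_, _), 1, one_mem _, rfl, rfl⟩
    obtain ⟨p, hp, hmin⟩ := WellFounded.has_min
      (measure fun p : Γ × Γ => p.1.norm + p.2.norm).wf _ hne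
    exact ⟨p.1, p.2, hp, fun x' y' h' => not_lt.1 (hmin (x', y') h')⟩
  obtain ⟨h, hh, hx, hy⟩ := hxy.1
  set γ := β * h with hγ
  have hx1 : x ≠ 1 := by rw [hx]; simp
  have hy1 : y ≠ 1 := by rw [hy]; simp
  have hlift : (γ : Γ →* Γ) = FreeGroup.lift ![x, y] :=
    FreeGroup.ext_hom _ _ fun i => by fin_cases i <;> simp [hx, hy]
  have hletter (j : Fin 2) : ∃ i s, γ⁻¹ (FreeGroup.of j) =
      cond s (FreeGroup.of i) (FreeGroup.of i)⁻¹ := by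
    set u := γ⁻¹ (FreeGroup.of j) with hu
    have hlen := hxy.length_le_norm hB hx1 hy1 u.toWord FreeGroup.isReduced_toWord
    rw [← FreeGroup.lift_mk, FreeGroup.mk_toWord, ← hlift] at hlen
    have hγu : (γ : Γ →* Γ) u = FreeGroup.of j := MulAut.apply_inv_self _ γ _
    rw [hγu, FreeGroup.norm_of] at hlen
    have hu1 : u ≠ 1 := by rw [hu]; simp
    have hne : u.toWord ≠ [] := fun h => hu1 (FreeGroup.toWord_eq_nil_iff.1 h)
    obtain ⟨⟨i, s⟩, hl⟩ : ∃ a, u.toWord = [a] :=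
      List.length_eq_one_iff.1 (le_antisymm hlen (List.length_pos_iff.2 hne))
    refine ⟨i, s, ?_⟩
    rw [← FreeGroup.mk_toWord (x := u), hl]
    cases s <;> simp [FreeGroup.of, FreeGroup.inv_mk, FreeGroup.invRev]
  obtain ⟨i, s, h0⟩ := hletter 0
  obtain ⟨j, t, h1⟩ := hletter 1
  have hmem := mem_closure_of_letters h0 h1
  rw [← hG] at hmem
  have : β = (γ⁻¹)⁻¹ * h⁻¹ := by rw [hγ]; group
  rw [this]
  exact mul_mem (inv_mem hmem) (inv_mem hh)

/-! ### The action of automorphisms on simple closed curves -/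

/-- The class in `Γ/∼` of an element of `Γ`. -/
def curveOf (g : Γ) : Curve := Quotient.mk _ g

theorem smul_curveOf (β : MulAut Γ) (g : Γ) : β • curveOf g = curveOf (β g) := rfl

theorem curveOf_inv (g : Γ) : curveOf g⁻¹ = curveOf g :=
  Quotient.sound (Or.inr (IsConj.refl _))

theorem curveOf_conj (g c : Γ) : curveOf (c * g * c⁻¹) = curveOf g :=
  Quotient.sound (Or.inl (isConj_iff.2 ⟨c, rfl⟩).symm)

theorem conj_smul (c : Γ) (X : Curve) : MulAut.conj c • X = X := by
  obtain ⟨g⟩ := X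
  exact curveOf_conj g c

/-- If `β * γ` is `δ` followed by conjugation by `c`, then both act in the same way on curves. -/
theorem smul_smul_eq_of_conj {β γ δ : MulAut Γ} (c : Γ)
    (h0 : β (γ (FreeGroup.of 0)) = c * δ (FreeGroup.of 0) * c⁻¹)
    (h1 : β (γ (FreeGroup.of 1)) = c * δ (FreeGroup.of 1) * c⁻¹) (X : Curve) :
    β • γ • X = δ • X := by
  rw [smul_smul, show β * γ = MulAut.conj c * δ from
    aut_ext (by simpa using h0) (by simpa using h1), mul_smul, conj_smul]

/-- The automorphism sending `a` to `ab` and fixing `b`. -/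
def twistAut' : MulAut Γ :=
  autOfBasis ![FreeGroup.of 0 * FreeGroup.of 1, FreeGroup.of 1]
    ![FreeGroup.of 0 * (FreeGroup.of 1)⁻¹, FreeGroup.of 1]
    (by intro i; fin_cases i <;> simp) (by intro i; fin_cases i <;> simp)

/-- The automorphism inverting both generators, which is induced by the elliptic involution of the
punctured torus. -/
def ellipticAut : MulAut Γ :=
  autOfBasis ![(FreeGroup.of 0)⁻¹, (FreeGroup.of 1)⁻¹] ![(FreeGroup.of 0)⁻¹, (FreeGroup.of 1)⁻¹]
    (by intro i; fin_cases i <;> simp) (by intro i; fin_cases i <;> simp)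

@[simp] theorem twistAut'_zero :
    twistAut' (FreeGroup.of 0) = FreeGroup.of 0 * FreeGroup.of 1 := autOfBasis_of _ _ 0
@[simp] theorem twistAut'_one : twistAut' (FreeGroup.of 1) = FreeGroup.of 1 := autOfBasis_of _ _ 1
@[simp] theorem ellipticAut_zero :
    ellipticAut (FreeGroup.of 0) = (FreeGroup.of 0)⁻¹ := autOfBasis_of _ _ 0
@[simp] theorem ellipticAut_one :
    ellipticAut (FreeGroup.of 1) = (FreeGroup.of 1)⁻¹ := autOfBasis_of _ _ 1

theorem twistAut_flipAut_twistAut_smul (X : Curve) :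
    twistAut • flipAut • twistAut • X = flipAut • X := by
  rw [smul_smul twistAut]
  exact smul_smul_eq_of_conj (FreeGroup.of 0) (by simp) (by simp [mul_assoc]) X

theorem swapAut_twistAut_smul (X : Curve) :
    swapAut • twistAut • X = twistAut' • swapAut • X := by
  rw [smul_smul twistAut']
  exact smul_smul_eq_of_conj (FreeGroup.of 1) (by simp) (by simp [mul_assoc]) X

theorem swapAut_twistAut'_smul (X : Curve) :
    swapAut • twistAut' • X = twistAut • swapAut • X := by
  rw [smul_smul twistAut]
  exact smul_smul_eq_of_conj (FreeGroup.of 0)⁻¹ (by simp) (by simp) X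

theorem ellipticAut_twistAut_smul (X : Curve) :
    ellipticAut • twistAut • X = twistAut • ellipticAut • X := by
  rw [smul_smul twistAut]
  exact smul_smul_eq_of_conj (FreeGroup.of 0)⁻¹ (by simp [mul_assoc]) (by simp [mul_assoc]) X

theorem ellipticAut_twistAut'_smul (X : Curve) :
    ellipticAut • twistAut' • X = twistAut' • ellipticAut • X := by
  rw [smul_smul twistAut']
  exact smul_smul_eq_of_conj (FreeGroup.of 1) (by simp) (by simp) X

theorem swapAut_flipAut_smul (X : Curve) :
    swapAut • flipAut • X = flipAut • swapAut • ellipticAut • X := by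
  rw [smul_smul flipAut, smul_smul (flipAut * swapAut)]
  exact smul_smul_eq_of_conj 1 (by simp) (by simp) X

theorem twistAut_flipAut_twistAut'_smul (X : Curve) :
    twistAut • flipAut • twistAut' • X = twistAut' • swapAut • ellipticAut • X := by
  rw [smul_smul twistAut, smul_smul twistAut', smul_smul (twistAut' * swapAut)]
  exact smul_smul_eq_of_conj (FreeGroup.of 0 * FreeGroup.of 1) (by simp [mul_assoc])
    (by simp [mul_assoc]) X

theorem flipAut_flipAut_smul (X : Curve) : flipAut • flipAut • X = X := by
  rw [← one_smul (MulAut Γ) X, smul_smul _ 1, mul_one]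
  exact smul_smul_eq_of_conj 1 (by simp) (by simp) X

/-- For coprime `p` and `q`, a primitive element of `Γ` with exponent sums `p` and `q`, obtained by
running the Euclidean algorithm backwards from `a` or `b`. -/
def euclidWord : ℕ → ℕ → Γ
  | 0, _ => FreeGroup.of 1
  | _ + 1, 0 => FreeGroup.of 0
  | p + 1, q + 1 =>
    if q ≤ p then twistAut (euclidWord (p - q) (q + 1)) else twistAut' (euclidWord (p + 1) (q - p))
  termination_by p q => p + q

theorem euclidWord_of_le {p q : ℕ} (hq : 0 < q) (h : q ≤ p) :
    euclidWord p q = twistAut (euclidWord (p - q) q) := by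
  obtain ⟨q, rfl⟩ := Nat.exists_eq_add_of_lt hq
  obtain ⟨p, rfl⟩ := Nat.exists_eq_add_of_lt (hq.trans_le h)
  simp only [zero_add] at *
  rw [euclidWord, if_pos (by omega), Nat.add_sub_add_right]

theorem euclidWord_of_lt {p q : ℕ} (hp : 0 < p) (h : p < q) :
    euclidWord p q = twistAut' (euclidWord p (q - p)) := by
  obtain ⟨p, rfl⟩ := Nat.exists_eq_add_of_lt hp
  obtain ⟨q, rfl⟩ := Nat.exists_eq_add_of_lt (hp.trans h)
  simp only [zero_add] at *
  rw [euclidWord, if_neg (by omega), Nat.add_sub_add_right]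

/-- Induction along the Euclidean algorithm. -/
theorem euclid_induction {P : ℕ → ℕ → Prop} (h01 : P 0 1) (h10 : P 1 0)
    (hle : ∀ p q, 0 < q → q ≤ p → (p - q).Coprime q → P (p - q) q → P p q)
    (hlt : ∀ p q, 0 < p → p < q → p.Coprime (q - p) → P p (q - p) → P p q)
    (p q : ℕ) (h : p.Coprime q) : P p q := by
  induction hn : p + q using Nat.strong_induction_on generalizing p q with
  | _ n ih =>
    rcases Nat.eq_zero_or_pos p with rfl | hp
    · obtain rfl : q = 1 := by simpa using h
      exact h01
    rcases Nat.eq_zero_or_pos q with rfl | hq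
    · obtain rfl : p = 1 := by simpa using h
      exact h10
    rcases le_or_gt q p with hqp | hqp
    · have h' : (p - q).Coprime q := (Nat.coprime_sub_self_left hqp).2 h
      exact hle p q hq hqp h' (ih _ (by omega) _ _ h' rfl)
    · have h' : p.Coprime (q - p) := (Nat.coprime_sub_self_right hqp.le).2 h
      exact hlt p q hp hqp h' (ih _ (by omega) _ _ h' rfl)

theorem swapAut_smul_euclidWord (p q : ℕ) (h : p.Coprime q) :
    swapAut • curveOf (euclidWord p q) = curveOf (euclidWord q p) := by
  refine euclid_induction (P := fun p q => swapAut • curveOf (euclidWord p q) =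
    curveOf (euclidWord q p)) ?_ ?_ ?_ ?_ p q h
  · simp [euclidWord, smul_curveOf]
  · simp [euclidWord, smul_curveOf]
  · intro p q hq hqp hc ih
    rcases hqp.eq_or_lt with rfl | hlt
    · obtain rfl : q = 1 := by simpa using hc
      have : curveOf (FreeGroup.of 1 * FreeGroup.of 0) =
          curveOf (FreeGroup.of 0 * FreeGroup.of 1) := by
        rw [← curveOf_conj _ (FreeGroup.of 0)]; congr 1; group
      simpa [euclidWord, smul_curveOf] using this
    · rw [euclidWord_of_le hq hqp, euclidWord_of_lt hq hlt, ← smul_curveOf, ← smul_curveOf,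
        swapAut_twistAut_smul, ih]
  · intro p q hp hlt hc ih
    rw [euclidWord_of_lt hp hlt, euclidWord_of_le hp hlt.le, ← smul_curveOf, ← smul_curveOf,
      swapAut_twistAut'_smul, ih]

theorem ellipticAut_smul_euclidWord (p q : ℕ) (h : p.Coprime q) :
    ellipticAut • curveOf (euclidWord p q) = curveOf (euclidWord p q) := by
  refine euclid_induction (P := fun p q => ellipticAut • curveOf (euclidWord p q) =
    curveOf (euclidWord p q)) ?_ ?_ ?_ ?_ p q h
  · simp [euclidWord, smul_curveOf, curveOf_inv]
  · simp [euclidWord, smul_curveOf, curveOf_inv]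
  · intro p q hq hqp hc ih
    rw [euclidWord_of_le hq hqp, ← smul_curveOf, ellipticAut_twistAut_smul, ih]
  · intro p q hp hlt hc ih
    rw [euclidWord_of_lt hp hlt, ← smul_curveOf, ellipticAut_twistAut'_smul, ih]

/-- The simple closed curve with homology class `±(p, q)`, for coprime `p` and `q`. -/
def curveOfHomology (p q : ℤ) : Curve :=
  if 0 ≤ p * q then curveOf (euclidWord p.natAbs q.natAbs)
  else flipAut • curveOf (euclidWord p.natAbs q.natAbs)

theorem curveOfHomology_neg (p q : ℤ) : curveOfHomology (-p) (-q) = curveOfHomology p q := by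
  simp [curveOfHomology]

theorem curveOfHomology_natCast (p q : ℕ) :
    curveOfHomology p q = curveOf (euclidWord p q) := by
  rw [curveOfHomology, if_pos (by positivity), Int.natAbs_natCast, Int.natAbs_natCast]

theorem curveOfHomology_natCast_neg (p q : ℕ) (h : p.Coprime q) :
    curveOfHomology p (-q) = flipAut • curveOf (euclidWord p q) := by
  rw [curveOfHomology, Int.natAbs_neg, Int.natAbs_natCast, Int.natAbs_natCast]
  split_ifs with h0
  · have : p = 0 ∨ q = 0 := by
      by_contra! hne
      have hp : (0 : ℤ) < p := by exact_mod_cast Nat.pos_of_ne_zero hne.1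
      have hq : (0 : ℤ) < q := by exact_mod_cast Nat.pos_of_ne_zero hne.2
      nlinarith
    rcases this with rfl | rfl
    · simp [euclidWord, smul_curveOf, curveOf_inv]
    · obtain rfl : p = 1 := by simpa using h
      simp [euclidWord, smul_curveOf]
  · rfl

/-- Up to a common sign, two coprime integers are `p, q` or `p, -q` with `p` and `q` natural. -/
theorem coprime_sign_induction {P : ℤ → ℤ → Prop} (hneg : ∀ p q, P (-p) (-q) → P p q)
    (hpos : ∀ p q : ℕ, p.Coprime q → P p q) (hmix : ∀ p q : ℕ, p.Coprime q → P p (-q))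
    (p q : ℤ) (h : IsCoprime p q) : P p q := by
  have hc := Int.isCoprime_iff_gcd_eq_one.1 h
  obtain ⟨m, rfl | rfl⟩ := Int.eq_nat_or_neg p <;> obtain ⟨n, rfl | rfl⟩ := Int.eq_nat_or_neg q <;>
    simp only [Int.gcd_neg, Int.neg_gcd, Int.gcd_natCast_natCast] at hc
  · exact hpos m n hc
  · exact hmix m n hc
  · exact hneg _ _ (by simpa using hmix m n hc)
  · exact hneg _ _ (by simpa using hpos m n hc)

theorem flipAut_smul_curveOfHomology (p q : ℤ) (h : IsCoprime p q) :
    flipAut • curveOfHomology p q = curveOfHomology p (-q) := by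
  refine coprime_sign_induction (P := fun p q => flipAut • curveOfHomology p q =
    curveOfHomology p (-q)) ?_ ?_ ?_ p q h
  · intro p q h
    rwa [curveOfHomology_neg, curveOfHomology_neg] at h
  · intro p q h
    rw [curveOfHomology_natCast, curveOfHomology_natCast_neg p q h]
  · intro p q h
    rw [neg_neg, curveOfHomology_natCast, curveOfHomology_natCast_neg p q h, flipAut_flipAut_smul]

theorem swapAut_smul_curveOfHomology (p q : ℤ) (h : IsCoprime p q) :
    swapAut • curveOfHomology p q = curveOfHomology q p := by
  refine coprime_sign_induction (P := fun p q => swapAut • curveOfHomology p q =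
    curveOfHomology q p) ?_ ?_ ?_ p q h
  · intro p q h
    rwa [curveOfHomology_neg, curveOfHomology_neg] at h
  · intro p q h
    rw [curveOfHomology_natCast, curveOfHomology_natCast, swapAut_smul_euclidWord p q h]
  · intro p q h
    rw [← curveOfHomology_neg (-q), neg_neg, curveOfHomology_natCast_neg p q h,
      curveOfHomology_natCast_neg q p h.symm, swapAut_flipAut_smul,
      ellipticAut_smul_euclidWord p q h, swapAut_smul_euclidWord p q h]

theorem twistAut_smul_curveOfHomology (p q : ℤ) (h : IsCoprime p q) :
    twistAut • curveOfHomology p q = curveOfHomology (p + q) q := by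
  refine coprime_sign_induction (P := fun p q => twistAut • curveOfHomology p q =
    curveOfHomology (p + q) q) ?_ ?_ ?_ p q h
  · intro p q h
    rwa [← neg_add, curveOfHomology_neg, curveOfHomology_neg] at h
  · intro p q h
    rw [← Nat.cast_add, curveOfHomology_natCast, curveOfHomology_natCast]
    rcases Nat.eq_zero_or_pos q with rfl | hq
    · obtain rfl : p = 1 := by simpa using h
      simp [euclidWord, smul_curveOf]
    · rw [euclidWord_of_le hq (Nat.le_add_left q p), Nat.add_sub_cancel, smul_curveOf]
  · intro p q h
    rw [curveOfHomology_natCast_neg p q h]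
    rcases Nat.eq_zero_or_pos q with rfl | hq
    · obtain rfl : p = 1 := by simpa using h
      simp [euclidWord, smul_curveOf, curveOfHomology]
    rcases le_or_gt q p with hqp | hqp
    · have hc : (p - q).Coprime q := (Nat.coprime_sub_self_left hqp).2 h
      rw [euclidWord_of_le hq hqp, ← smul_curveOf, twistAut_flipAut_twistAut_smul,
        ← curveOfHomology_natCast_neg _ _ hc, Nat.cast_sub hqp, sub_eq_add_neg]
    rcases Nat.eq_zero_or_pos p with rfl | hp
    · obtain rfl : q = 1 := by simpa using h
      have : curveOf ((FreeGroup.of 1)⁻¹ * (FreeGroup.of 0)⁻¹) =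
          curveOf (FreeGroup.of 0 * FreeGroup.of 1) := by
        rw [← mul_inv_rev, curveOf_inv]
      simpa [euclidWord, smul_curveOf, curveOfHomology] using this
    · have hc : p.Coprime (q - p) := (Nat.coprime_sub_self_right hqp.le).2 h
      rw [euclidWord_of_lt hp hqp, ← smul_curveOf, twistAut_flipAut_twistAut'_smul,
        ellipticAut_smul_euclidWord _ _ hc, swapAut_smul_euclidWord _ _ hc,
        ← curveOfHomology_neg, neg_neg, show -((p : ℤ) + -q) = ((q - p : ℕ) : ℤ) by
          rw [Nat.cast_sub hqp.le]; ring, curveOfHomology_natCast,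
        euclidWord_of_lt (Nat.sub_pos_of_lt hqp) (Nat.sub_lt hq hp), smul_curveOf,
        Nat.sub_sub_self hqp.le]

/-! ### Homology classes of simple closed curves -/

theorem exponentSum_one : exponentSum 1 = 0 := by simp [exponentSum]

theorem exponentSum_mul (g h : Γ) : exponentSum (g * h) = exponentSum g + exponentSum h := by
  simp [exponentSum]

theorem exponentSum_inv (g : Γ) : exponentSum g⁻¹ = -exponentSum g := by
  simp [exponentSum]

theorem exponentSum_of (i : Fin 2) : exponentSum (FreeGroup.of i) = Pi.single i 1 := by
  simp [exponentSum]

theorem exponentSum_zpow (g : Γ) (n : ℤ) : exponentSum (g ^ n) = n • exponentSum g := by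
  simp [exponentSum]

theorem exponentSum_apply (β : MulAut Γ) (g : Γ) :
    exponentSum (β g) = exponentSum g 0 • exponentSum (β (FreeGroup.of 0)) +
      exponentSum g 1 • exponentSum (β (FreeGroup.of 1)) := by
  induction g using FreeGroup.induction_on with
  | C1 => simp [exponentSum_one]
  | of i => fin_cases i <;> simp [exponentSum_of]
  | inv_of i h => simp only [map_inv, exponentSum_inv, h, Pi.neg_apply, neg_smul, neg_add]
  | mul g h hg hh =>
    simp only [map_mul, exponentSum_mul, hg, hh, Pi.add_apply, add_smul]
    abel

/-- The algebraic intersection number of the homology classes of two elements of `Γ`. -/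
def intersectionNumber (g h : Γ) : ℤ :=
  exponentSum g 0 * exponentSum h 1 - exponentSum h 0 * exponentSum g 1

theorem intersectionNumber_apply (β : MulAut Γ) (g h : Γ) :
    intersectionNumber (β g) (β h) =
      intersectionNumber (β (FreeGroup.of 0)) (β (FreeGroup.of 1)) * intersectionNumber g h := by
  simp only [intersectionNumber, exponentSum_apply β g, exponentSum_apply β h, Pi.add_apply,
    Pi.smul_apply, smul_eq_mul]
  ring

theorem intersectionNumber_of : intersectionNumber (FreeGroup.of 0) (FreeGroup.of 1) = 1 := by
  simp [intersectionNumber, exponentSum_of]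

theorem isUnit_intersectionNumber (β : MulAut Γ) :
    IsUnit (intersectionNumber (β (FreeGroup.of 0)) (β (FreeGroup.of 1))) := by
  have h := intersectionNumber_apply β (β⁻¹ (FreeGroup.of 0)) (β⁻¹ (FreeGroup.of 1))
  rw [MulAut.apply_inv_self, MulAut.apply_inv_self, intersectionNumber_of] at h
  exact IsUnit.of_mul_eq_one _ h.symm

theorem isCoprime_exponentSum_apply (β : MulAut Γ) {g : Γ}
    (h : IsCoprime (exponentSum g 0) (exponentSum g 1)) :
    IsCoprime (exponentSum (β g) 0) (exponentSum (β g) 1) := by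
  obtain ⟨s, r, hrs⟩ := h
  have h1 : intersectionNumber g (FreeGroup.of 0 ^ (-r) * FreeGroup.of 1 ^ s) = 1 := by
    simp [intersectionNumber, exponentSum_mul, exponentSum_zpow, exponentSum_of,
      -zpow_neg]
    linarith
  have h2 := intersectionNumber_apply β g (FreeGroup.of 0 ^ (-r) * FreeGroup.of 1 ^ s)
  rw [h1, mul_one] at h2
  set h := β (FreeGroup.of 0 ^ (-r) * FreeGroup.of 1 ^ s)
  obtain ⟨u, hu⟩ := isUnit_intersectionNumber β
  rw [← hu] at h2
  refine ⟨exponentSum h 1 * ↑u⁻¹, -exponentSum h 0 * ↑u⁻¹, ?_⟩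
  have h3 : (u : ℤ) * ↑u⁻¹ = 1 := u.mul_inv
  rw [← h3, ← h2, intersectionNumber]
  ring

theorem IsPrimitive.isCoprime_exponentSum {g : Γ} (hg : IsPrimitive g) :
    IsCoprime (exponentSum g 0) (exponentSum g 1) := by
  obtain ⟨β, rfl⟩ := hg
  exact isCoprime_exponentSum_apply β (by simp [exponentSum_of, isCoprime_one_left])

/-- The action of automorphisms on simple closed curves is the action on their homology classes. -/
theorem smul_curveOfHomology (β : MulAut Γ) (g : Γ)
    (h : IsCoprime (exponentSum g 0) (exponentSum g 1)) :
    β • curveOfHomology (exponentSum g 0) (exponentSum g 1) =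
      curveOfHomology (exponentSum (β g) 0) (exponentSum (β g) 1) := by
  have hβ : β ∈ Subgroup.closure
      ({swapAut, flipAut, twistAut} ∪ Set.range (MulAut.conj (G := Γ))) := by
    rw [closure_nielsen_eq_top]; trivial
  induction hβ using Subgroup.closure_induction generalizing g with
  | mem β hβ =>
    rw [exponentSum_apply β g]
    rcases hβ with (rfl | rfl | rfl) | ⟨c, rfl⟩
    · simpa [exponentSum_of] using swapAut_smul_curveOfHomology _ _ h
    · simpa [exponentSum_of, exponentSum_inv] using flipAut_smul_curveOfHomology _ _ h
    · simpa [exponentSum_of, exponentSum_mul] using twistAut_smul_curveOfHomology _ _ h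
    · simp [exponentSum_of, exponentSum_mul, exponentSum_inv, conj_smul]
  | one => rw [one_smul, MulAut.one_apply]
  | mul β γ _ _ ihβ ihγ =>
    rw [mul_smul, ihγ g h, ihβ _ (isCoprime_exponentSum_apply γ h), MulAut.mul_apply]
  | inv β _ ih =>
    have := ih _ (isCoprime_exponentSum_apply β⁻¹ h)
    rw [MulAut.apply_inv_self] at this
    rw [← this, inv_smul_smul]

/-- A simple closed curve is determined by its homology class. -/
theorem IsPrimitive.curveOf_eq {g : Γ} (hg : IsPrimitive g) :
    curveOf g = curveOfHomology (exponentSum g 0) (exponentSum g 1) := by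
  obtain ⟨β, rfl⟩ := hg
  rw [← smul_curveOfHomology β _ (by simp [exponentSum_of, isCoprime_one_left]), ← smul_curveOf]
  simp [exponentSum_of, curveOfHomology, euclidWord]

theorem exists_aut_exponentSum_eq (p q : ℤ) (h : IsCoprime p q) :
    ∃ β : MulAut Γ, exponentSum (β (FreeGroup.of 0)) = ![p, q] := by
  have hnat (p q : ℕ) (h : p.Coprime q) :
      ∃ β : MulAut Γ, exponentSum (β (FreeGroup.of 0)) = ![(p : ℤ), (q : ℤ)] := by
    refine euclid_induction
      (P := fun p q => ∃ β : MulAut Γ, exponentSum (β (FreeGroup.of 0)) = ![(p : ℤ), (q : ℤ)])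
      ?_ ?_ ?_ ?_ p q h
    · exact ⟨swapAut, by ext i; fin_cases i <;> simp [exponentSum_of]⟩
    · exact ⟨1, by ext i; fin_cases i <;> simp [exponentSum_of]⟩
    · rintro p q - hqp - ⟨β, hβ⟩
      refine ⟨twistAut * β, ?_⟩
      rw [MulAut.mul_apply, exponentSum_apply, hβ]
      ext i; fin_cases i <;> simp [exponentSum_of, exponentSum_mul, Nat.cast_sub hqp]
    · rintro p q - hqp - ⟨β, hβ⟩
      refine ⟨twistAut' * β, ?_⟩
      rw [MulAut.mul_apply, exponentSum_apply, hβ]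
      ext i; fin_cases i <;> simp [exponentSum_of, exponentSum_mul, Nat.cast_sub hqp.le]
  refine coprime_sign_induction
    (P := fun p q => ∃ β : MulAut Γ, exponentSum (β (FreeGroup.of 0)) = ![p, q]) ?_ hnat ?_ p q h
  · rintro p q ⟨β, hβ⟩
    refine ⟨ellipticAut * β, ?_⟩
    rw [MulAut.mul_apply, exponentSum_apply, hβ]
    ext i; fin_cases i <;> simp [exponentSum_of, exponentSum_inv]
  · intro p q h
    obtain ⟨β, hβ⟩ := hnat p q h
    refine ⟨flipAut * β, ?_⟩
    rw [MulAut.mul_apply, exponentSum_apply, hβ]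
    ext i; fin_cases i <;> simp [exponentSum_of, exponentSum_inv]

/-- The slope of an element of `Γ`: the region given by its homology class. -/
def slopeOf (g : Γ) : Region := slope (exponentSum g 0) (exponentSum g 1)

theorem slopeOf_inv (g : Γ) : slopeOf g⁻¹ = slopeOf g := by
  rw [slopeOf, exponentSum_inv]
  exact slope_neg _ _

/-- The slope of a simple closed curve. -/
def curveSlope (c : SimpleCurve) : Region :=
  Quotient.lift slopeOf (by
    have hconj {g h : Γ} (hgh : IsConj g h) : slopeOf g = slopeOf h := by
      obtain ⟨c, rfl⟩ := isConj_iff.1 hgh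
      simp [slopeOf, exponentSum_mul, exponentSum_inv]
    rintro g h (hc | hc)
    · exact hconj hc
    · rw [hconj hc, slopeOf_inv]) c.1

/-- The simple closed curve represented by the image of `a` under an automorphism. -/
def simpleCurveOf (β : MulAut Γ) : SimpleCurve :=
  ⟨curveOf (β (FreeGroup.of 0)), β (FreeGroup.of 0), ⟨β, rfl⟩, rfl⟩

theorem exists_simpleCurveOf_eq (c : SimpleCurve) : ∃ β, simpleCurveOf β = c := by
  obtain ⟨c, g, ⟨β, rfl⟩, rfl⟩ := c
  exact ⟨β, rfl⟩

theorem curveSlope_simpleCurveOf (β : MulAut Γ) :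
    curveSlope (simpleCurveOf β) = slopeOf (β (FreeGroup.of 0)) := rfl

theorem bijective_curveSlope : Function.Bijective curveSlope := by
  constructor
  · intro c d hcd
    obtain ⟨β, rfl⟩ := exists_simpleCurveOf_eq c
    obtain ⟨γ, rfl⟩ := exists_simpleCurveOf_eq d
    rw [curveSlope_simpleCurveOf, curveSlope_simpleCurveOf] at hcd
    have hβ : IsPrimitive (β (FreeGroup.of 0)) := ⟨β, rfl⟩
    have hγ : IsPrimitive (γ (FreeGroup.of 0)) := ⟨γ, rfl⟩
    refine Subtype.ext ?_
    change curveOf _ = curveOf _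
    rw [hβ.curveOf_eq, hγ.curveOf_eq]
    have key {g : Γ} (hg : IsPrimitive g) :
        curveOfHomology (exponentSum g 0) (exponentSum g 1) =
          curveOfHomology (slopeOf g).num (slopeOf g).den := by
      rcases num_den_slope hg.isCoprime_exponentSum with ⟨h1, h2⟩ | ⟨h1, h2⟩
      · rw [slopeOf, h1, h2]
      · rw [slopeOf, h1, h2, curveOfHomology_neg]
    rw [key hβ, key hγ, hcd]
  · intro X
    obtain ⟨β, hβ⟩ := exists_aut_exponentSum_eq _ _ (isCoprime_num_den X)
    refine ⟨simpleCurveOf β, ?_⟩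
    rw [curveSlope_simpleCurveOf, slopeOf, hβ]
    exact slope_num_den X

theorem curveSlope_smul {α : MulAut Γ} {H : SL(2, ℤ)} (hα : IsInducedBy α H) (c : SimpleCurve) :
    curveSlope (α • c) = moebius H • curveSlope c := by
  obtain ⟨β, rfl⟩ := exists_simpleCurveOf_eq c
  have hβ : IsPrimitive (β (FreeGroup.of 0)) := ⟨β, rfl⟩
  rw [curveSlope_simpleCurveOf, slopeOf, moebius_smul_slope H hβ.isCoprime_exponentSum]
  change slopeOf (α (β (FreeGroup.of 0))) = _
  rw [slopeOf, hα]
  simp [Matrix.mulVec, dotProduct, Fin.sum_univ_two]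

/-- Farey neighbours are the slopes of the two members of a free basis. -/
theorem FareyNeighbors.exists_aut {X Y : Region} (h : FareyNeighbors X Y) :
    ∃ β : MulAut Γ, slopeOf (β (FreeGroup.of 0)) = X ∧ slopeOf (β (FreeGroup.of 1)) = Y := by
  obtain ⟨β, hβ⟩ := exists_aut_exponentSum_eq _ _ (isCoprime_num_den X)
  have hδ := isUnit_intersectionNumber β
  set y := exponentSum (β (FreeGroup.of 1)) with hy
  rw [intersectionNumber, hβ, ← hy] at hδ
  simp only [Matrix.cons_val_zero, Matrix.cons_val_one] at hδ
  set m : ℤ := (X.num * Y.den - Y.num * X.den) * (Y.num * y 1 - y 0 * Y.den) with hm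
  -- the second basis element is corrected by a power of the first
  let γ : MulAut Γ := autOfBasis ![FreeGroup.of 0, FreeGroup.of 0 ^ m * FreeGroup.of 1]
    ![FreeGroup.of 0, FreeGroup.of 0 ^ (-m) * FreeGroup.of 1]
    (by intro i; fin_cases i <;> simp) (by intro i; fin_cases i <;> simp)
  have hγ0 : γ (FreeGroup.of 0) = FreeGroup.of 0 := autOfBasis_of _ _ 0
  have hγ1 : γ (FreeGroup.of 1) = FreeGroup.of 0 ^ m * FreeGroup.of 1 := autOfBasis_of _ _ 1
  refine ⟨β * γ, ?_, ?_⟩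
  · rw [MulAut.mul_apply, hγ0, slopeOf, hβ]; exact slope_num_den X
  · rw [MulAut.mul_apply, hγ1, slopeOf, map_mul, map_zpow, exponentSum_mul, exponentSum_zpow, hβ,
      ← hy]
    simp only [Pi.add_apply, Pi.smul_apply, Matrix.cons_val_zero, Matrix.cons_val_one, smul_eq_mul]
    rw [FareyNeighbors, ← Int.isUnit_iff_abs_eq] at h
    conv_rhs => rw [← slope_num_den Y]
    set p := X.num
    set q := X.den
    set r := Y.num
    set s := Y.den
    have he : (p * s - r * q) * (p * s - r * q) = 1 := by
      rcases Int.isUnit_iff.1 h with h | h <;> rw [h] <;> rfl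
    have h0 : m * p + y 0 = (p * s - r * q) * (p * y 1 - y 0 * q) * r := by
      rw [hm]; linear_combination (-y 0) * he
    have h1 : m * q + y 1 = (p * s - r * q) * (p * y 1 - y 0 * q) * s := by
      rw [hm]; linear_combination (-y 1) * he
    rw [h0, h1]
    rcases Int.isUnit_iff.1 (h.mul hδ) with hu | hu <;> rw [hu]
    · simp
    · rw [neg_one_mul, neg_one_mul, slope_neg]

/-- The two common Farey neighbours of the slopes of a free basis `x, y` are the slopes of `x y` and
`x⁻¹ y`. -/
theorem FareyNeighbors.eq_slopeOf {β : MulAut Γ} {Z : Region}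
    (h0 : FareyNeighbors (slopeOf (β (FreeGroup.of 0))) Z)
    (h1 : FareyNeighbors (slopeOf (β (FreeGroup.of 1))) Z) :
    Z = slopeOf (β (FreeGroup.of 0) * β (FreeGroup.of 1)) ∨
      Z = slopeOf ((β (FreeGroup.of 0))⁻¹ * β (FreeGroup.of 1)) := by
  have hc0 : IsCoprime (exponentSum (β (FreeGroup.of 0)) 0) (exponentSum (β (FreeGroup.of 0)) 1) :=
    IsPrimitive.isCoprime_exponentSum ⟨β, rfl⟩
  have hc1 : IsCoprime (exponentSum (β (FreeGroup.of 1)) 0) (exponentSum (β (FreeGroup.of 1)) 1) :=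
    IsPrimitive.isCoprime_exponentSum ⟨β * swapAut, by simp⟩
  have hδ := isUnit_intersectionNumber β
  rw [intersectionNumber] at hδ
  rw [slopeOf, slopeOf, exponentSum_mul, exponentSum_mul, exponentSum_inv]
  rw [slopeOf, ← slope_num_den Z, fareyNeighbors_slope hc0 (isCoprime_num_den Z),
    ← Int.isUnit_iff_abs_eq] at h0
  rw [slopeOf, ← slope_num_den Z, fareyNeighbors_slope hc1 (isCoprime_num_den Z),
    ← Int.isUnit_iff_abs_eq] at h1
  simp only [Pi.add_apply, Pi.neg_apply]
  conv_lhs => rw [← slope_num_den Z]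
  conv in Z = _ => rw [← slope_num_den Z]
  set x := exponentSum (β (FreeGroup.of 0))
  set y := exponentSum (β (FreeGroup.of 1))
  set r := Z.num
  set s := Z.den
  -- Cramer's rule
  have e0 : (x 0 * y 1 - y 0 * x 1) * r =
      -(y 0 * s - r * y 1) * x 0 + (x 0 * s - r * x 1) * y 0 := by ring
  have e1 : (x 0 * y 1 - y 0 * x 1) * s =
      -(y 0 * s - r * y 1) * x 1 + (x 0 * s - r * x 1) * y 1 := by ring
  have key : (r = x 0 + y 0 ∧ s = x 1 + y 1) ∨ (r = -(x 0 + y 0) ∧ s = -(x 1 + y 1)) ∨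
      (r = -x 0 + y 0 ∧ s = -x 1 + y 1) ∨ (r = -(-x 0 + y 0) ∧ s = -(-x 1 + y 1)) := by
    rcases Int.isUnit_iff.1 hδ with h | h <;> rcases Int.isUnit_iff.1 h0 with h' | h' <;>
      rcases Int.isUnit_iff.1 h1 with h'' | h'' <;> rw [h, h', h''] at e0 e1 <;> omega
  rcases key with ⟨hr, hs⟩ | ⟨hr, hs⟩ | ⟨hr, hs⟩ | ⟨hr, hs⟩ <;> rw [hr, hs]
  · exact Or.inl rfl
  · exact Or.inl (slope_neg _ _)
  · exact Or.inr rfl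
  · exact Or.inr (slope_neg _ _)

/-! ### Trace functions as Markoff maps -/

theorem trace_inv_mul (A B : SL(2, ℂ)) :
    (A⁻¹ * B).val.trace = A.val.trace * B.val.trace - (A * B).val.trace := by
  rw [Matrix.SpecialLinearGroup.coe_mul, Matrix.SpecialLinearGroup.coe_mul,
    Matrix.SpecialLinearGroup.coe_inv, Matrix.adjugate_fin_two]
  simp only [Matrix.trace_fin_two, Matrix.mul_apply, Fin.sum_univ_two, Matrix.of_apply,
    Matrix.cons_val', Matrix.cons_val_zero, Matrix.cons_val_one, Matrix.cons_val_fin_one]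
  ring

/-- Fricke's trace identity. -/
theorem trace_commutator (A B : SL(2, ℂ)) :
    (A * B * A⁻¹ * B⁻¹).val.trace = A.val.trace ^ 2 + B.val.trace ^ 2 + (A * B).val.trace ^ 2 -
      A.val.trace * B.val.trace * (A * B).val.trace - 2 := by
  have hone : (1 : SL(2, ℂ)).val.trace = 2 := by simp
  have e1 : (A * B * A⁻¹ * B⁻¹).val.trace = (B⁻¹ * (A * B * A⁻¹)).val.trace :=
    trace_eq_of_isConj (isConj_iff.2 ⟨B⁻¹, by group⟩)
  have e2 : (A * B * A⁻¹).val.trace = B.val.trace :=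
    trace_eq_of_isConj (isConj_iff.2 ⟨A⁻¹, by group⟩)
  have e3 : (B * (A * B * A⁻¹)).val.trace = (A⁻¹ * B * (A * B)).val.trace :=
    trace_eq_of_isConj (isConj_iff.2 ⟨A⁻¹, by group⟩)
  have e4 : ((A⁻¹ * B)⁻¹ * (A * B)).val.trace = (A * A).val.trace :=
    trace_eq_of_isConj (isConj_iff.2 ⟨B, by group⟩)
  have e5 := trace_inv_mul (A⁻¹ * B) (A * B)
  have e6 := trace_inv_mul A A
  rw [inv_mul_cancel, hone] at e6
  rw [e1, trace_inv_mul, e2, e3]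
  rw [e4, trace_inv_mul A B] at e5
  linear_combination e6 - e5

/-- Every automorphism maps the boundary curve to itself or its inverse, up to conjugation. -/
theorem smul_curveOf_commutator (β : MulAut Γ) :
    β • curveOf (FreeGroup.of 0 * FreeGroup.of 1 * (FreeGroup.of 0)⁻¹ * (FreeGroup.of 1)⁻¹) =
      curveOf (FreeGroup.of 0 * FreeGroup.of 1 * (FreeGroup.of 0)⁻¹ * (FreeGroup.of 1)⁻¹) := by
  have hβ : β ∈ Subgroup.closure
      ({swapAut, flipAut, twistAut} ∪ Set.range (MulAut.conj (G := Γ))) := by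
    rw [closure_nielsen_eq_top]; trivial
  rw [← MulAction.mem_stabilizer_iff]
  refine (Subgroup.closure_le _).2 ?_ hβ
  rintro β ((rfl | rfl | rfl) | ⟨c, rfl⟩) <;>
    rw [SetLike.mem_coe, MulAction.mem_stabilizer_iff]
  · rw [smul_curveOf, ← curveOf_inv]; exact congrArg curveOf (by simp [mul_assoc])
  · rw [smul_curveOf, ← curveOf_inv, ← curveOf_conj _ (FreeGroup.of 1)]
    congr 1; simp [mul_assoc]
  · rw [smul_curveOf, ← curveOf_conj _ (FreeGroup.of 0)⁻¹]; congr 1; simp [mul_assoc]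
  · exact conj_smul c _

/-- Simple closed curves correspond to their slopes. -/
def curveEquiv : SimpleCurve ≃ Region := Equiv.ofBijective curveSlope bijective_curveSlope

/-- The trace of `ρ` on the simple closed curve of a given slope. -/
def slopeTrace (ρ : Γ →* SL(2, ℂ)) (X : Region) : ℂ := curveTrace ρ (curveEquiv.symm X).1

theorem slopeTrace_curveEquiv (ρ : Γ →* SL(2, ℂ)) (c : SimpleCurve) :
    slopeTrace ρ (curveEquiv c) = curveTrace ρ c.1 := by
  rw [slopeTrace, Equiv.symm_apply_apply]

theorem slopeTrace_slopeOf (ρ : Γ →* SL(2, ℂ)) {g : Γ} (hg : IsPrimitive g) :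
    slopeTrace ρ (slopeOf g) = (ρ g).val.trace := by
  obtain ⟨β, rfl⟩ := hg
  exact slopeTrace_curveEquiv ρ (simpleCurveOf β)

/-- The trace of `ρ` as a function of the slope is a generalized Markoff map: the vertex relation is
Fricke's identity together with the invariance of the boundary curve, and the edge relation is
`tr (AB) + tr (A⁻¹B) = tr A tr B`. -/
theorem isMarkoffMap_slopeTrace {τ : ℂ} {ρ : Γ →* SL(2, ℂ)} (hρ : IsTauRepresentation τ ρ) :
    IsMarkoffMap (τ + 2) (slopeTrace ρ) := by
  have hx (β : MulAut Γ) : slopeTrace ρ (slopeOf (β (FreeGroup.of 0))) =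
      (ρ (β (FreeGroup.of 0))).val.trace := slopeTrace_slopeOf ρ ⟨β, rfl⟩
  have hy (β : MulAut Γ) : slopeTrace ρ (slopeOf (β (FreeGroup.of 1))) =
      (ρ (β (FreeGroup.of 1))).val.trace := slopeTrace_slopeOf ρ ⟨β * swapAut, by simp⟩
  have hz (β : MulAut Γ) : slopeTrace ρ (slopeOf (β (FreeGroup.of 0) * β (FreeGroup.of 1))) =
      (ρ (β (FreeGroup.of 0)) * ρ (β (FreeGroup.of 1))).val.trace := by
    rw [slopeTrace_slopeOf ρ ⟨β * twistAut', by simp⟩, map_mul]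
  have hw (β : MulAut Γ) : slopeTrace ρ (slopeOf ((β (FreeGroup.of 0))⁻¹ * β (FreeGroup.of 1))) =
      (ρ (β (FreeGroup.of 0))).val.trace * (ρ (β (FreeGroup.of 1))).val.trace -
        (ρ (β (FreeGroup.of 0)) * ρ (β (FreeGroup.of 1))).val.trace := by
    rw [slopeTrace_slopeOf ρ ⟨β * flipAut * swapAut * twistAut * swapAut * ellipticAut, ?_⟩,
      map_mul, map_inv, trace_inv_mul]
    simp
  have hfricke (β : MulAut Γ) := trace_commutator (ρ (β (FreeGroup.of 0))) (ρ (β (FreeGroup.of 1)))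
  have hτ (β : MulAut Γ) : (ρ (β (FreeGroup.of 0)) * ρ (β (FreeGroup.of 1)) *
      (ρ (β (FreeGroup.of 0)))⁻¹ * (ρ (β (FreeGroup.of 1)))⁻¹).val.trace = τ := by
    have h := congrArg (curveTrace ρ) (smul_curveOf_commutator β)
    rw [smul_curveOf] at h
    simp only [map_mul, map_inv] at h
    have h' : (ρ (β (FreeGroup.of 0) * β (FreeGroup.of 1) * (β (FreeGroup.of 0))⁻¹ *
      (β (FreeGroup.of 1))⁻¹)).val.trace = _ := h
    simp only [map_mul, map_inv] at h'
    rw [h']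
    exact hρ
  constructor
  · intro X Y Z hXY hYZ hZX
    obtain ⟨β, rfl, rfl⟩ := hXY.exists_aut
    have h := hfricke β
    rw [hτ] at h
    rw [hx, hy]
    rcases FareyNeighbors.eq_slopeOf hZX.symm hYZ with rfl | rfl
    · rw [hz]; linear_combination -h
    · rw [hw]; linear_combination -h
  · intro X Y Z W hXY hXZ hYZ hXW hYW hZW
    obtain ⟨β, rfl, rfl⟩ := hXY.exists_aut
    rw [hx, hy]
    rcases FareyNeighbors.eq_slopeOf hXZ hYZ with rfl | rfl <;>
      rcases FareyNeighbors.eq_slopeOf hXW hYW with rfl | rfl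
    · exact absurd rfl hZW
    · rw [hz, hw]; ring
    · rw [hz, hw]; ring
    · exact absurd rfl hZW

/-! ### Transport to representations -/

/-- An equivariant bijection induces a bijection of the sets of orbits. -/
def cyclicQuotientEquiv {G G' C C' : Type*} [Group G] [Group G'] [MulAction G C]
    [MulAction G' C'] {g : G} {g' : G'} (e : C ≃ C') (h : ∀ c, e (g • c) = g' • e c) :
    CyclicQuotient C g ≃ CyclicQuotient C' g' :=
  have hz (n : ℤ) (c : C) : e (g ^ n • c) = g' ^ n • e c := by
    induction n using Int.induction_on generalizing c with
    | zero => simp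
    | succ i ih => rw [zpow_add_one, zpow_add_one, mul_smul, mul_smul, ih, h]
    | pred i ih =>
      have h' : e (g⁻¹ • c) = g'⁻¹ • e c := by rw [eq_inv_smul_iff, ← h, smul_inv_smul]
      rw [zpow_sub_one, zpow_sub_one, mul_smul, mul_smul, ih, h']
  Quotient.congr e fun c d => by
    change c ∈ MulAction.orbit _ d ↔ e c ∈ MulAction.orbit _ (e d)
    constructor
    · rintro ⟨⟨_, n, rfl⟩, rfl⟩
      exact ⟨⟨_, n, rfl⟩, (hz n d).symm⟩
    · rintro ⟨⟨_, n, rfl⟩, hn⟩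
      exact ⟨⟨_, n, rfl⟩, e.injective ((hz n d).trans hn)⟩

theorem slopeTrace_moebius {ρ : Γ →* SL(2, ℂ)} {α : MulAut Γ} {H : SL(2, ℤ)}
    (hα : IsInducedBy α H) (hs : IsStabilizedBy ρ α) (X : Region) :
    slopeTrace ρ (moebius H • X) = slopeTrace ρ X := by
  obtain ⟨c, rfl⟩ := curveEquiv.surjective X
  rw [show moebius H • curveEquiv c = curveEquiv (α • c) from (curveSlope_smul hα c).symm,
    slopeTrace_curveEquiv, slopeTrace_curveEquiv, curveTrace_smul hs]

/-- McShane's identity for a representation stabilized by a hyperbolic mapping class. -/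
theorem orbitTrace_identity {τ : ℂ} (hτ : τ ≠ 2) {ρ : Γ →* SL(2, ℂ)}
    (hρ : IsTauRepresentation τ ρ) {H : SL(2, ℤ)} (hH : H.val.IsHyperbolic) {α : MulAut Γ}
    (hα : IsInducedBy α H) (hs : IsStabilizedBy ρ α) (hBQ : SatisfiesBQ (orbitTrace ρ α hs)) :
    (∀ c, orbitTrace ρ α hs c ^ 2 ≠ τ + 2) ∧
      Summable (fun c => ‖gap τ (orbitTrace ρ α hs c)‖) ∧
      ∃ n : ℤ, ∑' c, gap τ (orbitTrace ρ α hs c) = n * (2 * Real.pi * Complex.I) := by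
  have hinv := slopeTrace_moebius hα hs
  let E : CyclicQuotient SimpleCurve α ≃ CyclicQuotient Region (moebius H) :=
    cyclicQuotientEquiv curveEquiv (curveSlope_smul hα)
  have hE (c) : orbitMarkoff (slopeTrace ρ) H hinv (E c) = orbitTrace ρ α hs c := by
    induction c using Quotient.inductionOn with
    | h c => exact slopeTrace_curveEquiv ρ c
  have hE' (X) : orbitTrace ρ α hs (E.symm X) = orbitMarkoff (slopeTrace ρ) H hinv X := by
    rw [← hE, Equiv.apply_symm_apply]
  have hBQ' : SatisfiesBQ (orbitMarkoff (slopeTrace ρ) H hinv) := by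
    refine ⟨fun X => hE' X ▸ hBQ.1 _, (hBQ.2.image E).subset fun X hX => ⟨E.symm X, ?_, by simp⟩⟩
    rw [Set.mem_ofPred_eq, hE']
    exact hX
  have hμ : τ + 2 ≠ 4 := fun h => hτ (by linear_combination h)
  obtain ⟨h1, h2, n, h3⟩ :=
    orbitMarkoff_identity hμ (isMarkoffMap_slopeTrace hρ) hH hinv hBQ'
  rw [add_sub_cancel_right] at h2 h3
  refine ⟨fun c => hE c ▸ h1 _, ?_, n, ?_⟩
  · simpa only [Function.comp_def, hE] using (E.summable_iff).2 h2
  · rw [← h3, ← E.tsum_eq]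
    simp only [hE]

end PuncturedTorus

end

theorem theorem2p5 :
    -- representations
    (∀ (τ : ℂ) (_ : τ ≠ 2) (ρ : PuncturedTorus.Γ →* SL(2, ℂ))
        (_ : PuncturedTorus.IsTauRepresentation τ ρ)
        (H : SL(2, ℤ)) (_ : H.val.IsHyperbolic)
        (α : MulAut PuncturedTorus.Γ) (_ : PuncturedTorus.IsInducedBy α H)
        (hs : PuncturedTorus.IsStabilizedBy ρ α)
        (_ : PuncturedTorus.SatisfiesBQ (PuncturedTorus.orbitTrace ρ α hs)),
      (∀ c, PuncturedTorus.orbitTrace ρ α hs c ^ 2 ≠ τ + 2) ∧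
      Summable (fun c => ‖PuncturedTorus.gap τ (PuncturedTorus.orbitTrace ρ α hs c)‖) ∧
      ∃ n : ℤ, ∑' c, PuncturedTorus.gap τ (PuncturedTorus.orbitTrace ρ α hs c) =
        n * (2 * Real.pi * Complex.I)) ∧
    -- generalized Markoff maps
    (∀ (μ : ℂ) (_ : μ ≠ 4) (φ : PuncturedTorus.Region → ℂ)
        (_ : PuncturedTorus.IsMarkoffMap μ φ)
        (H : SL(2, ℤ)) (_ : H.val.IsHyperbolic)
        (hs : ∀ X : PuncturedTorus.Region, φ (PuncturedTorus.moebius H • X) = φ X)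
        (_ : PuncturedTorus.SatisfiesBQ (PuncturedTorus.orbitMarkoff φ H hs)),
      (∀ c, PuncturedTorus.orbitMarkoff φ H hs c ^ 2 ≠ μ) ∧
      Summable (fun c => ‖PuncturedTorus.gap (μ - 2) (PuncturedTorus.orbitMarkoff φ H hs c)‖) ∧
      ∃ n : ℤ, ∑' c, PuncturedTorus.gap (μ - 2) (PuncturedTorus.orbitMarkoff φ H hs c) =
        n * (2 * Real.pi * Complex.I)) := by
  exact ⟨fun _ hτ _ hρ _ hH _ hα hs hBQ => PuncturedTorus.orbitTrace_identity hτ hρ hH hα hs hBQ,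
    fun _ hμ _ hφ _ hH hs hBQ => PuncturedTorus.orbitMarkoff_identity hμ hφ hH hs hBQ⟩
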